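/- Let $\mathbf{S}$ be the $\mathbb{Q}$-vector space with basis the graded permutations $(\sigma,d)$, $\sigma\in\mathfrak{S}_k$, $d:\{1,\dots,k\}\to\mathbb{N}^*$, $k\ge 0$, written as biwords with biletters $(\sigma(i),d(i))$; the weight of $(\sigma,d)$ is $d(1)+\dots+d(k)$, and $\mathbf{S}_+$ is the span of those with $k\ge 1$. For $\sigma\in\mathfrak{S}_k$ let $(\sigma,d)\prec(\tau,e)$ (resp. $(\sigma,d)\succ(\tau,e)$) be the sum of all shuffles of the biword of $(\sigma,d)$ with the biword of $(\tau,e)$ in which the letters of $\tau$ are increased by $k$, that begin with the first biletter of $(\sigma,d)$ (resp. of $(\tau,e)$). Let $\Delta_\prec(\sigma,d)$ (resp. $\Delta_\succ(\sigma,d)$) be the sum of $\mathrm{std}(u)\otimes\mathrm{std}(v)$ over all ways of cutting the biword into two nonempty parts $u\,v$ such that the letter $1$ of the first row lies in $u$ (resp. in $v$), where $\mathrm{std}$ standardizes the first row. These half-products are the ones of endomorphisms of shuffle algebras: for every graded alphabet $X=\bigsqcup_{n\ge1}X_n$ with all $X_n$ infinite, let $(\sigma,d)$ act on the span $Sh(X)$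 of the words over $X$ by $x_1\cdots x_k\mapsto x_{\sigma(1)}\cdots x_{\sigma(k)}$ if $|x_{\sigma(i)}|=d(i)$ for all $i$, and by $0$ on all other words; then the induced linear map $\mathbf{S}\to End(Sh(X))$ is injective and compatible with $\prec$ and $\succ$, where on $End(Sh(X))$ one sets $f\prec g=\prec\circ(f\otimes g)\circ\Delta$ and $f\succ g=\succ\circ(f\otimes g)\circ\Delta$, with the half-shuffles $\prec,\succ$ of words ($w\prec 1=w$ for nonempty words $w$, $1\prec w=0$ for all words $w$, and $u\succ v=v\prec u$) and the deconcatenation coproduct $\Delta$. Then $(\mathbf{S}_+,\prec,\succ)$ is a (non-unital) dendriform algebra, freely generated by the subspace $Prim_{Dend}(\mathbf{S})=\mathrm{Ker}(\Delta_\prec)\cap\mathrm{Ker}(\Delta_\succ)\subseteq\mathbf{S}_+$ of dendriform primitive elements: every linear map from $Prim_{Dend}(\mathbf{S})$ to a dendriform $\mathbb{Q}$-algebra extends uniquely to a morphism of dendriform algebras on $\mathbf{S}_+$. Moreover the weight components of $\mathbf{S}$ are finite-dimensional, the generating series of their dimensions is $$R(x)=\Bigl(\sum_{k\ge0}k!\,x^k\Bigr)\circ\Bigl(\sum_{k\ge1}x^k\Bigr),$$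 and $Prim_{Dend}(\mathbf{S})$ is a graded subspace of $\mathbf{S}_+$ with generating series $$P(x)=\frac{R(x)-1}{R(x)^2}.$$ -/

import Mathlib

open scoped TensorProduct Nat

universe u v

namespace GradedPermutations

/-! ### Words, shuffles and half-shuffles -/

/-- The list (with multiplicities) of all shuffles of two words. -/
def shuffles {A : Type*} : List A → List A → List (List A)
  | [], v => [v]
  | a :: u, [] => [a :: u]
  | a :: u, b :: v =>
      (shuffles u (b :: v)).map (fun w => a :: w) ++
        (shuffles (a :: u) v).map (fun w => b :: w)
termination_by u v => u.length + v.length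

/-- The terms of the left half-shuffle `u ≺ v`: the shuffles of `u` and `v` that begin with the
first letter of `u`. By convention `w ≺ 1 = w` (for a nonempty word `w`) and `1 ≺ w = 0`.
The right half-shuffle is `u ≻ v = v ≺ u`. -/
def leftShuffles {A : Type*} : List A → List A → List (List A)
  | [], _ => []
  | a :: u, v => (shuffles u v).map (fun w => a :: w)

/-- The bilinear extension of a map given on pairs of basis elements. -/
noncomputable def bilinearExt {I J M : Type*} [AddCommGroup M] [Module ℚ M] (f : I → J → M) :
    (I →₀ ℚ) →ₗ[ℚ] (J →₀ ℚ) →ₗ[ℚ] M :=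
  Finsupp.linearCombination ℚ (fun i => Finsupp.linearCombination ℚ (f i))

/-! ### Dendriform algebras -/

/-- The two half-products `≺` and `≻` make the module `A` a (non-unital) dendriform algebra,
with associative product `x * y = x ≺ y + x ≻ y`. -/
structure IsDendriform {A : Type*} [AddCommGroup A] [Module ℚ A]
    (prec succ : A →ₗ[ℚ] A →ₗ[ℚ] A) : Prop where
  prec_prec : ∀ x y z, prec (prec x y) z = prec x (prec y z + succ y z)
  succ_succ : ∀ x y z, succ (prec x y + succ x y) z = succ x (succ y z)
  succ_prec : ∀ x y z, prec (succ x y) z = succ x (prec y z)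

/-- `A` is a dendriform algebra which is freely generated by its subspace `V`: every linear map
from `V` to a dendriform algebra `D` extends uniquely to a morphism of dendriform algebras. -/
def IsFreelyGeneratedBy {A : Type*} [AddCommGroup A] [Module ℚ A]
    (prec succ : A →ₗ[ℚ] A →ₗ[ℚ] A) (V : Submodule ℚ A) : Prop :=
  IsDendriform prec succ ∧
    ∀ (D : Type u) [AddCommGroup D] [Module ℚ D] (precD succD : D →ₗ[ℚ] D →ₗ[ℚ] D),
      IsDendriform precD succD → ∀ f : V →ₗ[ℚ] D,
        ∃! F : A →ₗ[ℚ] D,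
          (∀ x y, F (prec x y) = precD (F x) (F y)) ∧
          (∀ x y, F (succ x y) = succD (F x) (F y)) ∧
          ∀ a : V, F a = f a

/-! ### The shuffle algebra of an alphabet and its endomorphisms -/

/-- The vector space spanned by the words over the alphabet `X`. -/
abbrev Sh (X : Type*) := List X →₀ ℚ

/-- The left half-shuffle product `≺` on `Sh X`. -/
noncomputable def shPrec (X : Type*) : Sh X →ₗ[ℚ] Sh X →ₗ[ℚ] Sh X :=
  bilinearExt fun u v => ((leftShuffles u v).map fun w => Finsupp.single w (1 : ℚ)).sum

/-- The right half-shuffle product `≻` on `Sh X`. -/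
noncomputable def shSucc (X : Type*) : Sh X →ₗ[ℚ] Sh X →ₗ[ℚ] Sh X :=
  (shPrec X).flip

/-- The deconcatenation coproduct of `Sh X`. -/
noncomputable def deconcatenation (X : Type*) : Sh X →ₗ[ℚ] Sh X ⊗[ℚ] Sh X :=
  Finsupp.linearCombination ℚ fun w =>
    ∑ i ∈ Finset.range (w.length + 1),
      Finsupp.single (w.take i) (1 : ℚ) ⊗ₜ[ℚ] Finsupp.single (w.drop i) (1 : ℚ)

/-- The product `f ≺ g = ≺ ∘ (f ⊗ g) ∘ Δ` of endomorphisms of `Sh X`. -/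
noncomputable def endPrec {X : Type*} (f g : Module.End ℚ (Sh X)) : Module.End ℚ (Sh X) :=
  TensorProduct.lift (shPrec X) ∘ₗ TensorProduct.map f g ∘ₗ deconcatenation X

/-- The product `f ≻ g = ≻ ∘ (f ⊗ g) ∘ Δ` of endomorphisms of `Sh X`. -/
noncomputable def endSucc {X : Type*} (f g : Module.End ℚ (Sh X)) : Module.End ℚ (Sh X) :=
  TensorProduct.lift (shSucc X) ∘ₗ TensorProduct.map f g ∘ₗ deconcatenation X

/-! ### Graded permutations -/

/-- Graded permutations `(σ, d)`: a permutation `σ` of `k` letters, `k ≥ 0`, with a map `d` from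
the `k` positions to the positive integers. (Letters and positions are numbered from `0`.) -/
abbrev GradedPerm := Σ k : ℕ, Equiv.Perm (Fin k) × (Fin k → ℕ+)

/-- The weight `d(1) + ... + d(k)` of a graded permutation. -/
def weight (p : GradedPerm) : ℕ := ∑ i, (p.2.2 i : ℕ)

/-- The biword of a graded permutation, with biletters `(σ i, d i)`. -/
def biword (p : GradedPerm) : List (ℕ × ℕ+) :=
  List.ofFn fun i => ((p.2.1 i : ℕ), p.2.2 i)

/-- The standardization of the first row of a biword, the second row being kept: `σ i` is the rank
of the `i`-th letter of the first row among the letters of that row. In particular a biword whose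
first row is a permutation of `0, ..., k - 1` is sent to the graded permutation it represents. -/
def standardize (w : List (ℕ × ℕ+)) : GradedPerm :=
  ⟨w.length, (Tuple.sort fun i : Fin w.length => (w.get i).1)⁻¹, fun i => (w.get i).2⟩

/-- Add `k` to the letters of the first row of a biword. -/
def shift (k : ℕ) (w : List (ℕ × ℕ+)) : List (ℕ × ℕ+) :=
  w.map fun c => (c.1 + k, c.2)

/-- The vector space `S` with basis the graded permutations. -/
abbrev S := GradedPerm →₀ ℚ

/-- The half-product `≺` of `S`: the sum of the shuffles of the biword of `(σ, d)` and of the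
shifted biword of `(τ, e)` that begin with the first biletter of the former. -/
noncomputable def prec : S →ₗ[ℚ] S →ₗ[ℚ] S :=
  bilinearExt fun p q =>
    ((leftShuffles (biword p) (shift p.1 (biword q))).map fun w =>
      Finsupp.single (standardize w) (1 : ℚ)).sum

/-- The half-product `≻` of `S`: the sum of the shuffles of the biword of `(σ, d)` and of the
shifted biword of `(τ, e)` that begin with the first biletter of the latter. -/
noncomputable def succ : S →ₗ[ℚ] S →ₗ[ℚ] S :=
  bilinearExt fun p q =>
    ((leftShuffles (shift p.1 (biword q)) (biword p)).map fun w =>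
      Finsupp.single (standardize w) (1 : ℚ)).sum

/-- The coproduct `Δ_≺`: the sum of the cuts of a biword into two nonempty parts such that the
smallest letter of the first row is in the left part; both parts are standardized. -/
noncomputable def coprodPrec : S →ₗ[ℚ] S ⊗[ℚ] S :=
  Finsupp.linearCombination ℚ fun p =>
    ∑ k ∈ Finset.Ico 1 p.1 with 0 ∈ ((biword p).take k).map Prod.fst,
      Finsupp.single (standardize ((biword p).take k)) (1 : ℚ) ⊗ₜ[ℚ]
        Finsupp.single (standardize ((biword p).drop k)) (1 : ℚ)

/-- The coproduct `Δ_≻`: the sum of the cuts of a biword into two nonempty parts such that the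
smallest letter of the first row is in the right part; both parts are standardized. -/
noncomputable def coprodSucc : S →ₗ[ℚ] S ⊗[ℚ] S :=
  Finsupp.linearCombination ℚ fun p =>
    ∑ k ∈ Finset.Ico 1 p.1 with 0 ∈ ((biword p).drop k).map Prod.fst,
      Finsupp.single (standardize ((biword p).take k)) (1 : ℚ) ⊗ₜ[ℚ]
        Finsupp.single (standardize ((biword p).drop k)) (1 : ℚ)

/-- The action of a graded permutation `(σ, d)` on `Sh X`, for an alphabet `X` graded by `deg`:
a word `x` of length `k` such that the letter `x (σ i)` has degree `d i` for all `i` is sent to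
the word `x (σ 0) ... x (σ (k - 1))`, and all other words are sent to `0`. -/
noncomputable def actionBasis {X : Type*} (deg : X → ℕ+) (p : GradedPerm) :
    Module.End ℚ (Sh X) :=
  Finsupp.linearCombination ℚ fun x : List X =>
    if h : p.1 = x.length then
      if ∀ i, deg (x.get (Fin.cast h (p.2.1 i))) = p.2.2 i then
        Finsupp.single (List.ofFn fun i => x.get (Fin.cast h (p.2.1 i))) (1 : ℚ)
      else 0
    else 0

/-- The linear map from `S` to the endomorphisms of `Sh X`. -/
noncomputable def action {X : Type*} (deg : X → ℕ+) : S →ₗ[ℚ] Module.End ℚ (Sh X) :=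
  Finsupp.linearCombination ℚ (actionBasis deg)

/-! ### The augmentation ideal and its dendriform primitives -/

/-- The homogeneous component of weight `n` of `S`. -/
noncomputable def weightComponent (n : ℕ) : Submodule ℚ S :=
  Finsupp.supported ℚ ℚ {p : GradedPerm | weight p = n}

/-- The augmentation ideal of `S`, spanned by the graded permutations of at least one letter. -/
noncomputable def Splus : Submodule ℚ S :=
  Finsupp.supported ℚ ℚ {p : GradedPerm | 0 < p.1}

theorem sum_leftShuffles_mem (u v : List (ℕ × ℕ+)) :
    ((leftShuffles u v).map fun w => Finsupp.single (standardize w) (1 : ℚ)).sum ∈ Splus := by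
  refine list_sum_mem ?_
  intro x hx
  obtain ⟨w, hw, rfl⟩ := List.mem_map.1 hx
  refine Finsupp.single_mem_supported ℚ _ ?_
  cases u with
  | nil => simp [leftShuffles] at hw
  | cons a u =>
    obtain ⟨t, -, rfl⟩ := List.mem_map.1 hw
    simp [standardize]

theorem bilinearExt_mem {f : GradedPerm → GradedPerm → S} (hf : ∀ p q, f p q ∈ Splus)
    (x y : S) : bilinearExt f x y ∈ Splus := by
  rw [bilinearExt, Finsupp.linearCombination_apply, Finsupp.sum, LinearMap.sum_apply]
  refine Submodule.sum_mem _ fun p _ => ?_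
  rw [LinearMap.smul_apply, Finsupp.linearCombination_apply]
  exact Submodule.smul_mem _ _
    (Submodule.sum_mem _ fun q _ => Submodule.smul_mem _ _ (hf p q))

/-- The half-product `≺` of the augmentation ideal. -/
noncomputable def precPlus : Splus →ₗ[ℚ] Splus →ₗ[ℚ] Splus :=
  LinearMap.mk₂ ℚ
    (fun x y => ⟨prec x y, bilinearExt_mem (fun _ _ => sum_leftShuffles_mem _ _) x y⟩)
    (fun _ _ _ => Subtype.ext (by simp)) (fun _ _ _ => Subtype.ext (by simp))
    (fun _ _ _ => Subtype.ext (by simp)) (fun _ _ _ => Subtype.ext (by simp))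

/-- The half-product `≻` of the augmentation ideal. -/
noncomputable def succPlus : Splus →ₗ[ℚ] Splus →ₗ[ℚ] Splus :=
  LinearMap.mk₂ ℚ
    (fun x y => ⟨succ x y, bilinearExt_mem (fun _ _ => sum_leftShuffles_mem _ _) x y⟩)
    (fun _ _ _ => Subtype.ext (by simp)) (fun _ _ _ => Subtype.ext (by simp))
    (fun _ _ _ => Subtype.ext (by simp)) (fun _ _ _ => Subtype.ext (by simp))

/-- The dendriform primitive elements: `Ker Δ_≺ ∩ Ker Δ_≻` in the augmentation ideal. -/
noncomputable def primDend : Submodule ℚ Splus :=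
  LinearMap.ker (coprodPrec ∘ₗ Splus.subtype) ⊓ LinearMap.ker (coprodSucc ∘ₗ Splus.subtype)

/-- The dendriform primitive elements which are homogeneous of weight `n`. -/
noncomputable def primComponent (n : ℕ) : Submodule ℚ Splus :=
  primDend ⊓ (weightComponent n).comap Splus.subtype

/-- The formal series `R = (∑ k! x^k) ∘ (∑_{k ≥ 1} x^k)`. -/
noncomputable def seriesR : PowerSeries ℚ :=
  (PowerSeries.mk fun k => (k ! : ℚ)).subst
    (PowerSeries.mk fun k => if 1 ≤ k then (1 : ℚ) else 0)

end GradedPermutations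

/-! The proof rests on a symmetric bilinear form on `S` and on a dimension count. Write `*` for
`mul`, `R` for the series of `S`, `Q` for that of the elements primitive for `≺` alone, `P` for that
of the dendriform primitive elements.

Pair each graded permutation with its inverse (`form`). Inversion exchanges positions and letters,
so cutting a biword corresponds to separating letters by size, and `≺`, `≻`, `*` become adjoint to
the coproducts that keep the extreme cuts (`form_prec`, `form_succ`, `form_mul`). Being primitive
for a product then means being orthogonal to all products of elements of `S_+`.

For `w`, `z` primitive for `≺`, the compatibility of `≺` with cuts gives `⟨w ≺ b, z ≺ t⟩ = ⟨w, z⟩⟨b,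
t⟩`. By induction on the weight, each component of positive weight is the direct sum of primitive
elements and products, and products expand uniquely as `∑ w_p ≺ p` (`IsGramPair.disjoint`,
`IsGramPair.expansion_injective`). Hence `R = 1 + R Q`. The same argument for the pair `(*, ≺)`
shows that the primitive elements for `*` and for `≺` have equal dimensions and are in perfect
duality.

Among the elements primitive for `≺` are the products `c ≻ u` with `c` primitive for `≺` and `u`
primitive for `*`. Their Gram matrix is block triangular (`form_succ_succ`), so the form is
nondegenerate on their span, whose series is `Q²`; the dendriform primitive elements are a
complement (`dendDeg_sup_mixedDeg`). So `Q = P + Q²`, and `P = Q (1 - Q) = (R - 1) / R²`.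

For freeness, the elements `p ≻ (v ≺ q)` with `v` dendriform primitive span `S_+`, and `R P R = R -
1` says that there are as many of them as the dimension: they form a basis
(`linearIndependent_sandwich`). A linear map `f` is extended by the recursion `F (p ≻ (v ≺ q)) = F p
≻ (f v ≺ F q)`, and the dendriform axioms make `F` a morphism (`extension_compatibleAt`).

The identities in `S`, and those of the action on `Sh X`, are reduced to identities between sums
over shuffles of lists. -/

namespace GradedPermutations

/-! ### Sums over shuffles and over cuts -/

section ShuffleSums

variable {A M : Type*} [AddCommMonoid M]

/-- The sum of `F` over all shuffles of two words. -/
def shSum (u v : List A) (F : List A → M) : M := ((shuffles u v).map F).sum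

/-- The sum of `F` over all shuffles of two words which begin with the first letter of `u`. -/
def lshSum (u v : List A) (F : List A → M) : M := ((leftShuffles u v).map F).sum

/-- The sum of `G` over all ways of cutting a word into two parts. -/
def cutSum (w : List A) (G : List A → List A → M) : M :=
  ∑ k ∈ Finset.range (w.length + 1), G (w.take k) (w.drop k)

theorem shuffles_nil_left (v : List A) : shuffles [] v = [v] := by
  rw [shuffles]

theorem shuffles_nil_right (u : List A) : shuffles u [] = [u] := by
  cases u <;> rw [shuffles]

theorem shuffles_cons_cons (a b : A) (u v : List A) :
    shuffles (a :: u) (b :: v) =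
      (shuffles u (b :: v)).map (fun w => a :: w) ++
        (shuffles (a :: u) v).map (fun w => b :: w) := by
  rw [shuffles]

@[simp] theorem shSum_nil_left (v : List A) (F : List A → M) : shSum [] v F = F v := by
  simp [shSum, shuffles_nil_left]

@[simp] theorem shSum_nil_right (u : List A) (F : List A → M) : shSum u [] F = F u := by
  simp [shSum, shuffles_nil_right]

theorem shSum_cons_cons (a b : A) (u v : List A) (F : List A → M) :
    shSum (a :: u) (b :: v) F =
      shSum u (b :: v) (fun w => F (a :: w)) + shSum (a :: u) v (fun w => F (b :: w)) := by
  simp [shSum, shuffles_cons_cons, Function.comp_def]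

@[simp] theorem lshSum_nil (v : List A) (F : List A → M) : lshSum [] v F = 0 := by
  simp [lshSum, leftShuffles]

@[simp] theorem lshSum_cons (a : A) (u v : List A) (F : List A → M) :
    lshSum (a :: u) v F = shSum u v (fun w => F (a :: w)) := by
  simp [lshSum, shSum, leftShuffles, Function.comp_def]

@[simp] theorem cutSum_nil (G : List A → List A → M) : cutSum [] G = G [] [] := by
  simp [cutSum]

@[simp] theorem cutSum_cons (a : A) (w : List A) (G : List A → List A → M) :
    cutSum (a :: w) G = G [] (a :: w) + cutSum w (fun x y => G (a :: x) y) := by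
  rw [cutSum, List.length_cons, Finset.sum_range_succ', add_comm]
  simp [cutSum]

theorem shSum_add (u v : List A) (F G : List A → M) :
    shSum u v (fun w => F w + G w) = shSum u v F + shSum u v G := by
  simp [shSum, List.sum_map_add]

theorem cutSum_add (w : List A) (F G : List A → List A → M) :
    cutSum w (fun x y => F x y + G x y) = cutSum w F + cutSum w G := by
  simp [cutSum, Finset.sum_add_distrib]

@[simp] theorem cutSum_zero (w : List A) : cutSum w (fun _ _ => (0 : M)) = 0 := by
  simp [cutSum]

theorem cutSum_comm (u v : List A) (G : List A → List A → List A → List A → M) :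
    cutSum u (fun u₁ u₂ => cutSum v (fun v₁ v₂ => G u₁ u₂ v₁ v₂)) =
      cutSum v (fun v₁ v₂ => cutSum u (fun u₁ u₂ => G u₁ u₂ v₁ v₂)) :=
  Finset.sum_comm

theorem map_shSum {N : Type*} [AddCommMonoid N] {H : Type*} [FunLike H M N]
    [AddMonoidHomClass H M N] (f : H) (u v : List A) (F : List A → M) :
    f (shSum u v F) = shSum u v (fun w => f (F w)) := by
  simp [shSum, map_list_sum, Function.comp_def]

theorem map_lshSum {N : Type*} [AddCommMonoid N] {H : Type*} [FunLike H M N]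
    [AddMonoidHomClass H M N] (f : H) (u v : List A) (F : List A → M) :
    f (lshSum u v F) = lshSum u v (fun w => f (F w)) := by
  simp [lshSum, map_list_sum, Function.comp_def]

theorem map_cutSum {N : Type*} [AddCommMonoid N] {H : Type*} [FunLike H M N]
    [AddMonoidHomClass H M N] (f : H) (w : List A) (G : List A → List A → M) :
    f (cutSum w G) = cutSum w (fun x y => f (G x y)) := by
  simp [cutSum, map_sum]

theorem shSum_comm (u v : List A) (F : List A → M) : shSum u v F = shSum v u F := by
  induction u generalizing v F with
  | nil => simp
  | cons a u ihu =>
    induction v generalizing F with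
    | nil => simp
    | cons b v ihv =>
      rw [shSum_cons_cons, shSum_cons_cons, ihu, ihv, add_comm]

/-- Both sides are sorted by the word that supplies the first letter, with one inductive hypothesis
for each of the three words. -/
theorem shSum_assoc (u v z : List A) (F : List A → M) :
    shSum u v (fun w => shSum w z F) = shSum v z (fun w => shSum u w F) := by
  induction u generalizing v z F with
  | nil => simp
  | cons a u ihu =>
    induction v generalizing z F with
    | nil => simp
    | cons b v ihv =>
      induction z generalizing F with
      | nil => simp
      | cons c z ihz =>
        rw [shSum_cons_cons a b, shSum_cons_cons b c]
        simp only [shSum_cons_cons _ c, shSum_cons_cons a, shSum_add]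
        rw [ihu, ihv]
        -- On the left the shuffles starting with `c` appear in two pieces, according to the next
        -- letter taken from `u` and `v`; `h` cuts the right side in the same way.
        have h := ihz (fun w => F (c :: w))
        rw [shSum_cons_cons a b] at h
        rw [← h, shSum_cons_cons b c]
        abel

theorem mem_shuffles_perm {u v w : List A} (h : w ∈ shuffles u v) : w.Perm (u ++ v) := by
  induction u generalizing v w with
  | nil => simp_all [shuffles_nil_left]
  | cons a u ihu =>
    induction v generalizing w with
    | nil => simp_all [shuffles_nil_right]
    | cons b v ihv =>
      rw [shuffles_cons_cons, List.mem_append, List.mem_map, List.mem_map] at h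
      rcases h with ⟨t, ht, rfl⟩ | ⟨t, ht, rfl⟩
      · exact (ihu ht).cons a
      · exact ((ihv ht).cons b).trans List.perm_middle.symm

theorem mem_leftShuffles_perm {u v w : List A} (h : w ∈ leftShuffles u v) :
    w.Perm (u ++ v) := by
  cases u with
  | nil => simp [leftShuffles] at h
  | cons a u =>
    obtain ⟨t, ht, rfl⟩ := List.mem_map.1 h
    exact (mem_shuffles_perm ht).cons a

theorem shSum_congr {u v : List A} {F G : List A → M}
    (h : ∀ w, w.Perm (u ++ v) → F w = G w) : shSum u v F = shSum u v G := by
  rw [shSum, shSum, List.map_congr_left fun w hw => h w (mem_shuffles_perm hw)]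

theorem lshSum_congr {u v : List A} {F G : List A → M}
    (h : ∀ w, w.Perm (u ++ v) → F w = G w) : lshSum u v F = lshSum u v G := by
  rw [lshSum, lshSum, List.map_congr_left fun w hw => h w (mem_leftShuffles_perm hw)]

theorem cutSum_congr {w : List A} {F G : List A → List A → M}
    (h : ∀ x y, x ++ y = w → F x y = G x y) : cutSum w F = cutSum w G :=
  Finset.sum_congr rfl fun _ _ => h _ _ (List.take_append_drop _ _)

theorem shuffles_map {B : Type*} (f : A → B) (u v : List A) :
    shuffles (u.map f) (v.map f) = (shuffles u v).map (List.map f) := by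
  induction u generalizing v with
  | nil => simp [shuffles_nil_left]
  | cons a u ihu =>
    induction v with
    | nil => simp [shuffles_nil_right]
    | cons b v ihv =>
      have h := ihu (b :: v)
      simp only [List.map_cons] at h ihv ⊢
      simp [shuffles_cons_cons, h, ihv, Function.comp_def]

theorem leftShuffles_map {B : Type*} (f : A → B) (u v : List A) :
    leftShuffles (u.map f) (v.map f) = (leftShuffles u v).map (List.map f) := by
  cases u with
  | nil => simp [leftShuffles]
  | cons a u => simp [leftShuffles, shuffles_map, Function.comp_def]

theorem shSum_map {B : Type*} (f : A → B) (u v : List A) (F : List B → M) :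
    shSum (u.map f) (v.map f) F = shSum u v (fun w => F (w.map f)) := by
  simp [shSum, shuffles_map, Function.comp_def]

theorem lshSum_map {B : Type*} (f : A → B) (u v : List A) (F : List B → M) :
    lshSum (u.map f) (v.map f) F = lshSum u v (fun w => F (w.map f)) := by
  simp [lshSum, leftShuffles_map, Function.comp_def]

theorem cutSum_map {B : Type*} (f : A → B) (w : List A) (G : List B → List B → M) :
    cutSum (w.map f) G = cutSum w (fun x y => G (x.map f) (y.map f)) := by
  simp [cutSum, List.map_take, List.map_drop]

/-- A shuffle starts with the first letter of `u` or of `v`. Two empty words have one shuffle, which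
starts with neither; this exception is why `mul` differs from `prec + succ` on the unit. -/
theorem shSum_eq_lshSum_add (u v : List A) (h : u ≠ [] ∨ v ≠ []) (F : List A → M) :
    shSum u v F = lshSum u v F + lshSum v u F := by
  cases u with
  | nil =>
    cases v with
    | nil => simp at h
    | cons b v => simp
  | cons a u =>
    cases v with
    | nil => simp
    | cons b v => rw [shSum_cons_cons, lshSum_cons, lshSum_cons, shSum_comm v]

/-- Once the first letter of `u` is stripped, only associativity of the shuffle remains. This and
the next two statements are the three dendriform identities at the level of words. -/
theorem lshSum_lshSum_left (u v z : List A) (F : List A → M) :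
    lshSum u v (fun w => lshSum w z F) = shSum v z (fun w => lshSum u w F) := by
  cases u with
  | nil => simp [shSum]
  | cons a u =>
    simp only [lshSum_cons]
    exact shSum_assoc u v z _

theorem lshSum_lshSum_comm (u v z : List A) (F : List A → M) :
    lshSum v u (fun w => lshSum w z F) = lshSum v z (fun w => lshSum w u F) := by
  rw [lshSum_lshSum_left, lshSum_lshSum_left, shSum_comm]

theorem lshSum_shSum_right (u v z : List A) (F : List A → M) :
    shSum u v (fun w => lshSum z w F) = lshSum z v (fun w => lshSum w u F) := by
  rw [lshSum_lshSum_left, shSum_comm]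

/-- Cutting a shuffle amounts to cutting the two words and shuffling the parts. -/
theorem shSum_cutSum (u v : List A) (G : List A → List A → M) :
    shSum u v (fun w => cutSum w G) =
      cutSum u (fun u₁ u₂ => cutSum v (fun v₁ v₂ =>
        shSum u₁ v₁ (fun w₁ => shSum u₂ v₂ (fun w₂ => G w₁ w₂)))) := by
  induction u generalizing v G with
  | nil => simp
  | cons a u ihu =>
    induction v generalizing G with
    | nil => simp
    | cons b v ihv =>
      have h1 := ihu (b :: v) (fun x y => G (a :: x) y)
      have h2 := ihv (fun x y => G (b :: x) y)
      rw [shSum_cons_cons]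
      simp only [cutSum_cons, shSum_add, shSum_nil_left, shSum_nil_right, cutSum_add,
        shSum_cons_cons] at h1 h2 ⊢
      rw [h1, h2]
      abel

/-- In a cut other than the one before the first letter, that letter stays on the left: the left
parts undergo a half-shuffle and the right parts a full one. This asymmetry is the origin of the
factors `prec`, `mul` and `succ`, `mul` in the coproduct formulas. -/
theorem lshSum_cutSum (u v : List A) (G : List A → List A → M) :
    lshSum u v (fun w => cutSum w G) = lshSum u v (fun w => G [] w) +
      cutSum u (fun u₁ u₂ => cutSum v (fun v₁ v₂ =>
        lshSum u₁ v₁ (fun w₁ => shSum u₂ v₂ (fun w₂ => G w₁ w₂)))) := by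
  cases u with
  | nil => simp
  | cons a u =>
    simp only [lshSum_cons, cutSum_cons, shSum_add, lshSum_nil, cutSum_zero, zero_add]
    rw [shSum_cutSum]

end ShuffleSums

/-! ### Standardization of biwords -/

/-- The letters of the first row of a biword. -/
abbrev letters (w : List (ℕ × ℕ+)) : List ℕ := w.map Prod.fst

/-- The number of letters of the first row of `w` which are smaller than `m`. -/
def rank (w : List (ℕ × ℕ+)) (m : ℕ) : ℕ := w.countP fun c => c.1 < m

/-- The basis element of `S` represented by a biword. -/
noncomputable def cls (w : List (ℕ × ℕ+)) : S := Finsupp.single (standardize w) 1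

theorem rank_eq_card (w : List (ℕ × ℕ+)) (m : ℕ) :
    rank w m = (Finset.univ.filter fun j : Fin w.length => (w.get j).1 < m).card := by
  have h : (w : Multiset (ℕ × ℕ+)) = (Finset.univ : Finset (Fin w.length)).val.map w.get := by
    rw [Fin.univ_val_map, List.ofFn_get]
  rw [rank, ← Multiset.coe_countP, h, Multiset.countP_map]
  rfl

theorem rank_strictMonoOn (w : List (ℕ × ℕ+)) : StrictMonoOn (rank w) {m | m ∈ letters w} := by
  intro a ha b _ hab
  obtain ⟨c, hc, rfl⟩ := List.mem_map.1 ha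
  obtain ⟨i, rfl⟩ := List.mem_iff_get.1 hc
  rw [rank_eq_card, rank_eq_card]
  refine Finset.card_lt_card (Finset.ssubset_iff_of_subset ?_ |>.2 ⟨i, ?_, ?_⟩)
  · intro j hj
    simp only [Finset.mem_filter, Finset.mem_univ, true_and] at hj ⊢
    exact hj.trans hab
  · simpa using hab
  · simp

theorem card_perm_lt {n : ℕ} (σ : Equiv.Perm (Fin n)) (i : Fin n) :
    (Finset.univ.filter fun j => σ j < σ i).card = (σ i : ℕ) := by
  have : (Finset.univ.filter fun j => σ j < σ i) = (Finset.Iio (σ i)).map σ.symm.toEmbedding := by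
    ext j
    simp only [Finset.mem_filter, Finset.mem_univ, true_and, Finset.mem_map_equiv, Equiv.symm_symm,
      Finset.mem_Iio]
  rw [this, Finset.card_map, Fin.card_Iio]

theorem length_biword (p : GradedPerm) : (biword p).length = p.1 := by
  simp [biword]

theorem biword_injective : Function.Injective biword := by
  rintro ⟨k, σ, d⟩ ⟨l, τ, e⟩ h
  obtain rfl : k = l := by simpa [biword] using congrArg List.length h
  have h' := List.ofFn_injective h
  have h1 : σ = τ := Equiv.ext fun i => Fin.ext (congrArg Prod.fst (congrFun h' i))
  have h2 : d = e := funext fun i => congrArg Prod.snd (congrFun h' i)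
  rw [h1, h2]

theorem nodup_biword (p : GradedPerm) : (letters (biword p)).Nodup := by
  rw [letters, biword, List.map_ofFn, List.nodup_ofFn]
  intro i j h
  exact p.2.1.injective (Fin.ext h)

theorem rank_biword (p : GradedPerm) (i : Fin p.1) :
    rank (biword p) (p.2.1 i : ℕ) = p.2.1 i := by
  have h : (biword p : Multiset (ℕ × ℕ+)) =
      (Finset.univ : Finset (Fin p.1)).val.map fun i => ((p.2.1 i : ℕ), p.2.2 i) := by
    rw [Fin.univ_val_map]; rfl
  refine Eq.trans ?_ (card_perm_lt p.2.1 i)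
  rw [rank, ← Multiset.coe_countP, h, Multiset.countP_map]
  rfl

/-- The inverse of the sorting permutation sends a position to the number of positions holding a
smaller letter. Standardization thereby becomes a relabelling of letters, which commutes with
shuffling and cutting. -/
theorem biword_standardize {w : List (ℕ × ℕ+)} (hw : (letters w).Nodup) :
    biword (standardize w) = w.map (Prod.map (rank w) id) := by
  refine List.ext_get (by simp [biword, standardize]) fun i h1 h2 => ?_
  have hi : i < w.length := by simpa using h2
  set f : Fin w.length → ℕ := fun i => (w.get i).1 with hf
  have hinj : Function.Injective f := by
    have := List.nodup_iff_injective_get.1 hw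
    intro a b hab
    have h3 := @this (Fin.cast (by simp) a) (Fin.cast (by simp) b) (by simpa [hf] using hab)
    simpa [Fin.ext_iff] using h3
  have hmono : StrictMono (f ∘ Tuple.sort f) :=
    (Tuple.monotone_sort f).strictMono_of_injective (hinj.comp (Tuple.sort f).injective)
  have key : (((Tuple.sort f)⁻¹ ⟨i, hi⟩ : Fin w.length) : ℕ) = rank w (w[i]).1 := by
    rw [rank_eq_card, ← card_perm_lt]
    congr 1
    ext j
    have := hmono.lt_iff_lt (a := (Tuple.sort f)⁻¹ j) (b := (Tuple.sort f)⁻¹ ⟨i, hi⟩)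
    have hs : ∀ j, Tuple.sort f ((Tuple.sort f)⁻¹ j) = j := fun j => Equiv.apply_symm_apply _ j
    simp only [Function.comp_apply, hs] at this
    simp only [Finset.mem_filter, Finset.mem_univ, true_and]
    exact this.symm
  rw [hf] at key
  simpa [biword, standardize, Prod.ext_iff] using key

theorem standardize_biword (p : GradedPerm) : standardize (biword p) = p := by
  apply biword_injective
  rw [biword_standardize (nodup_biword p)]
  conv_rhs => rw [biword]
  rw [← List.map_id (List.ofFn _), ← List.map_id (List.ofFn _)]
  conv_lhs => arg 2; rw [biword]
  simp [rank_biword, Function.comp_def]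

theorem cls_biword (p : GradedPerm) : cls (biword p) = Finsupp.single p 1 := by
  rw [cls, standardize_biword]

theorem nodup_map {f : ℕ → ℕ} {w : List (ℕ × ℕ+)} (hf : StrictMonoOn f {m | m ∈ letters w})
    (hw : (letters w).Nodup) : (letters (w.map (Prod.map f id))).Nodup := by
  have : letters (w.map (Prod.map f id)) = (letters w).map f := by
    simp [letters]
  rw [this]
  exact hw.map_on fun x hx y hy h => hf.injOn hx hy h

/-- Ranks depend only on the relative order of the letters. A basis element may therefore be
represented by any word with the right relative order. -/
theorem standardize_map {f : ℕ → ℕ} {w : List (ℕ × ℕ+)}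
    (hf : StrictMonoOn f {m | m ∈ letters w}) (hw : (letters w).Nodup) :
    standardize (w.map (Prod.map f id)) = standardize w := by
  apply biword_injective
  rw [biword_standardize (nodup_map hf hw), biword_standardize hw, List.map_map]
  refine List.map_congr_left fun c hc => ?_
  have hc' : c.1 ∈ letters w := List.mem_map_of_mem hc
  refine Prod.ext ?_ rfl
  change rank (w.map (Prod.map f id)) (f c.1) = rank w c.1
  rw [rank, rank, List.countP_map]
  refine List.countP_congr fun e he => ?_
  have he' : e.1 ∈ letters w := List.mem_map_of_mem he
  simpa using hf.lt_iff_lt he' hc'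

theorem cls_map {f : ℕ → ℕ} {w : List (ℕ × ℕ+)}
    (hf : StrictMonoOn f {m | m ∈ letters w}) (hw : (letters w).Nodup) :
    cls (w.map (Prod.map f id)) = cls w := by
  rw [cls, cls, standardize_map hf hw]

/-- All letters of the first row of `u` are smaller than those of `v`. -/
def Below (u v : List (ℕ × ℕ+)) : Prop := ∀ a ∈ letters u, ∀ b ∈ letters v, a < b

/-! ### Products computed on representative words -/

theorem bilinearExt_single {I J M : Type*} [AddCommGroup M] [Module ℚ M] (f : I → J → M)
    (i : I) (j : J) :
    bilinearExt f (Finsupp.single i (1 : ℚ)) (Finsupp.single j (1 : ℚ)) = f i j := by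
  simp [bilinearExt]

/-- The shuffle product of `S`. -/
noncomputable def mul : S →ₗ[ℚ] S →ₗ[ℚ] S :=
  bilinearExt fun p q => shSum (biword p) (shift p.1 (biword q)) cls

/-- If `u` and `v` represent `p` and `q`, and `u` is below `v`, then a common order preserving
relabelling carries them to the biword of `p` and to the shifted biword of `q`. -/
theorem exists_relabel {u v : List (ℕ × ℕ+)} (h : (letters (u ++ v)).Nodup) (hb : Below u v) :
    ∃ f : ℕ → ℕ, StrictMonoOn f {m | m ∈ letters (u ++ v)} ∧
      biword (standardize u) = u.map (Prod.map f id) ∧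
      shift (standardize u).1 (biword (standardize v)) = v.map (Prod.map f id) := by
  have hu : (letters u).Nodup := by
    rw [letters, List.map_append] at h; exact h.of_append_left
  have hv : (letters v).Nodup := by
    rw [letters, List.map_append] at h; exact h.of_append_right
  -- Ranks in `u ++ v`: no letter of `v` is smaller than a letter of `u`, and all letters of `u` are
  -- smaller than a letter of `v`, which accounts for the shift.
  refine ⟨rank (u ++ v), rank_strictMonoOn _, ?_, ?_⟩
  · rw [biword_standardize hu]
    refine List.map_congr_left fun c hc => ?_
    have : v.countP (fun e => e.1 < c.1) = 0 := by
      rw [List.countP_eq_zero]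
      intro e he
      have := hb c.1 (List.mem_map_of_mem hc) e.1 (List.mem_map_of_mem he)
      simp only [decide_eq_true_eq]; omega
    simp only [Prod.map, rank, List.countP_append, this, add_zero]
  · rw [biword_standardize hv, shift, List.map_map]
    refine List.map_congr_left fun c hc => ?_
    have : u.countP (fun e => e.1 < c.1) = u.length := by
      rw [List.countP_eq_length]
      intro e he
      have := hb e.1 (List.mem_map_of_mem he) c.1 (List.mem_map_of_mem hc)
      simpa using this
    simp only [Function.comp_apply, Prod.map, rank, List.countP_append, this]
    congr 1
    exact add_comm _ _

theorem cls_map_of_perm {f : ℕ → ℕ} {w t : List (ℕ × ℕ+)} (hw : w.Perm t)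
    (hf : StrictMonoOn f {m | m ∈ letters t}) (ht : (letters t).Nodup) :
    cls (w.map (Prod.map f id)) = cls w := by
  have hp : (letters w).Perm (letters t) := hw.map _
  refine cls_map (hf.mono fun m hm => hp.mem_iff.1 hm) (hp.nodup_iff.2 ht)

/-- The shift disappears when the factors are represented by words one of which is below the other.
Iterated products can then be computed with words alone; the same holds for the half-products below.
-/
theorem mul_cls {u v : List (ℕ × ℕ+)} (h : (letters (u ++ v)).Nodup) (hb : Below u v) :
    mul (cls u) (cls v) = shSum u v cls := by
  obtain ⟨f, hf, h1, h2⟩ := exists_relabel h hb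
  rw [cls, cls, mul, bilinearExt_single, h1, h2, shSum_map]
  exact shSum_congr fun w hw => cls_map_of_perm hw hf h

theorem prec_cls {u v : List (ℕ × ℕ+)} (h : (letters (u ++ v)).Nodup) (hb : Below u v) :
    prec (cls u) (cls v) = lshSum u v cls := by
  obtain ⟨f, hf, h1, h2⟩ := exists_relabel h hb
  rw [cls, cls, prec, bilinearExt_single, h1, h2]
  change lshSum _ _ cls = _
  rw [lshSum_map]
  exact lshSum_congr fun w hw => cls_map_of_perm hw hf h

theorem succ_cls {u v : List (ℕ × ℕ+)} (h : (letters (u ++ v)).Nodup) (hb : Below u v) :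
    succ (cls u) (cls v) = lshSum v u cls := by
  obtain ⟨f, hf, h1, h2⟩ := exists_relabel h hb
  rw [cls, cls, succ, bilinearExt_single, h1, h2]
  change lshSum _ _ cls = _
  rw [lshSum_map]
  exact lshSum_congr fun w hw => cls_map_of_perm (hw.trans List.perm_append_comm) hf h

/-! ### Coproducts -/

/-- The coproduct of `S`: the sum of all cuts of a biword. -/
noncomputable def coprod : S →ₗ[ℚ] S ⊗[ℚ] S :=
  Finsupp.linearCombination ℚ fun p =>
    cutSum (biword p) fun x y => cls x ⊗ₜ[ℚ] cls y

/-- The sum of all cuts of a biword such that the smallest letter is in the left part. -/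
noncomputable def coprodLeft : S →ₗ[ℚ] S ⊗[ℚ] S :=
  Finsupp.linearCombination ℚ fun p =>
    cutSum (biword p) fun x y => if 0 ∈ letters x then cls x ⊗ₜ[ℚ] cls y else 0

/-- The sum of all cuts of a biword such that the smallest letter is in the right part. -/
noncomputable def coprodRight : S →ₗ[ℚ] S ⊗[ℚ] S :=
  Finsupp.linearCombination ℚ fun p =>
    cutSum (biword p) fun x y => if 0 ∈ letters y then cls x ⊗ₜ[ℚ] cls y else 0

theorem cls_map_left {w x y : List (ℕ × ℕ+)} (hw : (letters w).Nodup) (h : x ++ y = w) :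
    cls (x.map (Prod.map (rank w) id)) = cls x := by
  subst h
  have hn : (letters x).Nodup := by
    rw [letters, List.map_append] at hw; exact hw.of_append_left
  refine cls_map ((rank_strictMonoOn _).mono fun m hm => ?_) hn
  simp only [Set.mem_ofPred_eq, letters, List.map_append, List.mem_append] at hm ⊢
  exact Or.inl hm

theorem cls_map_right {w x y : List (ℕ × ℕ+)} (hw : (letters w).Nodup) (h : x ++ y = w) :
    cls (y.map (Prod.map (rank w) id)) = cls y := by
  subst h
  have hn : (letters y).Nodup := by
    rw [letters, List.map_append] at hw; exact hw.of_append_right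
  refine cls_map ((rank_strictMonoOn _).mono fun m hm => ?_) hn
  simp only [Set.mem_ofPred_eq, letters, List.map_append, List.mem_append] at hm ⊢
  exact Or.inr hm

theorem zero_mem_map_rank {w x : List (ℕ × ℕ+)} {m : ℕ} (hx : ∀ a ∈ letters x, a ∈ letters w)
    (hm : m ∈ letters w) (hmin : ∀ a ∈ letters w, m ≤ a) :
    0 ∈ letters (x.map (Prod.map (rank w) id)) ↔ m ∈ letters x := by
  have h0 : rank w m = 0 := by
    rw [rank, List.countP_eq_zero]
    intro e he
    have := hmin e.1 (List.mem_map_of_mem he)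
    simpa using this
  have : letters (x.map (Prod.map (rank w) id)) = (letters x).map (rank w) := by
    simp [letters]
  rw [this, List.mem_map]
  constructor
  · rintro ⟨a, ha, ha'⟩
    rwa [← (rank_strictMonoOn w).injOn (hx a ha) hm (ha'.trans h0.symm)]
  · exact fun h => ⟨m, h, h0⟩

theorem coprod_cls {w : List (ℕ × ℕ+)} (hw : (letters w).Nodup) :
    coprod (cls w) = cutSum w fun x y => cls x ⊗ₜ[ℚ] cls y := by
  rw [cls, coprod, Finsupp.linearCombination_single, one_smul, biword_standardize hw, cutSum_map]
  refine cutSum_congr fun x y h => ?_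
  rw [cls_map_left hw h, cls_map_right hw h]

/-- The smallest letter `m` of `w` is the one of rank `0`, so it plays the role of the letter `0` of
the standardized biword. -/
theorem coprodLeft_cls {w : List (ℕ × ℕ+)} {m : ℕ} (hw : (letters w).Nodup)
    (hm : m ∈ letters w) (hmin : ∀ a ∈ letters w, m ≤ a) :
    coprodLeft (cls w) =
      cutSum w fun x y => if m ∈ letters x then cls x ⊗ₜ[ℚ] cls y else 0 := by
  rw [cls, coprodLeft, Finsupp.linearCombination_single, one_smul, biword_standardize hw,
    cutSum_map]
  refine cutSum_congr fun x y h => ?_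
  rw [cls_map_left hw h, cls_map_right hw h]
  refine if_congr (zero_mem_map_rank (fun a ha => ?_) hm hmin) rfl rfl
  rw [← h, letters, List.map_append]
  exact List.mem_append_left _ ha

theorem coprodRight_cls {w : List (ℕ × ℕ+)} {m : ℕ} (hw : (letters w).Nodup)
    (hm : m ∈ letters w) (hmin : ∀ a ∈ letters w, m ≤ a) :
    coprodRight (cls w) =
      cutSum w fun x y => if m ∈ letters y then cls x ⊗ₜ[ℚ] cls y else 0 := by
  rw [cls, coprodRight, Finsupp.linearCombination_single, one_smul, biword_standardize hw,
    cutSum_map]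
  refine cutSum_congr fun x y h => ?_
  rw [cls_map_left hw h, cls_map_right hw h]
  refine if_congr (zero_mem_map_rank (fun a ha => ?_) hm hmin) rfl rfl
  rw [← h, letters, List.map_append]
  exact List.mem_append_right _ ha

/-! ### The dendriform identities -/

theorem S_induction {C : S → Prop} (hsingle : ∀ p, C (Finsupp.single p 1))
    (hadd : ∀ x y, C x → C y → C (x + y)) (hsmul : ∀ (c : ℚ) x, C x → C (c • x)) (x : S) :
    C x := by
  induction x using Finsupp.induction_linear with
  | zero => simpa using hsmul 0 _ (hsingle (standardize []))
  | add x y hx hy => exact hadd x y hx hy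
  | single p c => simpa using hsmul c _ (hsingle p)

theorem single_mem_Splus {p : GradedPerm} (hp : 0 < p.1) : Finsupp.single p (1 : ℚ) ∈ Splus :=
  Finsupp.single_mem_supported ℚ _ hp

theorem Splus_induction {C : ∀ x : S, x ∈ Splus → Prop}
    (hsingle : ∀ (p : GradedPerm) (hp : 0 < p.1), C (Finsupp.single p 1) (single_mem_Splus hp))
    (hzero : C 0 (zero_mem _))
    (hadd : ∀ x y hx hy, C x hx → C y hy → C (x + y) (add_mem hx hy))
    (hsmul : ∀ (c : ℚ) x hx, C x hx → C (c • x) (Submodule.smul_mem _ c hx))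
    {x : S} (hx : x ∈ Splus) : C x hx := by
  have he : Splus = Submodule.span ℚ
      ((fun p => Finsupp.single p (1 : ℚ)) '' {p : GradedPerm | 0 < p.1}) :=
    Finsupp.supported_eq_span_single _ _
  have hx' := hx
  rw [he] at hx'
  induction hx' using Submodule.span_induction with
  | mem x h => obtain ⟨p, hp, rfl⟩ := h; exact hsingle p hp
  | zero => exact hzero
  | add x y hx1 hy1 h1 h2 =>
    exact hadd x y (he ▸ hx1) (he ▸ hy1) (h1 _) (h2 _)
  | smul c x hx1 h => exact hsmul c x (he ▸ hx1) (h _)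

theorem letters_shift (k : ℕ) (w : List (ℕ × ℕ+)) :
    letters (shift k w) = (letters w).map (· + k) := by
  simp [letters, shift]

theorem lt_of_mem_letters_biword {p : GradedPerm} {a : ℕ} (h : a ∈ letters (biword p)) :
    a < p.1 := by
  rw [letters, biword, List.map_ofFn, List.mem_ofFn] at h
  obtain ⟨i, rfl⟩ := h
  exact (p.2.1 i).2

theorem nodup_letters_shift (k : ℕ) {w : List (ℕ × ℕ+)} (h : (letters w).Nodup) :
    (letters (shift k w)).Nodup := by
  rw [letters_shift]
  exact h.map (add_left_injective k)

theorem cls_shift (k : ℕ) {w : List (ℕ × ℕ+)} (h : (letters w).Nodup) :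
    cls (shift k w) = cls w :=
  cls_map (f := (· + k)) (fun _ _ _ _ hab => Nat.add_lt_add_right hab k) h

theorem nodup_append {u v : List (ℕ × ℕ+)} (hu : (letters u).Nodup) (hv : (letters v).Nodup)
    (h : Below u v) : (letters (u ++ v)).Nodup := by
  rw [letters, List.map_append]
  exact hu.append hv fun a ha hb => lt_irrefl _ (h a ha a hb)

theorem exists_words_two (p q : GradedPerm) :
    ∃ u v, cls u = Finsupp.single p 1 ∧ cls v = Finsupp.single q 1 ∧
      u.length = p.1 ∧ v.length = q.1 ∧ (letters (u ++ v)).Nodup ∧ Below u v := by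
  have h : Below (biword p) (shift p.1 (biword q)) := by
    intro a ha b hb
    rw [letters_shift, List.mem_map] at hb
    obtain ⟨c, -, rfl⟩ := hb
    have := lt_of_mem_letters_biword ha
    omega
  refine ⟨biword p, shift p.1 (biword q), cls_biword p, ?_, length_biword p, ?_,
    nodup_append (nodup_biword p) (nodup_letters_shift _ (nodup_biword q)) h, h⟩
  · rw [cls_shift _ (nodup_biword q), cls_biword]
  · simp [shift, length_biword]

theorem below_congr_left {u u' v : List (ℕ × ℕ+)} (h : u.Perm u') (hb : Below u' v) :
    Below u v :=
  fun a ha => hb a ((h.map _).mem_iff.1 ha)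

theorem below_congr_right {u v v' : List (ℕ × ℕ+)} (h : v.Perm v') (hb : Below u v') :
    Below u v :=
  fun a ha b hb' => hb a ha b ((h.map _).mem_iff.1 hb')

theorem below_append_left {u v z : List (ℕ × ℕ+)} :
    Below (u ++ v) z ↔ Below u z ∧ Below v z := by
  simp only [Below, letters, List.map_append, List.mem_append]
  exact ⟨fun h => ⟨fun a ha => h a (Or.inl ha), fun a ha => h a (Or.inr ha)⟩,
    fun h a ha => ha.elim (h.1 a) (h.2 a)⟩

theorem below_append_right {u v z : List (ℕ × ℕ+)} :
    Below u (v ++ z) ↔ Below u v ∧ Below u z := by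
  simp only [Below, letters, List.map_append, List.mem_append]
  exact ⟨fun h => ⟨fun a ha b hb => h a ha b (Or.inl hb), fun a ha b hb => h a ha b (Or.inr hb)⟩,
    fun h a ha b hb => hb.elim (h.1 a ha b) (h.2 a ha b)⟩

theorem nodup_of_append {u v : List (ℕ × ℕ+)} (h : (letters (u ++ v)).Nodup) :
    (letters u).Nodup ∧ (letters v).Nodup := by
  rw [letters, List.map_append] at h
  exact ⟨h.of_append_left, h.of_append_right⟩

theorem nodup_of_perm {u v : List (ℕ × ℕ+)} (h : u.Perm v) (hv : (letters v).Nodup) :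
    (letters u).Nodup :=
  (h.map _).nodup_iff.2 hv

theorem exists_words_three (p q r : GradedPerm) :
    ∃ u v z, cls u = Finsupp.single p 1 ∧ cls v = Finsupp.single q 1 ∧
      cls z = Finsupp.single r 1 ∧ (letters u).Nodup ∧ (letters v).Nodup ∧ (letters z).Nodup ∧
      Below u v ∧ Below u z ∧ Below v z := by
  obtain ⟨u, v, hu, hv, -, -, hn, hb⟩ := exists_words_two p q
  -- Larger than every letter of `u` and `v`, so the shifted biword of `r` is above both.
  set k := (letters (u ++ v)).foldr max 0 + 1 with hk
  have hlt : Below (u ++ v) (shift k (biword r)) := by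
    intro a ha b hb
    rw [letters_shift, List.mem_map] at hb
    obtain ⟨c, -, rfl⟩ := hb
    have : a ≤ (letters (u ++ v)).foldr max 0 := List.le_max_of_le ha le_rfl
    omega
  rw [below_append_left] at hlt
  exact ⟨u, v, shift k (biword r), hu, hv, by rw [cls_shift _ (nodup_biword r), cls_biword],
    (nodup_of_append hn).1, (nodup_of_append hn).2, nodup_letters_shift _ (nodup_biword r),
    hb, hlt.1, hlt.2⟩

section Words

variable {u v z w : List (ℕ × ℕ+)}

theorem words_left (hu : (letters u).Nodup) (hv : (letters v).Nodup) (hz : (letters z).Nodup)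
    (huv : Below u v) (huz : Below u z) (hvz : Below v z) (hw : w.Perm (u ++ v)) :
    (letters (w ++ z)).Nodup ∧ Below w z := by
  have h : Below w z := below_congr_left hw (below_append_left.2 ⟨huz, hvz⟩)
  exact ⟨nodup_append (nodup_of_perm hw (nodup_append hu hv huv)) hz h, h⟩

theorem words_right (hu : (letters u).Nodup) (hv : (letters v).Nodup) (hz : (letters z).Nodup)
    (huv : Below u v) (huz : Below u z) (hvz : Below v z) (hw : w.Perm (v ++ z)) :
    (letters (u ++ w)).Nodup ∧ Below u w := by
  have h : Below u w := below_congr_right hw (below_append_right.2 ⟨huv, huz⟩)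
  exact ⟨nodup_append hu (nodup_of_perm hw (nodup_append hv hz hvz)) h, h⟩

end Words

/-- With `mul` in place of `prec + succ`, from which it differs only on the unit times itself, the
dendriform identities hold on all of `S` and not only on the augmentation ideal. -/
theorem prec_prec (x y z : S) : prec (prec x y) z = prec x (mul y z) := by
  induction x using S_induction with
  | hadd x x' hx hx' => simp only [map_add, LinearMap.add_apply, hx, hx']
  | hsmul c x hx => simp only [map_smul, LinearMap.smul_apply, hx]
  | hsingle p =>
  induction y using S_induction with
  | hadd x x' hx hx' => simp only [map_add, LinearMap.add_apply, hx, hx']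
  | hsmul c x hx => simp only [map_smul, LinearMap.smul_apply, hx]
  | hsingle q =>
  induction z using S_induction with
  | hadd x x' hx hx' => simp only [map_add, hx, hx']
  | hsmul c x hx => simp only [map_smul, hx]
  | hsingle r =>
  obtain ⟨u, v, z, rfl', rfl'', rfl''', nu, nv, nz, huv, huz, hvz⟩ := exists_words_three p q r
  rw [← rfl', ← rfl'', ← rfl''', prec_cls (nodup_append nu nv huv) huv,
    mul_cls (nodup_append nv nz hvz) hvz, ← LinearMap.flip_apply, map_lshSum, map_shSum]
  refine Eq.trans (lshSum_congr fun w hw => ?_) ((lshSum_lshSum_left u v z cls).trans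
    (shSum_congr fun w hw => ?_))
  · obtain ⟨h1, h2⟩ := words_left nu nv nz huv huz hvz hw
    rw [LinearMap.flip_apply, prec_cls h1 h2]
  · obtain ⟨h1, h2⟩ := words_right nu nv nz huv huz hvz hw
    rw [prec_cls h1 h2]

theorem mul_mul (x y z : S) : mul (mul x y) z = mul x (mul y z) := by
  induction x using S_induction with
  | hadd x x' hx hx' => simp only [map_add, LinearMap.add_apply, hx, hx']
  | hsmul c x hx => simp only [map_smul, LinearMap.smul_apply, hx]
  | hsingle p =>
  induction y using S_induction with
  | hadd x x' hx hx' => simp only [map_add, LinearMap.add_apply, hx, hx']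
  | hsmul c x hx => simp only [map_smul, LinearMap.smul_apply, hx]
  | hsingle q =>
  induction z using S_induction with
  | hadd x x' hx hx' => simp only [map_add, hx, hx']
  | hsmul c x hx => simp only [map_smul, hx]
  | hsingle r =>
  obtain ⟨u, v, z, rfl', rfl'', rfl''', nu, nv, nz, huv, huz, hvz⟩ := exists_words_three p q r
  rw [← rfl', ← rfl'', ← rfl''', mul_cls (nodup_append nu nv huv) huv,
    mul_cls (nodup_append nv nz hvz) hvz, ← LinearMap.flip_apply, map_shSum, map_shSum]
  refine Eq.trans (shSum_congr fun w hw => ?_) ((shSum_assoc u v z cls).trans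
    (shSum_congr fun w hw => ?_))
  · obtain ⟨h1, h2⟩ := words_left nu nv nz huv huz hvz hw
    rw [LinearMap.flip_apply, mul_cls h1 h2]
  · obtain ⟨h1, h2⟩ := words_right nu nv nz huv huz hvz hw
    rw [mul_cls h1 h2]

theorem succ_succ (x y z : S) : succ (mul x y) z = succ x (succ y z) := by
  induction x using S_induction with
  | hadd x x' hx hx' => simp only [map_add, LinearMap.add_apply, hx, hx']
  | hsmul c x hx => simp only [map_smul, LinearMap.smul_apply, hx]
  | hsingle p =>
  induction y using S_induction with
  | hadd x x' hx hx' => simp only [map_add, LinearMap.add_apply, hx, hx']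
  | hsmul c x hx => simp only [map_smul, LinearMap.smul_apply, hx]
  | hsingle q =>
  induction z using S_induction with
  | hadd x x' hx hx' => simp only [map_add, hx, hx']
  | hsmul c x hx => simp only [map_smul, hx]
  | hsingle r =>
  obtain ⟨u, v, z, rfl', rfl'', rfl''', nu, nv, nz, huv, huz, hvz⟩ := exists_words_three p q r
  rw [← rfl', ← rfl'', ← rfl''', mul_cls (nodup_append nu nv huv) huv,
    succ_cls (nodup_append nv nz hvz) hvz, ← LinearMap.flip_apply, map_shSum, map_lshSum]
  refine Eq.trans (shSum_congr fun w hw => ?_) ((lshSum_shSum_right u v z cls).trans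
    (lshSum_congr fun w hw => ?_))
  · obtain ⟨h1, h2⟩ := words_left nu nv nz huv huz hvz hw
    rw [LinearMap.flip_apply, succ_cls h1 h2]
  · obtain ⟨h1, h2⟩ := words_right nu nv nz huv huz hvz (hw.trans List.perm_append_comm)
    rw [succ_cls h1 h2]

theorem succ_prec (x y z : S) : prec (succ x y) z = succ x (prec y z) := by
  induction x using S_induction with
  | hadd x x' hx hx' => simp only [map_add, LinearMap.add_apply, hx, hx']
  | hsmul c x hx => simp only [map_smul, LinearMap.smul_apply, hx]
  | hsingle p =>
  induction y using S_induction with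
  | hadd x x' hx hx' => simp only [map_add, LinearMap.add_apply, hx, hx']
  | hsmul c x hx => simp only [map_smul, LinearMap.smul_apply, hx]
  | hsingle q =>
  induction z using S_induction with
  | hadd x x' hx hx' => simp only [map_add, hx, hx']
  | hsmul c x hx => simp only [map_smul, hx]
  | hsingle r =>
  obtain ⟨u, v, z, rfl', rfl'', rfl''', nu, nv, nz, huv, huz, hvz⟩ := exists_words_three p q r
  rw [← rfl', ← rfl'', ← rfl''', succ_cls (nodup_append nu nv huv) huv,
    prec_cls (nodup_append nv nz hvz) hvz, ← LinearMap.flip_apply, map_lshSum, map_lshSum]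
  refine Eq.trans (lshSum_congr fun w hw => ?_) ((lshSum_lshSum_comm u v z cls).trans
    (lshSum_congr fun w hw => ?_))
  · obtain ⟨h1, h2⟩ := words_left nu nv nz huv huz hvz (hw.trans List.perm_append_comm)
    rw [LinearMap.flip_apply, prec_cls h1 h2]
  · obtain ⟨h1, h2⟩ := words_right nu nv nz huv huz hvz hw
    rw [succ_cls h1 h2]

/-! ### The unit -/

/-- The empty graded permutation, as an element of `S`. -/
noncomputable def one : S := cls []

theorem single_eq_one {p : GradedPerm} (h : p.1 = 0) : Finsupp.single p (1 : ℚ) = one := by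
  rw [one, ← cls_biword, List.length_eq_zero_iff.1 ((length_biword p).trans h)]

theorem one_eq_single : one = Finsupp.single (standardize []) 1 := rfl

theorem biword_ne_nil {p : GradedPerm} (hp : 0 < p.1) : biword p ≠ [] := fun h => by
  have := length_biword p
  rw [h] at this
  exact hp.ne this

@[simp] theorem prec_one_left (x : S) : prec one x = 0 := by
  induction x using S_induction with
  | hadd x x' hx hx' => simp only [map_add, hx, hx', add_zero]
  | hsmul c x hx => simp only [map_smul, hx, smul_zero]
  | hsingle p =>
    rw [← cls_biword, one, prec_cls (by simpa using nodup_biword p) (by simp [Below]), lshSum_nil]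

@[simp] theorem succ_one_right (x : S) : succ x one = 0 := by
  induction x using S_induction with
  | hadd x x' hx hx' => simp only [map_add, LinearMap.add_apply, hx, hx', add_zero]
  | hsmul c x hx => simp only [map_smul, LinearMap.smul_apply, hx, smul_zero]
  | hsingle p =>
    rw [← cls_biword, one, succ_cls (by simpa using nodup_biword p) (by simp [Below]), lshSum_nil]

@[simp] theorem mul_one' (x : S) : mul x one = x := by
  induction x using S_induction with
  | hadd x x' hx hx' => simp only [map_add, LinearMap.add_apply, hx, hx']
  | hsmul c x hx => simp only [map_smul, LinearMap.smul_apply, hx]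
  | hsingle p =>
    rw [← cls_biword, one, mul_cls (by simpa using nodup_biword p) (by simp [Below]),
      shSum_nil_right]

@[simp] theorem one_mul' (x : S) : mul one x = x := by
  induction x using S_induction with
  | hadd x x' hx hx' => simp only [map_add, hx, hx']
  | hsmul c x hx => simp only [map_smul, hx]
  | hsingle p =>
    rw [← cls_biword, one, mul_cls (by simpa using nodup_biword p) (by simp [Below]),
      shSum_nil_left]

theorem mul_single_eq {p q : GradedPerm} (h : 0 < p.1 ∨ 0 < q.1) :
    mul (Finsupp.single p 1) (Finsupp.single q 1) =
      prec (Finsupp.single p 1) (Finsupp.single q 1) +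
        succ (Finsupp.single p 1) (Finsupp.single q 1) := by
  obtain ⟨u, v, hu, hv, lu, lv, hn, hb⟩ := exists_words_two p q
  rw [← hu, ← hv, mul_cls hn hb, prec_cls hn hb, succ_cls hn hb]
  refine shSum_eq_lshSum_add u v (h.imp ?_ ?_) _
  · rintro h rfl; exact h.ne lu
  · rintro h rfl; exact h.ne lv

theorem mul_eq_left {x : S} (hx : x ∈ Splus) (y : S) : mul x y = prec x y + succ x y := by
  induction hx using Splus_induction with
  | hzero => simp
  | hadd x x' _ _ hx hx' => simp only [map_add, LinearMap.add_apply, hx, hx']; abel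
  | hsmul c x _ hx => simp only [map_smul, LinearMap.smul_apply, hx, smul_add]
  | hsingle p hp =>
  induction y using S_induction with
  | hadd x x' hx hx' => simp only [map_add, hx, hx']; abel
  | hsmul c x hx => simp only [map_smul, hx, smul_add]
  | hsingle q => exact mul_single_eq (Or.inl hp)

theorem mul_eq_right (x : S) {y : S} (hy : y ∈ Splus) : mul x y = prec x y + succ x y := by
  induction x using S_induction with
  | hadd x x' hx hx' => simp only [map_add, LinearMap.add_apply, hx, hx']; abel
  | hsmul c x hx => simp only [map_smul, LinearMap.smul_apply, hx, smul_add]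
  | hsingle p =>
  induction hy using Splus_induction with
  | hzero => simp
  | hadd x x' _ _ hx hx' => simp only [map_add, hx, hx']; abel
  | hsmul c x _ hx => simp only [map_smul, hx, smul_add]
  | hsingle q hq => exact mul_single_eq (Or.inr hq)

theorem prec_one_right {x : S} (hx : x ∈ Splus) : prec x one = x := by
  have := mul_eq_left hx one
  rwa [mul_one', succ_one_right, add_zero, eq_comm] at this

theorem succ_one_left {x : S} (hx : x ∈ Splus) : succ one x = x := by
  have := mul_eq_right one hx
  rwa [one_mul', prec_one_left, zero_add, eq_comm] at this

/-! ### Compatibility of the half-products with the coproducts -/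

/-- The map `(a ⊗ b) ⊗ (c ⊗ d) ↦ f a c ⊗ g b d`. -/
noncomputable def pairMul (f g : S →ₗ[ℚ] S →ₗ[ℚ] S) :
    (S ⊗[ℚ] S) →ₗ[ℚ] (S ⊗[ℚ] S) →ₗ[ℚ] S ⊗[ℚ] S :=
  TensorProduct.curry (TensorProduct.map (TensorProduct.lift f) (TensorProduct.lift g) ∘ₗ
    (TensorProduct.tensorTensorTensorComm ℚ S S S S).toLinearMap)

@[simp] theorem pairMul_tmul (f g : S →ₗ[ℚ] S →ₗ[ℚ] S) (a b c d : S) :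
    pairMul f g (a ⊗ₜ b) (c ⊗ₜ d) = f a c ⊗ₜ g b d := by
  simp [pairMul]

theorem lshSum_shSum_tmul (u₁ v₁ u₂ v₂ : List (ℕ × ℕ+)) :
    (lshSum u₁ v₁ fun w₁ => shSum u₂ v₂ fun w₂ => cls w₁ ⊗ₜ[ℚ] cls w₂) =
      lshSum u₁ v₁ cls ⊗ₜ[ℚ] shSum u₂ v₂ cls := by
  have h := map_lshSum ((TensorProduct.mk ℚ S S).flip (shSum u₂ v₂ cls)) u₁ v₁ cls
  rw [LinearMap.flip_apply, TensorProduct.mk_apply] at h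
  rw [h]
  refine congrArg _ (funext fun w => ?_)
  rw [LinearMap.flip_apply, map_shSum]
  rfl

theorem exists_min_letter {u v : List (ℕ × ℕ+)} (hu : u ≠ []) (h : Below u v) :
    ∃ m ∈ letters u, ∀ a ∈ letters (u ++ v), m ≤ a := by
  obtain ⟨m, hm, hmin⟩ := (letters u).toFinset.exists_min_image id
    (by simpa [letters] using hu)
  refine ⟨m, by simpa using hm, fun a ha => ?_⟩
  rw [letters, List.map_append, List.mem_append] at ha
  rcases ha with ha | ha
  · exact hmin a (by simpa using ha)
  · exact (h m (by simpa using hm) a ha).le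

theorem words_cut {u v u₁ u₂ v₁ v₂ : List (ℕ × ℕ+)} (hn : (letters (u ++ v)).Nodup)
    (hb : Below u v) (hu : u₁ ++ u₂ = u) (hv : v₁ ++ v₂ = v) :
    ((letters (u₁ ++ v₁)).Nodup ∧ Below u₁ v₁) ∧ ((letters (u₂ ++ v₂)).Nodup ∧ Below u₂ v₂) := by
  subst hu hv
  obtain ⟨h1, h2⟩ := nodup_of_append hn
  rw [below_append_left, below_append_right, below_append_right] at hb
  exact ⟨⟨nodup_append (nodup_of_append h1).1 (nodup_of_append h2).1 hb.1.1, hb.1.1⟩,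
    ⟨nodup_append (nodup_of_append h1).2 (nodup_of_append h2).2 hb.2.2, hb.2.2⟩⟩

theorem mem_letters_shuffle {u v u₁ v₁ v₂ w : List (ℕ × ℕ+)} {m : ℕ} (hb : Below u v)
    (hm : m ∈ letters u) (hv : v₁ ++ v₂ = v) (hw : w.Perm (u₁ ++ v₁) ∨ w.Perm (u₁ ++ v₂)) :
    m ∈ letters w ↔ m ∈ letters u₁ := by
  have hnot : m ∉ letters v := fun h => lt_irrefl _ (hb m hm m h)
  rw [← hv, letters, List.map_append, List.mem_append, not_or] at hnot
  rcases hw with hw | hw <;>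
  · rw [letters, (hw.map _).mem_iff, List.map_append, List.mem_append]
    simp [hnot]

theorem coprodLeft_one : coprodLeft one = 0 := by
  have : biword (standardize []) = [] := by rw [biword_standardize (by simp)]; rfl
  rw [one_eq_single, coprodLeft, Finsupp.linearCombination_single, this]
  simp

theorem min_letter_perm {u v w : List (ℕ × ℕ+)} {m : ℕ} (hm : m ∈ letters u)
    (hmin : ∀ a ∈ letters (u ++ v), m ≤ a) (hw : w.Perm (u ++ v)) :
    m ∈ letters w ∧ ∀ a ∈ letters w, m ≤ a := by
  constructor
  · rw [letters, (hw.map _).mem_iff, List.map_append]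
    exact List.mem_append_left _ hm
  · intro a ha
    exact hmin a ((hw.map _).mem_iff.1 ha)

/-- As `u` is below `v`, the smallest letter belongs to `u`, and it falls in the left part of a cut
shuffle exactly when it falls in the left part of the corresponding cut of `u`. -/
theorem coprodLeft_prec_words {u v : List (ℕ × ℕ+)} (hn : (letters (u ++ v)).Nodup)
    (hb : Below u v) :
    coprodLeft (prec (cls u) (cls v)) = pairMul prec mul (coprodLeft (cls u)) (coprod (cls v)) := by
  rcases eq_or_ne u [] with rfl | hu
  · rw [← one, prec_one_left, coprodLeft_one]; simp
  obtain ⟨m, hm, hmin⟩ := exists_min_letter hu hb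
  rw [prec_cls hn hb, map_lshSum, coprodLeft_cls (nodup_of_append hn).1 hm
    (fun a ha => hmin a (by rw [letters, List.map_append]; exact List.mem_append_left _ ha)),
    coprod_cls (nodup_of_append hn).2, ← LinearMap.flip_apply, map_cutSum]
  rw [lshSum_congr (G := fun w => cutSum w fun x y =>
    if m ∈ letters x then cls x ⊗ₜ[ℚ] cls y else 0) fun w hw =>
    coprodLeft_cls (nodup_of_perm hw hn) (min_letter_perm hm hmin hw).1
      (min_letter_perm hm hmin hw).2, lshSum_cutSum]
  -- The cut before the first letter does not count: its left part is empty.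
  have h0 : (lshSum u v fun w => if m ∈ letters ([] : List (ℕ × ℕ+)) then
      cls [] ⊗ₜ[ℚ] cls w else 0) = 0 := by
    simp [lshSum]
  rw [h0, zero_add]
  refine cutSum_congr fun u₁ u₂ hu' => ?_
  rw [LinearMap.flip_apply, map_cutSum]
  refine cutSum_congr fun v₁ v₂ hv' => ?_
  obtain ⟨⟨h1, h2⟩, h3, h4⟩ := words_cut hn hb hu' hv'
  rw [lshSum_congr fun w hw => shSum_congr fun w' _ =>
    if_congr (mem_letters_shuffle hb hm hv' (Or.inl hw)) rfl rfl]
  split_ifs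
  · rw [pairMul_tmul, prec_cls h1 h2, mul_cls h3 h4, lshSum_shSum_tmul]
  · simp [lshSum, shSum]

/-- The word `u` must be nonempty, for otherwise the smallest letter would come from `v` and the
right side would vanish. -/
theorem coprodLeft_succ_words {u v : List (ℕ × ℕ+)} (hn : (letters (u ++ v)).Nodup)
    (hb : Below u v) (hu : u ≠ []) :
    coprodLeft (succ (cls u) (cls v)) = pairMul succ mul (coprodLeft (cls u)) (coprod (cls v)) := by
  obtain ⟨m, hm, hmin⟩ := exists_min_letter hu hb
  rw [succ_cls hn hb, map_lshSum, coprodLeft_cls (nodup_of_append hn).1 hm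
    (fun a ha => hmin a (by rw [letters, List.map_append]; exact List.mem_append_left _ ha)),
    coprod_cls (nodup_of_append hn).2, ← LinearMap.flip_apply, map_cutSum]
  rw [lshSum_congr (G := fun w => cutSum w fun x y =>
    if m ∈ letters x then cls x ⊗ₜ[ℚ] cls y else 0) fun w hw' => by
    have hw := hw'.trans List.perm_append_comm
    exact coprodLeft_cls (nodup_of_perm hw hn) (min_letter_perm hm hmin hw).1
      (min_letter_perm hm hmin hw).2, lshSum_cutSum]
  have h0 : (lshSum v u fun w => if m ∈ letters ([] : List (ℕ × ℕ+)) then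
      cls [] ⊗ₜ[ℚ] cls w else 0) = 0 := by
    simp [lshSum]
  rw [h0, zero_add, cutSum_comm]
  refine cutSum_congr fun u₁ u₂ hu' => ?_
  rw [LinearMap.flip_apply, map_cutSum]
  refine cutSum_congr fun v₁ v₂ hv' => ?_
  obtain ⟨⟨h1, h2⟩, h3, h4⟩ := words_cut hn hb hu' hv'
  rw [lshSum_congr fun w hw => shSum_congr fun w' _ =>
    if_congr (mem_letters_shuffle hb hm hv' (Or.inl (hw.trans List.perm_append_comm))) rfl rfl]
  split_ifs
  · rw [pairMul_tmul, succ_cls h1 h2, mul_cls h3 h4, lshSum_shSum_tmul, shSum_comm u₂]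
  · simp [lshSum, shSum]

/-- Here the cut before the first letter counts, since the smallest letter is on its right; it gives
the term with left factor `one`. -/
theorem coprodRight_succ_words {u v : List (ℕ × ℕ+)} (hn : (letters (u ++ v)).Nodup)
    (hb : Below u v) (hu : u ≠ []) :
    coprodRight (succ (cls u) (cls v)) = one ⊗ₜ succ (cls u) (cls v) +
      pairMul succ mul (coprodRight (cls u)) (coprod (cls v)) := by
  obtain ⟨m, hm, hmin⟩ := exists_min_letter hu hb
  rw [succ_cls hn hb, map_lshSum, coprodRight_cls (nodup_of_append hn).1 hm
    (fun a ha => hmin a (by rw [letters, List.map_append]; exact List.mem_append_left _ ha)),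
    coprod_cls (nodup_of_append hn).2,
    ← LinearMap.flip_apply (pairMul succ mul), map_cutSum]
  rw [lshSum_congr (G := fun w => cutSum w fun x y =>
    if m ∈ letters y then cls x ⊗ₜ[ℚ] cls y else 0) fun w hw' => by
    have hw := hw'.trans List.perm_append_comm
    exact coprodRight_cls (nodup_of_perm hw hn) (min_letter_perm hm hmin hw).1
      (min_letter_perm hm hmin hw).2, lshSum_cutSum]
  congr 1
  · rw [← TensorProduct.mk_apply, map_lshSum]
    refine lshSum_congr fun w hw' => ?_
    rw [if_pos (min_letter_perm hm hmin (hw'.trans List.perm_append_comm)).1]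
    rfl
  rw [cutSum_comm]
  refine cutSum_congr fun u₁ u₂ hu' => ?_
  rw [LinearMap.flip_apply, map_cutSum]
  refine cutSum_congr fun v₁ v₂ hv' => ?_
  obtain ⟨⟨h1, h2⟩, h3, h4⟩ := words_cut hn hb hu' hv'
  rw [lshSum_congr fun w hw => shSum_congr fun w' hw' =>
    if_congr (mem_letters_shuffle hb hm hv' (Or.inr (hw'.trans List.perm_append_comm))) rfl rfl]
  split_ifs
  · rw [pairMul_tmul, succ_cls h1 h2, mul_cls h3 h4, lshSum_shSum_tmul, shSum_comm u₂]
  · simp [lshSum, shSum]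

theorem coprodLeft_prec (x y : S) :
    coprodLeft (prec x y) = pairMul prec mul (coprodLeft x) (coprod y) := by
  induction x using S_induction with
  | hadd x x' hx hx' => simp only [map_add, LinearMap.add_apply, hx, hx']
  | hsmul c x hx => simp only [map_smul, LinearMap.smul_apply, hx]
  | hsingle p =>
  induction y using S_induction with
  | hadd x x' hx hx' => simp only [map_add, hx, hx']
  | hsmul c x hx => simp only [map_smul, hx]
  | hsingle q =>
  obtain ⟨u, v, hu, hv, lu, lv, hn, hb⟩ := exists_words_two p q
  rw [← hu, ← hv, coprodLeft_prec_words hn hb]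

theorem coprodLeft_succ {x : S} (hx : x ∈ Splus) (y : S) :
    coprodLeft (succ x y) = pairMul succ mul (coprodLeft x) (coprod y) := by
  induction hx using Splus_induction with
  | hzero => simp
  | hadd x x' _ _ hx hx' => simp only [map_add, LinearMap.add_apply, hx, hx']
  | hsmul c x _ hx => simp only [map_smul, LinearMap.smul_apply, hx]
  | hsingle p hp =>
  induction y using S_induction with
  | hadd x x' hx hx' => simp only [map_add, hx, hx']
  | hsmul c x hx => simp only [map_smul, hx]
  | hsingle q =>
  obtain ⟨u, v, hu, hv, lu, lv, hn, hb⟩ := exists_words_two p q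
  rw [← hu, ← hv, coprodLeft_succ_words hn hb (by rintro rfl; exact hp.ne lu)]

theorem coprodRight_succ {x : S} (hx : x ∈ Splus) (y : S) :
    coprodRight (succ x y) =
      one ⊗ₜ succ x y + pairMul succ mul (coprodRight x) (coprod y) := by
  induction hx using Splus_induction with
  | hzero => simp
  | hadd x x' _ _ hx hx' =>
    simp only [map_add, LinearMap.add_apply, hx, hx', TensorProduct.tmul_add]; abel
  | hsmul c x _ hx => simp only [map_smul, LinearMap.smul_apply, hx, TensorProduct.tmul_smul, smul_add]
  | hsingle p hp =>
  induction y using S_induction with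
  | hadd x x' hx hx' => simp only [map_add, hx, hx', TensorProduct.tmul_add]; abel
  | hsmul c x hx => simp only [map_smul, hx, TensorProduct.tmul_smul, smul_add]
  | hsingle q =>
  obtain ⟨u, v, hu, hv, lu, lv, hn, hb⟩ := exists_words_two p q
  rw [← hu, ← hv, coprodRight_succ_words hn hb (by rintro rfl; exact hp.ne lu)]

/-! ### The grading by the weight -/

/-- The weight of a biword. -/
def wordWeight (w : List (ℕ × ℕ+)) : ℕ := (w.map fun c => (c.2 : ℕ)).sum

theorem wordWeight_append (u v : List (ℕ × ℕ+)) :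
    wordWeight (u ++ v) = wordWeight u + wordWeight v := by
  simp [wordWeight]

theorem wordWeight_perm {u v : List (ℕ × ℕ+)} (h : u.Perm v) : wordWeight u = wordWeight v :=
  (h.map _).sum_eq

theorem wordWeight_shift (k : ℕ) (w : List (ℕ × ℕ+)) : wordWeight (shift k w) = wordWeight w := by
  simp [wordWeight, shift, Function.comp_def]

theorem weight_standardize (w : List (ℕ × ℕ+)) : weight (standardize w) = wordWeight w := by
  have h : wordWeight w = (List.ofFn fun i : Fin w.length => ((w.get i).2 : ℕ)).sum := by
    conv_lhs => rw [wordWeight, ← List.ofFn_get w, List.map_ofFn]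
    rfl
  rw [h, List.sum_ofFn]
  rfl

theorem wordWeight_biword (p : GradedPerm) : wordWeight (biword p) = weight p := by
  rw [← weight_standardize, standardize_biword]

theorem le_weight (p : GradedPerm) : p.1 ≤ weight p := by
  have : ∑ _i : Fin p.1, 1 ≤ ∑ i, (p.2.2 i : ℕ) := Finset.sum_le_sum fun i _ => (p.2.2 i).2
  simpa [weight] using this

theorem weight_eq_zero {p : GradedPerm} (h : p.1 = 0) : weight p = 0 := by
  rw [← wordWeight_biword, List.length_eq_zero_iff.1 ((length_biword p).trans h)]
  rfl

theorem weight_pos {p : GradedPerm} : 0 < weight p ↔ 0 < p.1 := by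
  constructor
  · intro h
    by_contra h0
    rw [weight_eq_zero (by omega)] at h
    exact lt_irrefl _ h
  · exact fun h => h.trans_le (le_weight p)

theorem weight_standardize_nil : weight (standardize []) = 0 := by
  rw [weight_standardize]; rfl

theorem eq_nil_of_weight_eq_zero {p : GradedPerm} (h : weight p = 0) : p = standardize [] := by
  have h0 : p.1 = 0 := by have := le_weight p; omega
  rw [← standardize_biword p, List.length_eq_zero_iff.1 ((length_biword p).trans h0)]

theorem single_mem_weightComponent (p : GradedPerm) :
    Finsupp.single p (1 : ℚ) ∈ weightComponent (weight p) :=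
  Finsupp.single_mem_supported ℚ _ rfl

theorem cls_mem_weightComponent (w : List (ℕ × ℕ+)) : cls w ∈ weightComponent (wordWeight w) := by
  rw [← weight_standardize]
  exact single_mem_weightComponent _

theorem one_mem_weightComponent : one ∈ weightComponent 0 :=
  cls_mem_weightComponent []

theorem weightComponent_le_Splus {n : ℕ} (hn : 0 < n) : weightComponent n ≤ Splus := by
  refine Finsupp.supported_mono fun p hp => ?_
  change weight p = n at hp
  exact weight_pos.1 (by omega)

theorem weightComponent_eq_span (n : ℕ) : weightComponent n =
    Submodule.span ℚ ((fun p => Finsupp.single p (1 : ℚ)) '' {p : GradedPerm | weight p = n}) :=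
  Finsupp.supported_eq_span_single _ _

/-- A bilinear map which is homogeneous on basis elements is homogeneous. -/
theorem bilinear_mem_weightComponent {f : S →ₗ[ℚ] S →ₗ[ℚ] S}
    (hf : ∀ p q, f (Finsupp.single p 1) (Finsupp.single q 1) ∈
      weightComponent (weight p + weight q)) {m n : ℕ} {x y : S}
    (hx : x ∈ weightComponent m) (hy : y ∈ weightComponent n) :
    f x y ∈ weightComponent (m + n) := by
  rw [weightComponent_eq_span m] at hx
  rw [weightComponent_eq_span n] at hy
  induction hx using Submodule.span_induction with
  | zero => simp
  | add x x' _ _ hx hx' => rw [map_add]; exact add_mem hx hx'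
  | smul c x _ hx => rw [map_smul]; exact Submodule.smul_mem _ c hx
  | mem x hx =>
  obtain ⟨p, rfl, rfl⟩ := hx
  induction hy using Submodule.span_induction with
  | zero => simp
  | add x x' _ _ hx hx' => rw [map_add]; exact add_mem hx hx'
  | smul c x _ hx => rw [map_smul]; exact Submodule.smul_mem _ c hx
  | mem y hy =>
  obtain ⟨q, rfl, rfl⟩ := hy
  exact hf p q

theorem shSum_cls_mem (u v : List (ℕ × ℕ+)) :
    shSum u v cls ∈ weightComponent (wordWeight u + wordWeight v) := by
  refine list_sum_mem fun x hx => ?_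
  obtain ⟨w, hw, rfl⟩ := List.mem_map.1 hx
  rw [← wordWeight_append, ← wordWeight_perm (mem_shuffles_perm hw)]
  exact cls_mem_weightComponent w

theorem lshSum_cls_mem (u v : List (ℕ × ℕ+)) :
    lshSum u v cls ∈ weightComponent (wordWeight u + wordWeight v) := by
  refine list_sum_mem fun x hx => ?_
  obtain ⟨w, hw, rfl⟩ := List.mem_map.1 hx
  rw [← wordWeight_append, ← wordWeight_perm (mem_leftShuffles_perm hw)]
  exact cls_mem_weightComponent w

theorem mul_mem {m n : ℕ} {x y : S} (hx : x ∈ weightComponent m) (hy : y ∈ weightComponent n) :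
    mul x y ∈ weightComponent (m + n) := by
  refine bilinear_mem_weightComponent (fun p q => ?_) hx hy
  rw [mul, bilinearExt_single, ← wordWeight_biword p, ← wordWeight_biword q,
    ← wordWeight_shift p.1 (biword q)]
  exact shSum_cls_mem _ _

theorem prec_mem {m n : ℕ} {x y : S} (hx : x ∈ weightComponent m) (hy : y ∈ weightComponent n) :
    prec x y ∈ weightComponent (m + n) := by
  refine bilinear_mem_weightComponent (fun p q => ?_) hx hy
  rw [prec, bilinearExt_single, ← wordWeight_biword p, ← wordWeight_biword q,
    ← wordWeight_shift p.1 (biword q)]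
  exact lshSum_cls_mem _ _

theorem succ_mem {m n : ℕ} {x y : S} (hx : x ∈ weightComponent m) (hy : y ∈ weightComponent n) :
    succ x y ∈ weightComponent (m + n) := by
  refine bilinear_mem_weightComponent (fun p q => ?_) hx hy
  rw [succ, bilinearExt_single, ← wordWeight_biword p, ← wordWeight_biword q,
    ← wordWeight_shift p.1 (biword q), add_comm]
  exact lshSum_cls_mem _ _

/-! ### The symmetric bilinear form -/

/-- The inverse of a graded permutation, which exchanges positions and letters. -/
def inv (p : GradedPerm) : GradedPerm := ⟨p.1, p.2.1⁻¹, fun i => p.2.2 (p.2.1⁻¹ i)⟩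

@[simp] theorem inv_inv' (p : GradedPerm) : inv (inv p) = p := by
  obtain ⟨k, σ, d⟩ := p
  exact Sigma.ext rfl (heq_of_eq (Prod.ext rfl
    (funext fun i => congrArg d (Equiv.symm_apply_apply σ i))))

theorem inv_eq_iff {p q : GradedPerm} : inv p = q ↔ p = inv q :=
  ⟨fun h => by rw [← h, inv_inv'], fun h => by rw [h, inv_inv']⟩

@[simp] theorem weight_inv (p : GradedPerm) : weight (inv p) = weight p :=
  Equiv.sum_comp p.2.1⁻¹ fun i => (p.2.2 i : ℕ)

open Classical in
/-- The symmetric bilinear form for which a graded permutation is dual to its inverse. -/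
noncomputable def form : S →ₗ[ℚ] S →ₗ[ℚ] ℚ :=
  bilinearExt fun p q => if inv p = q then 1 else 0

open Classical in
theorem form_single (p q : GradedPerm) :
    form (Finsupp.single p 1) (Finsupp.single q 1) = if inv p = q then 1 else 0 := by
  rw [form, bilinearExt_single]

/-- Pairing with basis elements reads off coefficients, so the form is nondegenerate. -/
theorem form_single_right (x : S) (p : GradedPerm) : form x (Finsupp.single p 1) = x (inv p) := by
  classical
  induction x using S_induction with
  | hadd x x' hx hx' => simp only [map_add, LinearMap.add_apply, hx, hx', Finsupp.add_apply]
  | hsmul c x hx => simp only [map_smul, LinearMap.smul_apply, hx, Finsupp.smul_apply]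
  | hsingle q =>
    rw [form_single, Finsupp.single_apply]
    exact if_congr inv_eq_iff rfl rfl

theorem form_comm (x y : S) : form x y = form y x := by
  classical
  induction x using S_induction with
  | hadd x x' hx hx' => simp only [map_add, LinearMap.add_apply, hx, hx']
  | hsmul c x hx => simp only [map_smul, LinearMap.smul_apply, hx]
  | hsingle p =>
  induction y using S_induction with
  | hadd x x' hx hx' => simp only [map_add, LinearMap.add_apply, hx, hx']
  | hsmul c x hx => simp only [map_smul, LinearMap.smul_apply, hx]
  | hsingle q =>
    rw [form_single, form_single]
    exact if_congr (inv_eq_iff.trans eq_comm) rfl rfl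

theorem form_eq_zero_of_ne {m n : ℕ} (h : m ≠ n) {x y : S} (hx : x ∈ weightComponent m)
    (hy : y ∈ weightComponent n) : form x y = 0 := by
  rw [weightComponent_eq_span n] at hy
  induction hy using Submodule.span_induction with
  | zero => simp
  | add x x' _ _ hx hx' => rw [map_add, hx, hx', add_zero]
  | smul c x _ hx => rw [map_smul, hx, smul_zero]
  | mem y hy =>
  obtain ⟨q, rfl, rfl⟩ := hy
  rw [form_single_right]
  by_contra h0
  have : inv q ∈ {p : GradedPerm | weight p = m} := hx (Finsupp.mem_support_iff.2 h0)
  exact h ((weight_inv q).symm.trans this).symm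

/-- The bilinear form on `S ⊗ S`, with first argument a pure tensor. -/
noncomputable def form₂ (x y : S) : S ⊗[ℚ] S →ₗ[ℚ] ℚ :=
  LinearMap.mul' ℚ ℚ ∘ₗ TensorProduct.map (form x) (form y)

@[simp] theorem form₂_tmul (x y a b : S) : form₂ x y (a ⊗ₜ b) = form x a * form y b := by
  simp [form₂]

/-! ### Duality between products and coproducts -/

theorem ofFn_eq_zipIdx (w : List (ℕ × ℕ+)) :
    (List.ofFn fun i : Fin w.length => (w.get i, (i : ℕ))) = w.zipIdx := by
  refine List.ext_getElem (by simp) fun i h1 h2 => ?_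
  simp

/-- The biletters of a biword with their positions, sorted by the letters of the first row. -/
def sortedPositions (w : List (ℕ × ℕ+)) : List ((ℕ × ℕ+) × ℕ) :=
  List.ofFn fun j => (w.get (Tuple.sort (fun i : Fin w.length => (w.get i).1) j),
    (Tuple.sort (fun i : Fin w.length => (w.get i).1) j : ℕ))

theorem biword_inv_standardize (w : List (ℕ × ℕ+)) :
    biword (inv (standardize w)) = (sortedPositions w).map fun t => (t.2, t.1.2) := by
  rw [sortedPositions, List.map_ofFn, biword]
  simp only [inv, standardize, inv_inv]
  rfl

theorem sortedPositions_perm (w : List (ℕ × ℕ+)) : (sortedPositions w).Perm w.zipIdx := by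
  rw [← ofFn_eq_zipIdx]
  exact Equiv.Perm.ofFn_comp_perm (Tuple.sort fun i : Fin w.length => (w.get i).1)
    fun i : Fin w.length => (w.get i, (i : ℕ))

theorem sortedPositions_sorted (w : List (ℕ × ℕ+)) :
    (sortedPositions w).Pairwise fun s t => s.1.1 ≤ t.1.1 := by
  rw [sortedPositions, List.pairwise_ofFn]
  intro i j hij
  exact Tuple.monotone_sort (fun i : Fin w.length => (w.get i).1) hij.le

/-- With distinct keys there is only one sorted arrangement. Equalities between inverse biwords thus
reduce to equalities of multisets. -/
theorem eq_of_perm_of_sorted {L L' : List ((ℕ × ℕ+) × ℕ)} (h : L.Perm L')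
    (hL : L.Pairwise fun s t => s.1.1 ≤ t.1.1) (hL' : L'.Pairwise fun s t => s.1.1 ≤ t.1.1)
    (hn : (L'.map fun t => t.1.1).Nodup) : L = L' := by
  refine List.Perm.eq_of_pairwise ?_ hL hL' h
  intro a b ha hb hab hba
  exact List.inj_on_of_nodup_map hn (h.mem_iff.1 ha) hb (le_antisymm hab hba)

theorem nodup_zipIdx {w : List (ℕ × ℕ+)} (h : (letters w).Nodup) (k : ℕ) :
    ((w.zipIdx k).map fun t => t.1.1).Nodup := by
  have : ((w.zipIdx k).map fun t => t.1.1) = letters w := by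
    rw [letters, ← List.zipIdx_map_fst k w, List.map_map, List.zipIdx_map_fst]
    rfl
  rwa [this]

/-- Positions are the letters of the inverse, so keeping the first `x.length` positions means
keeping the letters below `x.length`. Both lists are the positions of `x` sorted by their letters.
-/
theorem filter_biword_inv_left {x y : List (ℕ × ℕ+)} (h : (letters (x ++ y)).Nodup) :
    (biword (inv (standardize (x ++ y)))).filter (fun c => c.1 < x.length) =
      biword (inv (standardize x)) := by
  rw [biword_inv_standardize, biword_inv_standardize, List.filter_map]
  congr 1
  have hx := nodup_zipIdx (nodup_of_append h).1 0
  have hp := sortedPositions_perm x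
  refine eq_of_perm_of_sorted ?_ ((sortedPositions_sorted _).filter _) (sortedPositions_sorted _)
    ((hp.map _).nodup_iff.2 hx)
  refine ((sortedPositions_perm _).filter _).trans (List.Perm.trans ?_ hp.symm)
  rw [List.zipIdx_append, List.filter_append]
  rw [List.filter_eq_self.2, List.filter_eq_nil_iff.2, List.append_nil]
  · intro t ht
    have := List.le_snd_of_mem_zipIdx ht
    simp only [Function.comp_apply, decide_eq_true_eq]; omega
  · intro t ht
    have := List.snd_lt_of_mem_zipIdx ht
    simp only [Function.comp_apply, decide_eq_true_eq]; omega

theorem filter_biword_inv_right {x y : List (ℕ × ℕ+)} (h : (letters (x ++ y)).Nodup) :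
    (biword (inv (standardize (x ++ y)))).filter (fun c => !decide (c.1 < x.length)) =
      shift x.length (biword (inv (standardize y))) := by
  rw [biword_inv_standardize, biword_inv_standardize, List.filter_map, shift, List.map_map]
  have hm : ((fun c : ℕ × ℕ+ => (c.1 + x.length, c.2)) ∘
      fun t : (ℕ × ℕ+) × ℕ => (t.2, t.1.2)) =
      (fun t : (ℕ × ℕ+) × ℕ => (t.2, t.1.2)) ∘ (Prod.map id (· + x.length)) := rfl
  rw [hm, ← List.map_map]
  congr 1
  have hy := nodup_zipIdx (nodup_of_append h).2 0
  have hp := sortedPositions_perm y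
  refine eq_of_perm_of_sorted ?_ ((sortedPositions_sorted _).filter _)
    ((sortedPositions_sorted y).map _ fun _ _ h => h) ?_
  · refine ((sortedPositions_perm _).filter _).trans (List.Perm.trans ?_ (hp.map _).symm)
    rw [List.zipIdx_append, List.filter_append]
    rw [List.filter_eq_nil_iff.2, List.filter_eq_self.2, List.nil_append, Nat.zero_add,
      List.map_snd_add_zipIdx_eq_zipIdx]
    · simp
    · intro t ht
      have := List.le_snd_of_mem_zipIdx ht
      simp only [Function.comp_apply, Bool.not_eq_true', decide_eq_false_iff_not]; omega
    · intro t ht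
      have := List.snd_lt_of_mem_zipIdx ht
      simp only [Function.comp_apply, Bool.not_eq_true', decide_eq_false_iff_not]; omega
  · rw [List.map_map]
    exact (hp.map _).nodup_iff.2 hy

section Counting

variable {A : Type*} [DecidableEq A]

/-- When `c` separates the letters of `u` from those of `v`, a word `t` arises at most once as a
shuffle, because each letter reveals its origin: `u` and `v` must be the two subwords cut out by
`c`. -/
theorem shSum_eq_filter (c : A → Bool) {u v : List A} (hu : ∀ a ∈ u, c a = true)
    (hv : ∀ b ∈ v, c b = false) (t : List A) :
    (shSum u v fun w => if w = t then (1 : ℚ) else 0) =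
      if t.filter c = u ∧ t.filter (fun a => !c a) = v then 1 else 0 := by
  induction u generalizing v t with
  | nil =>
    rw [shSum_nil_left]
    refine if_congr ⟨?_, ?_⟩ rfl rfl
    · rintro rfl
      exact ⟨List.filter_eq_nil_iff.2 fun a ha => by simp [hv a ha],
        List.filter_eq_self.2 fun a ha => by simp [hv a ha]⟩
    · rintro ⟨h1, h2⟩
      rw [← h2, List.filter_eq_self]
      intro a ha
      simpa using List.filter_eq_nil_iff.1 h1 a ha
  | cons a u ihu =>
    have ha : c a = true := hu a (by simp)
    have hu' : ∀ a ∈ u, c a = true := fun a h => hu a (by simp [h])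
    induction v generalizing t with
    | nil =>
      rw [shSum_nil_right]
      refine if_congr ⟨?_, ?_⟩ rfl rfl
      · rintro rfl
        exact ⟨List.filter_eq_self.2 fun a ha => by simp [hu a ha],
          List.filter_eq_nil_iff.2 fun a ha => by simp [hu a ha]⟩
      · rintro ⟨h1, h2⟩
        rw [← h1, List.filter_eq_self]
        intro a ha
        simpa using List.filter_eq_nil_iff.1 h2 a ha
    | cons b v ihv =>
      have hb : c b = false := hv b (by simp)
      have hv' : ∀ b ∈ v, c b = false := fun a h => hv a (by simp [h])
      rw [shSum_cons_cons]
      cases t with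
      | nil => simp [shSum]
      | cons e t =>
        have h1 := ihu hu' hv t
        have h2 := ihv hv' t
        by_cases he : c e = true
        · have hbe : b ≠ e := by rintro rfl; simp [he] at hb
          by_cases hae : a = e
          · subst hae
            simp [hbe, ha, h1]
            simp [shSum]
          · simp [hbe, hae, he, shSum, Ne.symm hae]
        · have hae : a ≠ e := by rintro rfl; exact he ha
          by_cases hbe : b = e
          · subst hbe
            simp [hae, hb, h2]
            simp [shSum]
          · simp [hbe, hae, he, shSum, Ne.symm hbe]

-- For the half-shuffle, the first letter of `t` must in addition come from `u`.
open Classical in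
theorem lshSum_eq_filter (c : A → Bool) {u v : List A} (hu : ∀ a ∈ u, c a = true)
    (hv : ∀ b ∈ v, c b = false) (t : List A) :
    (lshSum u v fun w => if w = t then (1 : ℚ) else 0) =
      if (t.filter c = u ∧ t.filter (fun a => !c a) = v) ∧ ∃ a ∈ t.head?, c a = true
        then 1 else 0 := by
  cases u with
  | nil =>
    rw [lshSum_nil, if_neg]
    rintro ⟨⟨h1, -⟩, a, ha, hc⟩
    exact List.filter_eq_nil_iff.1 h1 a (List.mem_of_mem_head? ha) hc
  | cons a u =>
    have ha : c a = true := hu a (by simp)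
    have hu' : ∀ a ∈ u, c a = true := fun a h => hu a (by simp [h])
    rw [lshSum_cons]
    cases t with
    | nil => simp [shSum]
    | cons e t =>
      have h1 := shSum_eq_filter c hu' hv t
      by_cases hae : a = e
      · subst hae
        simp [ha, h1]
      · rcases eq_or_ne (c e) true with he | he
        · simp [hae, he, shSum, Ne.symm hae]
        · simp [hae, he, shSum]

end Counting

/-! ### Matching the shuffles that yield an inverse with the cuts -/

theorem letters_biword_perm (p : GradedPerm) : (letters (biword p)).Perm (List.range p.1) := by
  refine (List.perm_ext_iff_of_nodup (nodup_biword p) List.nodup_range).2 fun a => ?_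
  rw [List.mem_range]
  refine ⟨lt_of_mem_letters_biword, fun h => ?_⟩
  rw [letters, biword, List.map_ofFn, List.mem_ofFn]
  exact ⟨p.2.1⁻¹ ⟨a, h⟩, congrArg Fin.val (Equiv.apply_symm_apply p.2.1 ⟨a, h⟩)⟩

theorem biword_standardize_of_perm {w : List (ℕ × ℕ+)} {n : ℕ}
    (h : (letters w).Perm (List.range n)) : biword (standardize w) = w := by
  rw [biword_standardize (h.nodup_iff.2 List.nodup_range)]
  conv_rhs => rw [← List.map_id w]
  refine List.map_congr_left fun c hc => Prod.ext ?_ rfl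
  have hc' : c.1 < n := List.mem_range.1 (h.mem_iff.1 (List.mem_map_of_mem hc))
  have h1 : rank w c.1 = (letters w).countP fun a => a < c.1 := by
    rw [rank, letters, List.countP_map]; rfl
  have h2 : ∀ m, (List.range m).countP (fun a => a < c.1) = min m c.1 := by
    intro m
    induction m with
    | zero => simp
    | succ m ih =>
      rw [List.range_succ, List.countP_append, ih, List.countP_singleton]
      simp only [decide_eq_true_eq]
      split_ifs <;> omega
  change rank w c.1 = c.1
  rw [h1, h.countP_eq, h2]
  omega

/-- The biword of `p` followed by the shifted biword of `q` uses the letters `0, ..., n - 1`. -/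
theorem letters_append_shift_perm (p q : GradedPerm) {w : List (ℕ × ℕ+)}
    (hw : w.Perm (biword p ++ shift p.1 (biword q))) :
    (letters w).Perm (List.range (p.1 + q.1)) := by
  refine (hw.map Prod.fst).trans ?_
  rw [List.map_append, List.range_add]
  refine (letters_biword_perm p).append ?_
  change (letters (shift p.1 (biword q))).Perm _
  rw [letters_shift]
  have h := (letters_biword_perm q).map (· + p.1)
  simpa only [add_comm] using h

open Classical in
theorem form_cls_single_of_perm {p q r : GradedPerm} {w : List (ℕ × ℕ+)}
    (hw : w.Perm (biword p ++ shift p.1 (biword q))) :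
    form (cls w) (Finsupp.single r 1) = if w = biword (inv r) then 1 else 0 := by
  rw [cls, form_single]
  refine if_congr ?_ rfl rfl
  rw [inv_eq_iff, ← biword_injective.eq_iff,
    biword_standardize_of_perm (letters_append_shift_perm p q hw)]

/-- Separating the letters of `inv r` at the value `p.1` is inverse to cutting `r` at position
`p.1`. This equates the nonzero terms on the product side with those on the coproduct side. -/
theorem standardize_take_drop_iff (p q r : GradedPerm) :
    ((biword (inv r)).filter (fun c => c.1 < p.1) = biword p ∧
      (biword (inv r)).filter (fun c => !decide (c.1 < p.1)) = shift p.1 (biword q)) ↔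
    p.1 ≤ r.1 ∧ inv p = standardize ((biword r).take p.1) ∧
      inv q = standardize ((biword r).drop p.1) := by
  by_cases hk : p.1 ≤ r.1
  · set x := (biword r).take p.1 with hx
    set y := (biword r).drop p.1 with hy
    have hxy : x ++ y = biword r := List.take_append_drop _ _
    have hl : x.length = p.1 := by
      rw [hx, List.length_take, length_biword, min_eq_left hk]
    have hn : (letters (x ++ y)).Nodup := by rw [hxy]; exact nodup_biword r
    have h1 := filter_biword_inv_left hn
    have h2 := filter_biword_inv_right hn
    rw [hxy, standardize_biword, hl] at h1 h2
    have hs : ∀ a b : GradedPerm, shift p.1 (biword a) = shift p.1 (biword b) ↔ a = b := by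
      intro a b
      refine ⟨fun h => biword_injective (List.map_injective_iff.2 ?_ h), fun h => by rw [h]⟩
      intro c d hcd
      simpa [Prod.ext_iff] using hcd
    rw [h1, h2, biword_injective.eq_iff, hs]
    exact ⟨fun h => ⟨hk, (inv_eq_iff.1 h.1).symm, (inv_eq_iff.1 h.2).symm⟩,
      fun h => ⟨inv_eq_iff.2 h.2.1.symm, inv_eq_iff.2 h.2.2.symm⟩⟩
  · refine iff_of_false (fun h => ?_) fun h => hk h.1
    have h' := congrArg List.length h.1
    have h'' := List.length_filter_le (fun c : ℕ × ℕ+ => decide (c.1 < p.1)) (biword (inv r))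
    rw [length_biword] at h' h''
    exact hk (h' ▸ h'')

open Classical in
theorem cutSum_form (p q r : GradedPerm) (c : List (ℕ × ℕ+) → List (ℕ × ℕ+) → Prop)
    [∀ x y, Decidable (c x y)] :
    (cutSum (biword r) fun x y => if c x y then
      form (Finsupp.single p 1) (cls x) * form (Finsupp.single q 1) (cls y) else 0) =
    if (p.1 ≤ r.1 ∧ inv p = standardize ((biword r).take p.1) ∧
      inv q = standardize ((biword r).drop p.1)) ∧
      c ((biword r).take p.1) ((biword r).drop p.1) then 1 else 0 := by
  -- Lengths leave a single possible cut, the one after `p.1` letters.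
  have hne : ∀ k ≤ r.1, k ≠ p.1 → inv p ≠ standardize ((biword r).take k) := by
    intro k hk hkp h
    have : p.1 = ((biword r).take k).length := congrArg Sigma.fst h
    rw [List.length_take, length_biword] at this
    omega
  rw [cutSum, length_biword]
  by_cases hk : p.1 ≤ r.1
  · rw [Finset.sum_eq_single p.1]
    · simp only [cls, form_single, hk, true_and]
      split_ifs <;> simp_all
    · intro k hk' hkp
      rw [Finset.mem_range] at hk'
      rw [cls, form_single, if_neg (hne k (by omega) hkp)]
      simp
    · intro h
      exact absurd (Finset.mem_range.2 (by omega)) h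
  · rw [if_neg fun h => hk h.1.1]
    refine Finset.sum_eq_zero fun k hk' => ?_
    rw [Finset.mem_range] at hk'
    rw [cls, form_single, if_neg (hne k (by omega) (by omega))]
    simp

/-- The first biletter of `inv r` records the position of the letter `0` in `r`. Hence the condition
on the first letter defining `≺` is dual to the condition on the smallest letter defining `Δ_≺`. -/
theorem zero_mem_take_iff (r : GradedPerm) (k : ℕ) :
    0 ∈ letters ((biword r).take k) ↔ ∃ a ∈ (biword (inv r)).head?, a.1 < k := by
  rcases Nat.eq_zero_or_pos r.1 with h0 | h0
  · have h1 : biword r = [] := List.length_eq_zero_iff.1 (by rw [length_biword, h0])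
    have h2 : biword (inv r) = [] := List.length_eq_zero_iff.1 (by rw [length_biword]; exact h0)
    simp [h1, h2]
  · have hh : (biword (inv r)).head? =
        some ((r.2.1.symm ⟨0, h0⟩ : ℕ), r.2.2 (r.2.1.symm ⟨0, h0⟩)) := by
      rw [List.head?_eq_getElem?, List.getElem?_eq_getElem (by rw [length_biword]; exact h0)]
      simp only [biword, List.getElem_ofFn]
      rfl
    rw [hh]
    simp only [Option.mem_def, Option.some.injEq, exists_eq_left']
    rw [letters, List.map_take, List.mem_take_iff_getElem]
    constructor
    · rintro ⟨i, hi, hi0⟩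
      have hi' : i < r.1 := by
        have := hi.trans_le (min_le_right _ _); simpa [length_biword] using this
      have h3 : r.2.1 ⟨i, hi'⟩ = ⟨0, h0⟩ := Fin.ext (by simpa [biword] using hi0)
      rw [← h3, Equiv.symm_apply_apply]
      exact hi.trans_le (min_le_left _ _)
    · intro h
      refine ⟨(r.2.1.symm ⟨0, h0⟩ : ℕ), lt_min h ?_, ?_⟩
      · simp [length_biword]
      · simp [biword]

theorem zero_mem_drop_iff {r : GradedPerm} {k : ℕ} :
    0 ∈ letters ((biword r).drop k) ↔
      ∃ a ∈ (biword (inv r)).head?, (!decide (a.1 < k)) = true := by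
  have h := zero_mem_take_iff r k
  have hnd : (letters ((biword r).take k ++ (biword r).drop k)).Nodup := by
    rw [List.take_append_drop]; exact nodup_biword r
  rw [letters, List.map_append] at hnd
  have hdisj := List.disjoint_of_nodup_append hnd
  have hall : 0 < r.1 → 0 ∈ letters ((biword r).take k) ∨ 0 ∈ letters ((biword r).drop k) := by
    intro h0
    rw [← List.mem_append, ← List.map_append, List.take_append_drop,
      (letters_biword_perm r).mem_iff, List.mem_range]
    exact h0
  cases hh : (biword (inv r)).head? with
  | none =>
    have h1 : biword (inv r) = [] := List.head?_eq_none_iff.1 hh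
    have h2 : biword r = [] := by
      rw [← List.length_eq_zero_iff] at h1 ⊢
      rw [length_biword] at h1 ⊢
      exact h1
    simp [h2]
  | some a =>
    have h0 : 0 < r.1 := by
      rcases Nat.eq_zero_or_pos r.1 with h0 | h0
      · rw [List.length_eq_zero_iff.1 ((length_biword (inv r)).trans h0)] at hh
        simp at hh
      · exact h0
    rw [hh] at h
    simp only [Option.mem_def, Option.some.injEq, exists_eq_left', Bool.not_eq_true',
      decide_eq_false_iff_not] at h ⊢
    rw [← h]
    exact ⟨fun h1 h2 => hdisj h2 h1, fun h1 => (hall h0).resolve_left h1⟩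

/-! ### Adjointness of products and coproducts -/

theorem form₂_add_left (x x' y : S) : form₂ (x + x') y = form₂ x y + form₂ x' y :=
  TensorProduct.ext' fun a b => by simp [add_mul]

theorem form₂_add_right (x y y' : S) : form₂ x (y + y') = form₂ x y + form₂ x y' :=
  TensorProduct.ext' fun a b => by simp [mul_add]

theorem form₂_smul_left (c : ℚ) (x y : S) : form₂ (c • x) y = c • form₂ x y :=
  TensorProduct.ext' fun a b => by simp [mul_assoc]

theorem form₂_smul_right (c : ℚ) (x y : S) : form₂ x (c • y) = c • form₂ x y :=
  TensorProduct.ext' fun a b => by simp [mul_left_comm]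

/-- A product and a coproduct which are dual to each other on basis elements are dual. -/
theorem form_eq_of_basis {f : S →ₗ[ℚ] S →ₗ[ℚ] S} {D : S →ₗ[ℚ] S ⊗[ℚ] S}
    (h : ∀ p q r, form (f (Finsupp.single p 1) (Finsupp.single q 1)) (Finsupp.single r 1) =
      form₂ (Finsupp.single p 1) (Finsupp.single q 1) (D (Finsupp.single r 1))) (x y z : S) :
    form (f x y) z = form₂ x y (D z) := by
  induction x using S_induction with
  | hadd x x' hx hx' => simp only [map_add, LinearMap.add_apply, hx, hx', form₂_add_left]
  | hsmul c x hx => simp only [map_smul, LinearMap.smul_apply, hx, form₂_smul_left]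
  | hsingle p =>
  induction y using S_induction with
  | hadd x x' hx hx' => simp only [map_add, LinearMap.add_apply, hx, hx', form₂_add_right]
  | hsmul c x hx => simp only [map_smul, LinearMap.smul_apply, hx, form₂_smul_right]
  | hsingle q =>
  induction z using S_induction with
  | hadd x x' hx hx' => simp only [map_add, hx, hx']
  | hsmul c x hx => simp only [map_smul, hx]
  | hsingle r => exact h p q r

theorem fst_lt_of_mem_biword {p : GradedPerm} {a : ℕ × ℕ+} (h : a ∈ biword p) :
    decide (a.1 < p.1) = true := by
  simpa using lt_of_mem_letters_biword (List.mem_map_of_mem h)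

theorem le_fst_of_mem_shift {k : ℕ} {w : List (ℕ × ℕ+)} {a : ℕ × ℕ+} (h : a ∈ shift k w) :
    decide (a.1 < k) = false := by
  obtain ⟨c, -, rfl⟩ := List.mem_map.1 h
  simp

theorem form_prec (x y z : S) : form (prec x y) z = form₂ x y (coprodLeft z) := by
  classical
  refine form_eq_of_basis (fun p q r => ?_) x y z
  rw [prec, bilinearExt_single]
  change form (lshSum _ _ cls) _ = _
  rw [← LinearMap.flip_apply, map_lshSum,
    lshSum_congr (G := fun w => if w = biword (inv r) then 1 else 0) fun w hw => by
      rw [LinearMap.flip_apply, form_cls_single_of_perm hw],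
    lshSum_eq_filter (fun a => decide (a.1 < p.1)) (fun _ => fst_lt_of_mem_biword)
      (fun _ => le_fst_of_mem_shift), coprodLeft, Finsupp.linearCombination_single, one_smul,
    map_cutSum]
  have h := cutSum_form p q r fun x y => 0 ∈ letters x
  simp only [apply_ite (form₂ (Finsupp.single p 1) (Finsupp.single q 1)), form₂_tmul,
    map_zero] at h ⊢
  rw [h]
  refine if_congr (and_congr (standardize_take_drop_iff p q r) ?_) rfl rfl
  simp only [zero_mem_take_iff, decide_eq_true_eq]

theorem form_succ (x y z : S) : form (succ x y) z = form₂ x y (coprodRight z) := by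
  classical
  refine form_eq_of_basis (fun p q r => ?_) x y z
  rw [succ, bilinearExt_single]
  change form (lshSum _ _ cls) _ = _
  rw [← LinearMap.flip_apply, map_lshSum,
    lshSum_congr (G := fun w => if w = biword (inv r) then 1 else 0) fun w hw => by
      rw [LinearMap.flip_apply, form_cls_single_of_perm (hw.trans List.perm_append_comm)],
    lshSum_eq_filter (fun a => !decide (a.1 < p.1))
      (fun _ h => by rw [le_fst_of_mem_shift h]; rfl)
      (fun _ h => by rw [fst_lt_of_mem_biword h]; rfl),
    coprodRight, Finsupp.linearCombination_single, one_smul, map_cutSum]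
  have h := cutSum_form p q r fun x y => 0 ∈ letters y
  simp only [apply_ite (form₂ (Finsupp.single p 1) (Finsupp.single q 1)), form₂_tmul,
    map_zero] at h ⊢
  rw [h]
  refine if_congr (and_congr ?_ zero_mem_drop_iff.symm) rfl rfl
  rw [← standardize_take_drop_iff, and_comm]
  simp only [Bool.not_not]

theorem form_mul (x y z : S) : form (mul x y) z = form₂ x y (coprod z) := by
  classical
  refine form_eq_of_basis (fun p q r => ?_) x y z
  rw [mul, bilinearExt_single, ← LinearMap.flip_apply, map_shSum,
    shSum_congr (G := fun w => if w = biword (inv r) then 1 else 0) fun w hw => by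
      rw [LinearMap.flip_apply, form_cls_single_of_perm hw],
    shSum_eq_filter (fun a => decide (a.1 < p.1)) (fun _ => fst_lt_of_mem_biword)
      (fun _ => le_fst_of_mem_shift), coprod, Finsupp.linearCombination_single, one_smul,
    map_cutSum]
  have h := cutSum_form p q r fun _ _ => True
  simp only [if_true, and_true] at h
  simp only [form₂_tmul]
  rw [h]
  exact if_congr (standardize_take_drop_iff p q r) rfl rfl

/-! ### Primitive elements as orthogonal complements -/

theorem form₂_single (p q : GradedPerm) (t : S ⊗[ℚ] S) :
    form₂ (Finsupp.single p 1) (Finsupp.single q 1) t =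
      finsuppTensorFinsupp' ℚ GradedPerm GradedPerm t (inv p, inv q) := by
  induction t with
  | zero => simp
  | add x y hx hy => simp only [map_add, hx, hy, Finsupp.add_apply]
  | tmul x y =>
    rw [form₂_tmul, form_comm, form_single_right, form_comm, form_single_right,
      finsuppTensorFinsupp'_apply_apply]

/-- The pairings with basis elements are the coordinates of a tensor. -/
theorem tensor_ext {s t : S ⊗[ℚ] S}
    (h : ∀ p q, form₂ (Finsupp.single p 1) (Finsupp.single q 1) s =
      form₂ (Finsupp.single p 1) (Finsupp.single q 1) t) : s = t := by
  apply (finsuppTensorFinsupp' ℚ GradedPerm GradedPerm).injective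
  ext ⟨p, q⟩
  have := h (inv p) (inv q)
  rwa [form₂_single, form₂_single, inv_inv', inv_inv'] at this

theorem form_one_of_mem_Splus {x : S} (hx : x ∈ Splus) : form one x = 0 := by
  induction hx using Splus_induction with
  | hzero => simp
  | hadd x y _ _ hx hy => rw [map_add, hx, hy, add_zero]
  | hsmul c x _ hx => rw [map_smul, hx, smul_zero]
  | hsingle p hp =>
    exact form_eq_zero_of_ne (weight_pos.2 hp).ne one_mem_weightComponent
      (single_mem_weightComponent p)

theorem form_one_one : form one one = 1 := by
  classical
  have h0 : inv (standardize []) = standardize [] :=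
    eq_nil_of_weight_eq_zero (by rw [weight_inv, weight_standardize_nil])
  rw [one_eq_single, form_single, if_pos h0]

/-- The elements of the augmentation ideal which are orthogonal to the products of elements of
the augmentation ideal. -/
noncomputable def primOf (f : S →ₗ[ℚ] S →ₗ[ℚ] S) : Submodule ℚ S where
  carrier := {x | x ∈ Splus ∧ ∀ y ∈ Splus, ∀ z ∈ Splus, form (f y z) x = 0}
  zero_mem' := ⟨zero_mem _, fun _ _ _ _ => map_zero _⟩
  add_mem' := fun ha hb => ⟨add_mem ha.1 hb.1, fun y hy z hz => by
    rw [map_add, ha.2 y hy z hz, hb.2 y hy z hz, add_zero]⟩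
  smul_mem' := fun c _ ha => ⟨Submodule.smul_mem _ c ha.1, fun y hy z hz => by
    rw [map_smul, ha.2 y hy z hz, smul_zero]⟩

theorem single_eq_one_or_mem (p : GradedPerm) :
    Finsupp.single p (1 : ℚ) = one ∨ Finsupp.single p (1 : ℚ) ∈ Splus := by
  rcases Nat.eq_zero_or_pos p.1 with h | h
  · exact Or.inl (single_eq_one h)
  · exact Or.inr (single_mem_Splus h)

/-- By adjointness the coordinates of `coprodLeft x` are the pairings of `x` with `p ≺ q`. These
vanish when `p` is the unit, give `x ⊗ one` when `q` is the unit, and are controlled by primitivity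
otherwise. -/
theorem mem_primOf_prec {x : S} (hx : x ∈ Splus) :
    x ∈ primOf prec ↔ coprodLeft x = x ⊗ₜ one := by
  constructor
  · intro h
    refine tensor_ext fun p q => ?_
    rw [← form_prec, form₂_tmul]
    rcases single_eq_one_or_mem p with hp | hp
    · rw [hp, prec_one_left, form_one_of_mem_Splus hx]; simp
    · rcases single_eq_one_or_mem q with hq | hq
      · rw [hq, prec_one_right hp, form_one_one, mul_one]
      · rw [h.2 _ hp _ hq, form_comm _ one, form_one_of_mem_Splus hq, mul_zero]
  · intro h
    refine ⟨hx, fun y hy z hz => ?_⟩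
    rw [form_prec, h, form₂_tmul, form_comm z, form_one_of_mem_Splus hz, mul_zero]

theorem mem_primOf_succ {x : S} (hx : x ∈ Splus) :
    x ∈ primOf succ ↔ coprodRight x = one ⊗ₜ x := by
  constructor
  · intro h
    refine tensor_ext fun p q => ?_
    rw [← form_succ, form₂_tmul]
    rcases single_eq_one_or_mem q with hq | hq
    · rw [hq, succ_one_right, form_one_of_mem_Splus hx]; simp
    · rcases single_eq_one_or_mem p with hp | hp
      · rw [hp, succ_one_left hq, form_one_one, one_mul]
      · rw [h.2 _ hp _ hq, form_comm _ one, form_one_of_mem_Splus hp, zero_mul]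
  · intro h
    refine ⟨hx, fun y hy z hz => ?_⟩
    rw [form_succ, h, form₂_tmul, form_comm y, form_one_of_mem_Splus hy, zero_mul]

theorem coprod_of_mem_primOf {x : S} (h : x ∈ primOf mul) :
    coprod x = x ⊗ₜ one + one ⊗ₜ x := by
  refine tensor_ext fun p q => ?_
  rw [← form_mul, map_add, form₂_tmul, form₂_tmul]
  rcases single_eq_one_or_mem p with hp | hp
  · rw [hp, one_mul', form_one_of_mem_Splus h.1, form_one_one]; simp
  · rcases single_eq_one_or_mem q with hq | hq
    · rw [hq, mul_one', form_one_of_mem_Splus h.1, form_one_one]; simp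
    · rw [h.2 _ hp _ hq, form_comm _ one, form_one_of_mem_Splus hq, form_comm _ one,
        form_one_of_mem_Splus hp]
      simp

theorem cutSum_biword_eq {M : Type*} [AddCommMonoid M] {p : GradedPerm} (hp : 0 < p.1)
    (G : List (ℕ × ℕ+) → List (ℕ × ℕ+) → M) :
    cutSum (biword p) G = G [] (biword p) +
      ∑ k ∈ Finset.Ico 1 p.1, G ((biword p).take k) ((biword p).drop k) + G (biword p) [] := by
  rw [cutSum, length_biword, Finset.sum_range_succ, Finset.range_eq_Ico,
    Finset.sum_eq_sum_Ico_succ_bot hp]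
  rw [List.take_of_length_le (length_biword p).le, List.drop_of_length_le (length_biword p).le]
  rfl

theorem zero_mem_letters_biword {p : GradedPerm} (hp : 0 < p.1) : 0 ∈ letters (biword p) := by
  rw [(letters_biword_perm p).mem_iff, List.mem_range]
  exact hp

/-- Of the two extreme cuts, only the one with empty right part has the smallest letter on the left.
-/
theorem coprodLeft_eq {x : S} (hx : x ∈ Splus) : coprodLeft x = coprodPrec x + x ⊗ₜ one := by
  induction hx using Splus_induction with
  | hzero => simp
  | hadd x y _ _ hx hy => rw [map_add, map_add, hx, hy, TensorProduct.add_tmul]; abel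
  | hsmul c x _ hx => rw [map_smul, map_smul, hx, smul_add, TensorProduct.smul_tmul']
  | hsingle p hp =>
    rw [coprodLeft, coprodPrec, Finsupp.linearCombination_single,
      Finsupp.linearCombination_single, one_smul, one_smul, cutSum_biword_eq hp,
      if_pos (zero_mem_letters_biword hp), Finset.sum_filter, cls_biword]
    simp [cls, one]

theorem coprodRight_eq {x : S} (hx : x ∈ Splus) : coprodRight x = coprodSucc x + one ⊗ₜ x := by
  induction hx using Splus_induction with
  | hzero => simp
  | hadd x y _ _ hx hy => rw [map_add, map_add, hx, hy, TensorProduct.tmul_add]; abel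
  | hsmul c x _ hx => rw [map_smul, map_smul, hx, smul_add, TensorProduct.tmul_smul]
  | hsingle p hp =>
    rw [coprodRight, coprodSucc, Finsupp.linearCombination_single,
      Finsupp.linearCombination_single, one_smul, one_smul, cutSum_biword_eq hp,
      if_pos (zero_mem_letters_biword hp), Finset.sum_filter, cls_biword]
    simp [cls, one, add_comm]

theorem mem_primDend {x : Splus} :
    x ∈ primDend ↔ (x : S) ∈ primOf prec ∧ (x : S) ∈ primOf succ := by
  rw [mem_primOf_prec x.2, mem_primOf_succ x.2, coprodLeft_eq x.2, coprodRight_eq x.2,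
    add_eq_right, add_eq_right]
  rfl

/-! ### Finiteness and orthogonality in a fixed weight -/

/-- There are at most `n` letters, of degrees between `1` and `n`; `Fin n` encodes the degree minus
one. -/
theorem finite_weight_eq (n : ℕ) : {p : GradedPerm | weight p = n}.Finite := by
  have h : {p : GradedPerm | weight p = n} ⊆ Set.range
      fun t : Σ k : Fin (n + 1), Equiv.Perm (Fin k) × (Fin k → Fin n) =>
        (⟨t.1, t.2.1, fun i => ⟨(t.2.2 i : ℕ) + 1, Nat.succ_pos _⟩⟩ : GradedPerm) := by
    rintro ⟨k, σ, d⟩ hp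
    have hk : k < n + 1 := by have := le_weight ⟨k, σ, d⟩; rw [hp] at this; exact Nat.lt_succ_of_le this
    have hd : ∀ i, (d i : ℕ) - 1 < n := by
      intro i
      have h1 : (d i : ℕ) ≤ n := by
        rw [← hp]
        exact Finset.single_le_sum (f := fun i => (d i : ℕ)) (fun _ _ => Nat.zero_le _)
          (Finset.mem_univ i)
      have := (d i).pos
      omega
    refine ⟨⟨⟨k, hk⟩, σ, fun i => ⟨(d i : ℕ) - 1, hd i⟩⟩, ?_⟩
    refine Sigma.ext rfl (heq_of_eq (Prod.ext rfl (funext fun i => PNat.eq ?_)))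
    exact Nat.sub_add_cancel (d i).pos
  exact (Set.finite_range _).subset h

theorem finite_weight_lt (n : ℕ) : {p : GradedPerm | weight p < n}.Finite := by
  have : {p : GradedPerm | weight p < n} = ⋃ m : Fin n, {p | weight p = m} := by
    ext p
    simp only [Set.mem_ofPred_eq, Set.mem_iUnion]
    exact ⟨fun h => ⟨⟨_, h⟩, rfl⟩, fun ⟨m, hm⟩ => hm ▸ m.2⟩
  rw [this]
  exact Set.finite_iUnion fun m => finite_weight_eq m

instance finite_weightComponent (n : ℕ) : Module.Finite ℚ (weightComponent n) := by
  rw [weightComponent_eq_span]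
  exact FiniteDimensional.span_of_finite ℚ ((finite_weight_eq n).image _)

theorem sum_single_mem_weightComponent {n : ℕ} {x : S} (hx : x ∈ weightComponent n) :
    x = ∑ p ∈ (finite_weight_eq n).toFinset, x p • Finsupp.single p (1 : ℚ) := by
  conv_lhs => rw [← Finsupp.sum_single x]
  rw [Finsupp.sum_of_support_subset x (s := (finite_weight_eq n).toFinset)
    (fun p hp => by rw [Set.Finite.mem_toFinset]; exact hx hp) _ (fun _ _ => Finsupp.single_zero _)]
  simp

/-- Double orthogonality in a fixed weight. -/
theorem mem_of_orthogonal {n : ℕ} {C : Submodule ℚ S} {x : S}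
    (hx : x ∈ weightComponent n)
    (h : ∀ y ∈ weightComponent n, (∀ c ∈ C, form c y = 0) → form x y = 0)
    (hC : C ≤ weightComponent n) : x ∈ C := by
  by_contra hxC
  obtain ⟨g, hg, hgC⟩ := Submodule.exists_le_ker_of_notMem hxC
  -- On weight `n` the functional `g` is the pairing with `y`, since each graded permutation is dual
  -- to its inverse.
  set y : S := ∑ p ∈ (finite_weight_eq n).toFinset,
    g (Finsupp.single p 1) • Finsupp.single (inv p) (1 : ℚ) with hy
  have hform : ∀ z ∈ weightComponent n, form z y = g z := by
    intro z hz
    conv_rhs => rw [sum_single_mem_weightComponent hz]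
    rw [hy, map_sum, map_sum]
    refine Finset.sum_congr rfl fun p _ => ?_
    rw [map_smul, map_smul, form_single_right, inv_inv', smul_eq_mul, smul_eq_mul, mul_comm]
  have hyn : y ∈ weightComponent n := by
    refine Submodule.sum_mem _ fun p hp => Submodule.smul_mem _ _ ?_
    rw [Set.Finite.mem_toFinset] at hp
    have := single_mem_weightComponent (inv p)
    rwa [weight_inv, hp] at this
  refine hg ?_
  rw [← hform x hx]
  refine h y hyn fun c hc => ?_
  rw [hform c (hC hc)]
  exact hgC hc

/-! ### Homogeneous components of the primitive elements and of the products -/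

/-- The span of the products of total weight `n` of homogeneous elements of positive weight. -/
noncomputable def prodDeg (f : S →ₗ[ℚ] S →ₗ[ℚ] S) (n : ℕ) : Submodule ℚ S :=
  Submodule.span ℚ {t | ∃ i j, 0 < i ∧ 0 < j ∧ i + j = n ∧
    ∃ y ∈ weightComponent i, ∃ z ∈ weightComponent j, t = f y z}

/-- The elements of weight `n` of `primOf f`. -/
noncomputable def primDeg (f : S →ₗ[ℚ] S →ₗ[ℚ] S) (n : ℕ) : Submodule ℚ S :=
  primOf f ⊓ weightComponent n

/-- A bilinear operation which is compatible with the weights. -/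
def Homogeneous (f : S →ₗ[ℚ] S →ₗ[ℚ] S) : Prop :=
  ∀ {m n : ℕ} {x y : S}, x ∈ weightComponent m → y ∈ weightComponent n →
    f x y ∈ weightComponent (m + n)

theorem apply_mem_prodDeg (f : S →ₗ[ℚ] S →ₗ[ℚ] S) {i j : ℕ} (hi : 0 < i) (hj : 0 < j) {y z : S}
    (hy : y ∈ weightComponent i) (hz : z ∈ weightComponent j) : f y z ∈ prodDeg f (i + j) :=
  Submodule.subset_span ⟨i, j, hi, hj, rfl, y, hy, z, hz, rfl⟩

theorem prodDeg_le {f : S →ₗ[ℚ] S →ₗ[ℚ] S} (hf : Homogeneous f) (n : ℕ) :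
    prodDeg f n ≤ weightComponent n := by
  refine Submodule.span_le.2 ?_
  rintro _ ⟨i, j, -, -, rfl, y, hy, z, hz, rfl⟩
  exact hf hy hz

theorem primDeg_le (f : S →ₗ[ℚ] S →ₗ[ℚ] S) (n : ℕ) : primDeg f n ≤ weightComponent n :=
  inf_le_right

theorem form_eq_zero_of_mem_prodDeg {f : S →ₗ[ℚ] S →ₗ[ℚ] S} {n : ℕ} {c x : S}
    (hc : c ∈ prodDeg f n) (hx : x ∈ primOf f) : form c x = 0 := by
  induction hc using Submodule.span_induction with
  | zero => simp
  | add a b _ _ ha hb => rw [map_add, LinearMap.add_apply, ha, hb, add_zero]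
  | smul r a _ ha => rw [map_smul, LinearMap.smul_apply, ha, smul_zero]
  | mem t ht =>
    obtain ⟨i, j, hi, hj, -, y, hy, z, hz, rfl⟩ := ht
    exact hx.2 y (weightComponent_le_Splus hi hy) z (weightComponent_le_Splus hj hz)

/-- Products of total weight other than `n` are orthogonal to `x` in any case. -/
theorem mem_primDeg_of_orthogonal {f : S →ₗ[ℚ] S →ₗ[ℚ] S} (hf : Homogeneous f) {n : ℕ}
    (hn : 0 < n) {x : S} (hx : x ∈ weightComponent n) (h : ∀ c ∈ prodDeg f n, form c x = 0) :
    x ∈ primDeg f n := by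
  refine ⟨⟨weightComponent_le_Splus hn hx, fun y hy z hz => ?_⟩, hx⟩
  induction hy using Splus_induction with
  | hzero => simp
  | hadd a b _ _ ha hb => rw [map_add, LinearMap.add_apply, map_add, LinearMap.add_apply, ha, hb,
      add_zero]
  | hsmul r a _ ha => rw [map_smul, LinearMap.smul_apply, map_smul, LinearMap.smul_apply, ha,
      smul_zero]
  | hsingle p hp =>
  induction hz using Splus_induction with
  | hzero => simp
  | hadd a b _ _ ha hb => rw [map_add, map_add, LinearMap.add_apply, ha, hb, add_zero]
  | hsmul r a _ ha => rw [map_smul, map_smul, LinearMap.smul_apply, ha, smul_zero]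
  | hsingle q hq =>
  have hpq := hf (single_mem_weightComponent p) (single_mem_weightComponent q)
  rcases eq_or_ne (weight p + weight q) n with h1 | h1
  · refine h _ ?_
    rw [← h1]
    exact apply_mem_prodDeg f (weight_pos.2 hp) (weight_pos.2 hq) (single_mem_weightComponent p)
      (single_mem_weightComponent q)
  · exact form_eq_zero_of_ne h1 hpq hx

/-- An element of weight `n` orthogonal to the primitive elements is a sum of products. -/
theorem mem_prodDeg_of_orthogonal {f : S →ₗ[ℚ] S →ₗ[ℚ] S} (hf : Homogeneous f) {n : ℕ}
    (hn : 0 < n) {x : S} (hx : x ∈ weightComponent n) (h : ∀ y ∈ primDeg f n, form x y = 0) :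
    x ∈ prodDeg f n :=
  mem_of_orthogonal hx (fun y hy hc => h y (mem_primDeg_of_orthogonal hf hn hy hc))
    (prodDeg_le hf n)

/-! ### Products as right actions, and orthogonal decompositions -/

/-- A homogeneous right action of `(S, mul)` on the augmentation ideal. -/
structure IsRightAction (f : S →ₗ[ℚ] S →ₗ[ℚ] S) : Prop where
  homogeneous : Homogeneous f
  assoc : ∀ x y z, f (f x y) z = f x (mul y z)
  unit : ∀ x ∈ Splus, f x one = x

theorem isRightAction_prec : IsRightAction prec :=
  ⟨prec_mem, prec_prec, fun _ hx => prec_one_right hx⟩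

theorem isRightAction_mul : IsRightAction mul :=
  ⟨mul_mem, mul_mul, fun x _ => mul_one' x⟩

/-- Two right actions for which the bilinear form factorizes. -/
structure IsGramPair (f g : S →ₗ[ℚ] S →ₗ[ℚ] S) : Prop where
  left : IsRightAction f
  right : IsRightAction g
  gram : ∀ w ∈ primOf g, ∀ z ∈ primOf f, ∀ b t, form (f w b) (g z t) = form w z * form b t

theorem IsGramPair.symm {f g : S →ₗ[ℚ] S →ₗ[ℚ] S} (h : IsGramPair f g) : IsGramPair g f :=
  ⟨h.right, h.left, fun w hw z hz b t => by
    rw [form_comm, h.gram z hz w hw, form_comm z, form_comm t]⟩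

/-- A primitive `z` is orthogonal to `f w a` for `a` in the augmentation ideal, so only the
coefficient of the unit in `a` survives. -/
theorem form_action {f : S →ₗ[ℚ] S →ₗ[ℚ] S} (hf : IsRightAction f) {w z : S} (hw : w ∈ Splus)
    (hz : z ∈ primOf f) (a : S) : form z (f w a) = form w z * form one a := by
  induction a using S_induction with
  | hadd x y hx hy => rw [map_add, map_add, map_add, hx, hy, mul_add]
  | hsmul c x hx => rw [map_smul, map_smul, map_smul, hx, smul_eq_mul, smul_eq_mul, mul_left_comm]
  | hsingle p =>
    rcases single_eq_one_or_mem p with hp | hp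
    · rw [hp, hf.unit w hw, form_one_one, mul_one, form_comm]
    · rw [form_comm, hz.2 w hw _ hp, form_one_of_mem_Splus hp, mul_zero]

/-- Adjointness moves `z ≺ t` onto `coprodLeft (f w b)`, which by `h` is `∑ f w b' ⊗ b''` over the
cuts of `b`. Pairing the first factor with `z` retains only the cut with `b'` the unit. -/
theorem form_prec_action {f : S →ₗ[ℚ] S →ₗ[ℚ] S} (hf : IsRightAction f) {w z : S}
    (hw : w ∈ Splus) (hz : z ∈ primOf f) (b t : S)
    (h : coprodLeft (f w b) = pairMul f mul (w ⊗ₜ one) (coprod b)) :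
    form (f w b) (prec z t) = form w z * form b t := by
  have key : ∀ D : S ⊗[ℚ] S,
      form₂ z t (pairMul f mul (w ⊗ₜ one) D) = form w z * form₂ one t D := by
    intro D
    induction D with
    | zero => simp
    | add x y hx hy => rw [map_add, map_add, map_add, hx, hy, mul_add]
    | tmul a c =>
      rw [pairMul_tmul, one_mul', form₂_tmul, form₂_tmul, form_action hf hw hz, mul_assoc]
  rw [form_comm, form_prec, h, key, ← form_mul, one_mul', form_comm b]

theorem isGramPair_prec_prec : IsGramPair prec prec where
  left := isRightAction_prec
  right := isRightAction_prec
  gram w hw z hz b t := form_prec_action isRightAction_prec hw.1 hz b t (by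
    rw [coprodLeft_prec, (mem_primOf_prec hw.1).1 hw])

/-- The two formulas for `coprodLeft` of `w ≺ b` and `w ≻ b` add up to one with `mul` on both
factors. Comparing this pair with `(≺, ≺)` relates the two kinds of primitive elements. -/
theorem isGramPair_mul_prec : IsGramPair mul prec where
  left := isRightAction_mul
  right := isRightAction_prec
  gram w hw z hz b t := form_prec_action isRightAction_mul hw.1 hz b t (by
    rw [mul_eq_left hw.1, map_add, coprodLeft_prec, coprodLeft_succ hw.1,
      (mem_primOf_prec hw.1).1 hw]
    generalize coprod b = D
    induction D with
    | zero => simp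
    | add x y hx hy => simp only [map_add, ← hx, ← hy]; abel
    | tmul a c =>
      rw [pairMul_tmul, pairMul_tmul, pairMul_tmul, mul_eq_left hw.1, TensorProduct.add_tmul])

/-- The graded permutations of positive weight less than `n`. -/
noncomputable def lowWeight (n : ℕ) : Finset GradedPerm :=
  (finite_weight_lt n).toFinset.filter fun p => 0 < weight p

theorem mem_lowWeight {n : ℕ} {p : GradedPerm} :
    p ∈ lowWeight n ↔ 0 < weight p ∧ weight p < n := by
  rw [lowWeight, Finset.mem_filter, Set.Finite.mem_toFinset, Set.mem_ofPred_eq, and_comm]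

/-- The map `(w_p) ↦ ∑ f w_p p`. -/
noncomputable def expansion (f g : S →ₗ[ℚ] S →ₗ[ℚ] S) (n : ℕ) :
    ((p : lowWeight n) → primDeg g (n - weight p)) →ₗ[ℚ] S :=
  LinearMap.lsum ℚ _ ℚ fun p => (f.flip (Finsupp.single p 1)).comp (Submodule.subtype _)

theorem expansion_apply (f g : S →ₗ[ℚ] S →ₗ[ℚ] S) (n : ℕ)
    (w : (p : lowWeight n) → primDeg g (n - weight p)) :
    expansion f g n w = ∑ p : lowWeight n, f (w p) (Finsupp.single p 1) := by
  simp [expansion, LinearMap.lsum_apply, LinearMap.sum_apply]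

theorem mem_range_expansion (f g : S →ₗ[ℚ] S →ₗ[ℚ] S) {n : ℕ} {p : GradedPerm}
    (hp : p ∈ lowWeight n) {w : S} (hw : w ∈ primDeg g (n - weight p)) :
    f w (Finsupp.single p 1) ∈ LinearMap.range (expansion f g n) := by
  classical
  refine ⟨Pi.single (⟨p, hp⟩ : lowWeight n) ⟨w, hw⟩, ?_⟩
  rw [expansion, LinearMap.lsum_piSingle]
  simp

/-! ### Unique expansions, and primitive elements as complements of products -/

variable {f g : S →ₗ[ℚ] S →ₗ[ℚ] S}

/-- In a product `f y z`, the factor `y` is split into a primitive element and products `f a b`. The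
latter are rewritten as `f (f a b) z = f a (b * z)`, where `a` has smaller weight than `y`. -/
theorem prodDeg_le_range_expansion (hf : IsRightAction f) {n : ℕ}
    (hsup : ∀ k, 0 < k → k < n → weightComponent k ≤ primDeg g k ⊔ prodDeg f k) :
    prodDeg f n ≤ LinearMap.range (expansion f g n) := by
  have key : ∀ i, ∀ j, 0 < i → 0 < j → i + j = n → ∀ y ∈ weightComponent i,
      ∀ z ∈ weightComponent j, f y z ∈ LinearMap.range (expansion f g n) := by
    intro i
    induction i using Nat.strong_induction_on with
    | _ i ih =>
    intro j hi hj hij y hy z hz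
    obtain ⟨w, hw, c, hc, rfl⟩ := Submodule.mem_sup.1 (hsup i hi (by omega) hy)
    rw [map_add, LinearMap.add_apply]
    refine add_mem ?_ ?_
    · rw [sum_single_mem_weightComponent hz, map_sum]
      refine Submodule.sum_mem _ fun q hq => ?_
      rw [Set.Finite.mem_toFinset, Set.mem_ofPred_eq] at hq
      rw [map_smul]
      refine Submodule.smul_mem _ _ (mem_range_expansion f g (mem_lowWeight.2 ?_) ?_)
      · omega
      · rwa [hq, ← hij, Nat.add_sub_cancel]
    · have hc' := hc
      clear hy hc
      induction hc' using Submodule.span_induction with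
      | zero => simp
      | add a b _ _ ha hb => rw [map_add, LinearMap.add_apply]; exact add_mem ha hb
      | smul r a _ ha => rw [map_smul, LinearMap.smul_apply]; exact Submodule.smul_mem _ r ha
      | mem t ht =>
        obtain ⟨i', j', hi', hj', h', a, ha, b, hb, rfl⟩ := ht
        rw [hf.assoc]
        exact ih i' (by omega) (j' + j) hi' (by omega) (by omega) a ha _ (mul_mem hb hz)
  refine Submodule.span_le.2 ?_
  rintro _ ⟨i, j, hi, hj, hij, y, hy, z, hz, rfl⟩
  exact key i j hi hj hij y hy z hz

/-- By the factorization of the form, pairing with `g z (inv t)` isolates the coefficient at `t`. -/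
theorem form_expansion (h : IsGramPair f g) {n : ℕ}
    (w : (p : lowWeight n) → primDeg g (n - weight p)) (t : lowWeight n) {z : S}
    (hz : z ∈ primOf f) :
    form (expansion f g n w) (g z (Finsupp.single (inv t) 1)) = form (w t) z := by
  classical
  rw [expansion_apply, map_sum, LinearMap.sum_apply, Finset.sum_eq_single t]
  · rw [h.gram _ (w t).2.1 _ hz, form_single, if_pos rfl, mul_one]
  · intro p _ hp
    rw [h.gram _ (w p).2.1 _ hz, form_single, if_neg, mul_zero]
    intro h'
    exact hp (Subtype.ext (by rw [inv_eq_iff, inv_inv'] at h'; exact h'))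
  · simp

/-- The orthogonal of `primDeg g n ⊔ prodDeg f n` is `primDeg f n ⊓ prodDeg g n`. Spanning for `(f,
g)` is thus disjointness for `(g, f)`, which is why the induction carries both. -/
theorem weightComponent_le_sup (hf : Homogeneous f) (hg : Homogeneous g) {n : ℕ} (hn : 0 < n)
    (h : ∀ x ∈ primDeg f n, x ∈ prodDeg g n → x = 0) :
    weightComponent n ≤ primDeg g n ⊔ prodDeg f n := by
  intro x hx
  refine mem_of_orthogonal hx (fun y hy hc => ?_) (sup_le (primDeg_le g n) (prodDeg_le hf n))
  have h1 : y ∈ primDeg f n := mem_primDeg_of_orthogonal hf hn hy fun c hc' =>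
    hc c (Submodule.mem_sup_right hc')
  have h2 : y ∈ prodDeg g n := mem_prodDeg_of_orthogonal hg hn hy fun c hc' => by
    rw [form_comm]; exact hc c (Submodule.mem_sup_left hc')
  rw [h y h1 h2, map_zero]

/-- Expand the product `x` with coefficients `w t`. Being primitive for `g`, `x` is orthogonal to
all `g z (inv t)`, so each `w t` is orthogonal to the primitive elements for `f` and is a sum of
products for `f`. It is also primitive for `g` and of smaller weight, hence zero by induction. -/
theorem IsGramPair.disjoint_step (h : IsGramPair f g) {n : ℕ}
    (ih : ∀ k, 0 < k → k < n → (∀ x ∈ primDeg g k, x ∈ prodDeg f k → x = 0) ∧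
      ∀ x ∈ primDeg f k, x ∈ prodDeg g k → x = 0) :
    ∀ x ∈ primDeg g n, x ∈ prodDeg f n → x = 0 := by
  intro x hx hx'
  obtain ⟨w, rfl⟩ := prodDeg_le_range_expansion (g := g) h.left (fun k hk hkn =>
    weightComponent_le_sup h.left.homogeneous h.right.homogeneous hk (ih k hk hkn).2) hx'
  have hw : w = 0 := by
    funext t
    obtain ⟨ht0, htn⟩ := mem_lowWeight.1 t.2
    refine Subtype.ext ((ih (n - weight t) (by omega) (by omega)).1 _ (w t).2 ?_)
    refine mem_prodDeg_of_orthogonal h.left.homogeneous (by omega) (w t).2.2 fun z hz => ?_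
    rw [← form_expansion h w t hz.1, form_comm]
    refine form_eq_zero_of_mem_prodDeg (n := n) ?_ hx.1
    have := apply_mem_prodDeg g (by omega) (by rw [weight_inv]; omega) hz.2
      (single_mem_weightComponent (inv t))
    rwa [weight_inv, Nat.sub_add_cancel htn.le] at this
  rw [hw, map_zero]

theorem IsGramPair.disjoint (h : IsGramPair f g) (n : ℕ) :
    (∀ x ∈ primDeg g n, x ∈ prodDeg f n → x = 0) ∧
      ∀ x ∈ primDeg f n, x ∈ prodDeg g n → x = 0 := by
  induction n using Nat.strong_induction_on with
  | _ n ih =>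
    exact ⟨h.disjoint_step fun k _ hk => ih k hk, h.symm.disjoint_step fun k _ hk => (ih k hk).symm⟩

theorem IsGramPair.sup_eq (h : IsGramPair f g) {n : ℕ} (hn : 0 < n) :
    primDeg g n ⊔ prodDeg f n = weightComponent n :=
  le_antisymm (sup_le (primDeg_le g n) (prodDeg_le h.left.homogeneous n))
    (weightComponent_le_sup h.left.homogeneous h.right.homogeneous hn (h.disjoint n).2)

theorem IsGramPair.inf_eq (h : IsGramPair f g) (n : ℕ) :
    primDeg g n ⊓ prodDeg f n = ⊥ :=
  (Submodule.eq_bot_iff _).2 fun x hx => (h.disjoint n).1 x hx.1 hx.2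

instance finite_primDeg (f : S →ₗ[ℚ] S →ₗ[ℚ] S) (n : ℕ) : Module.Finite ℚ (primDeg f n) :=
  Submodule.finiteDimensional_of_le (primDeg_le f n)

theorem IsGramPair.finite_prodDeg (h : IsGramPair f g) (n : ℕ) :
    Module.Finite ℚ (prodDeg f n) :=
  Submodule.finiteDimensional_of_le (prodDeg_le h.left.homogeneous n)

theorem IsGramPair.finrank_add (h : IsGramPair f g) {n : ℕ} (hn : 0 < n) :
    Module.finrank ℚ (primDeg g n) + Module.finrank ℚ (prodDeg f n) =
      Module.finrank ℚ (weightComponent n) := by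
  have := h.finite_prodDeg n
  have h1 := Submodule.finrank_sup_add_finrank_inf_eq (primDeg g n) (prodDeg f n)
  rw [h.sup_eq hn, h.inf_eq, finrank_bot, add_zero] at h1
  exact h1.symm

theorem IsGramPair.expansion_injective (h : IsGramPair f g) (n : ℕ) :
    Function.Injective (expansion f g n) := by
  refine (injective_iff_map_eq_zero _).2 fun w hw => ?_
  funext t
  obtain ⟨ht0, htn⟩ := mem_lowWeight.1 t.2
  refine Subtype.ext ((h.disjoint (n - weight t)).1 _ (w t).2 ?_)
  refine mem_prodDeg_of_orthogonal h.left.homogeneous (by omega) (w t).2.2 fun z hz => ?_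
  rw [← form_expansion h w t hz.1, hw, map_zero, LinearMap.zero_apply]

theorem IsGramPair.range_expansion (h : IsGramPair f g) (n : ℕ) :
    LinearMap.range (expansion f g n) = prodDeg f n := by
  refine le_antisymm ?_ (prodDeg_le_range_expansion h.left fun k hk _ => (h.sup_eq hk).ge)
  rintro _ ⟨w, rfl⟩
  rw [expansion_apply]
  refine Submodule.sum_mem _ fun p _ => ?_
  obtain ⟨h0, hn⟩ := mem_lowWeight.1 p.2
  have := apply_mem_prodDeg f (by omega) h0 (w p).2.2 (single_mem_weightComponent p)
  rwa [Nat.sub_add_cancel hn.le] at this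

theorem IsGramPair.finrank_prodDeg (h : IsGramPair f g) (n : ℕ) :
    Module.finrank ℚ (prodDeg f n) =
      ∑ p ∈ lowWeight n, Module.finrank ℚ (primDeg g (n - weight p)) := by
  rw [← h.range_expansion n, LinearMap.finrank_range_of_inj (h.expansion_injective n),
    Module.finrank_pi_fintype]
  exact Finset.sum_coe_sort (lowWeight n) fun p => Module.finrank ℚ (primDeg g (n - weight p))

/-- Both spaces are complements of `prodDeg prec n`. -/
theorem finrank_primDeg_mul {n : ℕ} (hn : 0 < n) :
    Module.finrank ℚ (primDeg mul n) = Module.finrank ℚ (primDeg prec n) := by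
  have h1 := isGramPair_prec_prec.finrank_add hn
  have h2 := isGramPair_mul_prec.symm.finrank_add hn
  omega

/-! ### The products `c ≻ u` with `c` primitive for `≺` and `u` primitive for the product -/

theorem succ_mem_Splus (x y : S) : succ x y ∈ Splus :=
  bilinearExt_mem (fun _ _ => sum_leftShuffles_mem _ _) x y

/-- Combining `c ⊗ 1` with `u ⊗ 1 + 1 ⊗ u` gives `(c ≻ u) ⊗ 1` and a term containing `c ≻ 1 = 0`. -/
theorem succ_mem_primOf_prec {c u : S} (hc : c ∈ primOf prec) (hu : u ∈ primOf mul) :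
    succ c u ∈ primOf prec := by
  rw [mem_primOf_prec (succ_mem_Splus c u), coprodLeft_succ hc.1, (mem_primOf_prec hc.1).1 hc,
    coprod_of_mem_primOf hu, map_add, pairMul_tmul, pairMul_tmul, one_mul', succ_one_right,
    TensorProduct.zero_tmul, add_zero]

theorem coprodRight_succ_of_mem_primOf {c u : S} (hc : c ∈ Splus) (hu : u ∈ primOf mul) :
    coprodRight (succ c u) =
      one ⊗ₜ succ c u + TensorProduct.map (succ.flip u) LinearMap.id (coprodRight c) := by
  rw [coprodRight_succ hc, coprod_of_mem_primOf hu]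
  congr 1
  generalize coprodRight c = D
  induction D with
  | zero => simp
  | add x y hx hy =>
    have h := map_add (pairMul succ mul) x y
    rw [h, LinearMap.add_apply, hx, hy, map_add]
  | tmul a b => simp

/-- All cuts but the first have a right part of weight less than `n ≤ m`, hence orthogonal to `w`;
only `one ⊗ c` contributes. -/
theorem form₂_coprodRight {m n : ℕ} (hn : 0 < n) (hnm : n ≤ m) {c w : S}
    (hc : c ∈ weightComponent n) (hw : w ∈ weightComponent m) (b : S) (h : S →ₗ[ℚ] S) :
    form₂ b w (TensorProduct.map h LinearMap.id (coprodRight c)) =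
      form b (h one) * form w c := by
  rw [weightComponent_eq_span n] at hc
  induction hc using Submodule.span_induction with
  | zero => simp
  | add x y _ _ hx hy => simp only [map_add, hx, hy, mul_add]
  | smul r x _ hx => simp only [map_smul, hx, smul_eq_mul, mul_left_comm]
  | mem x hx =>
  obtain ⟨p, hp, rfl⟩ := hx
  change weight p = n at hp
  have hp0 : 0 < p.1 := weight_pos.1 (by omega)
  rw [coprodRight, Finsupp.linearCombination_single, one_smul, map_cutSum, map_cutSum]
  have hz := zero_mem_letters_biword hp0
  have hcls := cls_biword p
  have hwt := wordWeight_biword p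
  cases hb : biword p with
  | nil => exact absurd hb (biword_ne_nil hp0)
  | cons a l =>
    rw [hb] at hz hcls hwt
    rw [cutSum_cons, if_pos hz, hcls]
    rw [cutSum_congr (G := fun _ _ => (0 : ℚ)), cutSum_zero, add_zero]
    · simp [one]
    · intro x y hxy
      have h1 : wordWeight (a :: l) = (a.2 : ℕ) + (wordWeight x + wordWeight y) := by
        rw [← wordWeight_append, hxy]; simp [wordWeight]
      have h2 := a.2.pos
      have h3 : form w (cls y) = 0 :=
        form_eq_zero_of_ne (by omega) hw (cls_mem_weightComponent y)
      split_ifs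
      · simp [h3]
      · simp

/-- The factors pair crosswise, and only when `w` weighs at least as much as `c`. The Gram matrix of
the products `c ≻ u` is therefore block triangular rather than block diagonal. -/
theorem form_succ_succ {m n : ℕ} (hn : 0 < n) (hnm : n ≤ m) {b w c u : S} (hb : b ∈ Splus)
    (hw : w ∈ weightComponent m) (hc : c ∈ weightComponent n) (hu : u ∈ primOf mul) :
    form (succ b w) (succ c u) = form b u * form w c := by
  rw [form_succ, coprodRight_succ_of_mem_primOf (weightComponent_le_Splus hn hc) hu, map_add,
    form₂_tmul, form_comm b one, form_one_of_mem_Splus hb, zero_mul, zero_add,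
    form₂_coprodRight hn hnm hc hw, LinearMap.flip_apply, succ_one_left hu.1]

/-- The span of the products `c ≻ u` of total weight `n`. -/
noncomputable def mixedDeg (n : ℕ) : Submodule ℚ S :=
  Submodule.span ℚ {t | ∃ i j, 0 < i ∧ 0 < j ∧ i + j = n ∧
    ∃ c ∈ primDeg prec i, ∃ u ∈ primDeg mul j, t = succ c u}

theorem mixedDeg_le_primDeg (n : ℕ) : mixedDeg n ≤ primDeg prec n := by
  refine Submodule.span_le.2 ?_
  rintro _ ⟨i, j, -, -, rfl, c, hc, u, hu, rfl⟩
  exact ⟨succ_mem_primOf_prec hc.1 hu.1, succ_mem hc.2 hu.2⟩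

theorem mixedDeg_le_prodDeg (n : ℕ) : mixedDeg n ≤ prodDeg succ n := by
  refine Submodule.span_le.2 ?_
  rintro _ ⟨i, j, hi, hj, rfl, c, hc, u, hu, rfl⟩
  exact apply_mem_prodDeg succ hi hj hc.2 hu.2

theorem eq_zero_of_mem_weightComponent_zero {x : S} (hx : x ∈ Splus)
    (h0 : x ∈ weightComponent 0) : x = 0 := by
  refine Finsupp.ext fun p => ?_
  by_contra h
  have h1 : 0 < p.1 := hx (Finsupp.mem_support_iff.2 h)
  have h2 : weight p = 0 := h0 (Finsupp.mem_support_iff.2 h)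
  exact (weight_pos.2 h1).ne' h2

theorem eq_zero_of_mem_primDeg {f : S →ₗ[ℚ] S →ₗ[ℚ] S} {n : ℕ} (hn : n = 0) {x : S}
    (hx : x ∈ primDeg f n) : x = 0 := by
  subst hn
  exact eq_zero_of_mem_weightComponent_zero hx.1.1 hx.2

/-- A basis of the elements of weight `n` of `primOf mul`. -/
noncomputable def mulBasis (n : ℕ) :
    Module.Basis (Fin (Module.finrank ℚ (primDeg mul n))) ℚ (primDeg mul n) :=
  Module.finBasis ℚ (primDeg mul n)

/-- The map `(c_s) ↦ ∑ c_s ≻ u_s`, where `u_s` runs over bases of the components of `primOf mul`. -/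
noncomputable def mixedExpansion (n : ℕ) :
    ((s : Σ i : Fin n, Fin (Module.finrank ℚ (primDeg mul (n - i)))) →
      primDeg prec (s.1 : ℕ)) →ₗ[ℚ] S :=
  LinearMap.lsum ℚ _ ℚ fun s =>
    (succ.flip (mulBasis (n - s.1) s.2 : S)).comp (Submodule.subtype _)

theorem mixedExpansion_apply (n : ℕ)
    (c : (s : Σ i : Fin n, Fin (Module.finrank ℚ (primDeg mul (n - i)))) →
      primDeg prec (s.1 : ℕ)) :
    mixedExpansion n c = ∑ s, succ (c s) (mulBasis (n - s.1) s.2 : S) := by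
  simp [mixedExpansion, LinearMap.lsum_apply, LinearMap.sum_apply]

/-- The element `∑ r a • u_a` of `primDeg mul k` is orthogonal to `primDeg prec k`, so it lies in
`prodDeg prec k`, a complement of `primDeg mul k`. -/
theorem mulBasis_coeff_eq_zero {k : ℕ} (hk : 0 < k)
    (r : Fin (Module.finrank ℚ (primDeg mul k)) → ℚ)
    (h : ∀ b ∈ primDeg prec k, ∑ a, form b (mulBasis k a : S) * r a = 0)
    (a : Fin (Module.finrank ℚ (primDeg mul k))) : r a = 0 := by
  refine Fintype.linearIndependent_iff.1 (mulBasis k).linearIndependent r ?_ a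
  refine Subtype.ext ((isGramPair_mul_prec.disjoint k).2 _ (Submodule.coe_mem _) ?_)
  refine mem_prodDeg_of_orthogonal prec_mem hk (Submodule.coe_mem
    (∑ a, r a • mulBasis k a)).2 fun b hb => ?_
  rw [form_comm, AddSubmonoidClass.coe_finsetSum, map_sum, ← h b hb]
  refine Finset.sum_congr rfl fun a _ => ?_
  rw [Submodule.coe_smul, map_smul, smul_eq_mul, mul_comm]

/-- Block triangularity, used by descending induction on the weight `m` of the components of `c`.
Pair with `b ≻ w`, where `w` has weight `m`: heavier components vanish by induction, lighter ones
are orthogonal to `w`. The remaining block is inverted by the two dualities between primitive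
elements for `*` and for `≺`. -/
theorem mixedExpansion_eq_zero {n : ℕ}
    (c : (s : Σ i : Fin n, Fin (Module.finrank ℚ (primDeg mul (n - i)))) →
      primDeg prec (s.1 : ℕ))
    (h : ∀ t ∈ mixedDeg n, form t (mixedExpansion n c) = 0) : c = 0 := by
  have key : ∀ d, ∀ s, n - (s.1 : ℕ) = d → c s = 0 := by
    intro d
    induction d using Nat.strong_induction_on with
    | _ d ih =>
    rintro ⟨m, a⟩ hd
    change n - (m : ℕ) = d at hd
    have hmn := m.2
    refine Subtype.ext ?_
    rcases Nat.eq_zero_or_pos (m : ℕ) with hm | hm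
    -- The index type includes weight `0`, where there is no nonzero primitive element.
    · exact eq_zero_of_mem_primDeg hm (c ⟨m, a⟩).2
    refine (isGramPair_mul_prec.disjoint m).1 _ (c ⟨m, a⟩).2 ?_
    refine mem_prodDeg_of_orthogonal mul_mem hm (c ⟨m, a⟩).2.2 fun w hw => ?_
    rw [form_comm]
    refine mulBasis_coeff_eq_zero (k := n - m) (by omega) (fun a => form w (c ⟨m, a⟩))
      (fun b hb => ?_) a
    have h1 := h (succ b w) (Submodule.subset_span
      ⟨n - m, m, by omega, hm, by omega, b, hb, w, hw, rfl⟩)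
    rw [mixedExpansion_apply, map_sum] at h1
    have h2 : ∀ s, form (succ b w) (succ (c s) (mulBasis (n - s.1) s.2 : S)) =
        form b (mulBasis (n - s.1) s.2 : S) * form w (c s) := by
      intro s
      rcases lt_or_ge (m : ℕ) (s.1 : ℕ) with hs | hs
      · rw [ih (n - s.1) (by omega) s rfl]; simp
      · rcases Nat.eq_zero_or_pos (s.1 : ℕ) with hs0 | hs0
        · rw [eq_zero_of_mem_primDeg hs0 (c s).2]
          simp
        · exact form_succ_succ hs0 hs hb.1.1 hw.2 (c s).2.2 (mulBasis (n - s.1) s.2).2.1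
    rw [Finset.sum_congr rfl fun s _ => h2 s, Fintype.sum_sigma,
      Finset.sum_eq_single m] at h1
    · exact h1
    · intro i _ hi
      refine Finset.sum_eq_zero fun a' _ => ?_
      rw [form_eq_zero_of_ne (fun h' => hi (Fin.ext h'.symm)) hw.2 (c ⟨i, a'⟩).2.2, mul_zero]
    · exact fun h' => absurd (Finset.mem_univ m) h'
  funext s
  exact key _ s rfl

theorem mixedExpansion_injective (n : ℕ) : Function.Injective (mixedExpansion n) := by
  refine (injective_iff_map_eq_zero _).2 fun c hc => mixedExpansion_eq_zero c fun t _ => ?_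
  rw [hc, map_zero]

theorem range_mixedExpansion (n : ℕ) : LinearMap.range (mixedExpansion n) = mixedDeg n := by
  classical
  refine le_antisymm ?_ (Submodule.span_le.2 ?_)
  · rintro _ ⟨c, rfl⟩
    rw [mixedExpansion_apply]
    refine Submodule.sum_mem _ fun s _ => ?_
    have hs := s.1.2
    rcases Nat.eq_zero_or_pos (s.1 : ℕ) with hs0 | hs0
    · rw [eq_zero_of_mem_primDeg hs0 (c s).2]
      simp
    · exact Submodule.subset_span ⟨s.1, n - s.1, hs0, by omega, by omega, _, (c s).2, _,
        (mulBasis (n - s.1) s.2).2, rfl⟩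
  · rintro _ ⟨i, j, hi, hj, hij, c, hc, u, hu, rfl⟩
    obtain rfl : n - i = j := by omega
    have hrepr := (mulBasis (n - i)).sum_repr ⟨u, hu⟩
    have hu' : u = ∑ a, (mulBasis (n - i)).repr ⟨u, hu⟩ a • (mulBasis (n - i) a : S) := by
      refine (congrArg Subtype.val hrepr).symm.trans ?_
      rw [AddSubmonoidClass.coe_finsetSum]
      rfl
    rw [hu', map_sum]
    refine Submodule.sum_mem _ fun a _ => ?_
    rw [map_smul]
    refine Submodule.smul_mem _ _ ⟨Pi.single
      (⟨⟨i, by omega⟩, a⟩ : Σ i : Fin n, Fin (Module.finrank ℚ (primDeg mul (n - i)))) ⟨c, hc⟩, ?_⟩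
    rw [mixedExpansion, LinearMap.lsum_piSingle]
    simp

theorem finrank_mixedDeg (n : ℕ) : Module.finrank ℚ (mixedDeg n) =
    ∑ i : Fin n, Module.finrank ℚ (primDeg mul (n - i)) * Module.finrank ℚ (primDeg prec i) := by
  rw [← range_mixedExpansion, LinearMap.finrank_range_of_inj (mixedExpansion_injective n),
    Module.finrank_pi_fintype, Fintype.sum_sigma]
  refine Finset.sum_congr rfl fun i _ => ?_
  change ∑ _a : Fin (Module.finrank ℚ (primDeg mul (n - i))), Module.finrank ℚ (primDeg prec i) = _
  rw [Finset.sum_const, Finset.card_univ, Fintype.card_fin, smul_eq_mul]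

theorem eq_zero_of_mem_mixedDeg {n : ℕ} {x : S} (hx : x ∈ mixedDeg n)
    (h : ∀ t ∈ mixedDeg n, form t x = 0) : x = 0 := by
  rw [← range_mixedExpansion] at hx
  obtain ⟨c, rfl⟩ := hx
  rw [mixedExpansion_eq_zero c h, map_zero]

/-! ### Dendriform primitive elements of a given weight -/

/-- The dendriform primitive elements of weight `n`, as elements of `S`. -/
noncomputable def dendDeg (n : ℕ) : Submodule ℚ S :=
  primOf prec ⊓ primOf succ ⊓ weightComponent n

/-- In `a ≻ b`, write `b` as a primitive element for `*` plus products `y ≺ z`, for which `a ≻ (y ≺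
z) = (a ≻ y) ≺ z`. Then write `a` as a primitive element for `≺` plus products `y * z`, for which
`(y * z) ≻ u = y ≻ (z ≻ u)` with `y` of smaller weight. -/
theorem prodDeg_succ_le (n : ℕ) : prodDeg succ n ≤ prodDeg prec n ⊔ mixedDeg n := by
  have key : ∀ i, ∀ j, 0 < i → 0 < j → i + j = n → ∀ a ∈ weightComponent i,
      ∀ b ∈ weightComponent j, succ a b ∈ prodDeg prec n ⊔ mixedDeg n := by
    intro i
    induction i using Nat.strong_induction_on with
    | _ i ih =>
    intro j hi hj hij a ha b hb
    rw [← isGramPair_mul_prec.symm.sup_eq hj] at hb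
    obtain ⟨u, hu, d, hd, rfl⟩ := Submodule.mem_sup.1 hb
    rw [map_add]
    refine add_mem ?_ ?_
    · rw [← isGramPair_mul_prec.sup_eq hi] at ha
      obtain ⟨c, hc, e, he, rfl⟩ := Submodule.mem_sup.1 ha
      rw [map_add, LinearMap.add_apply]
      refine add_mem (Submodule.mem_sup_right (Submodule.subset_span
        ⟨i, j, hi, hj, hij, c, hc, u, hu, rfl⟩)) ?_
      clear ha
      induction he using Submodule.span_induction with
      | zero => simp
      | add x y _ _ hx hy => rw [map_add, LinearMap.add_apply]; exact add_mem hx hy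
      | smul r x _ hx => rw [map_smul, LinearMap.smul_apply]; exact Submodule.smul_mem _ r hx
      | mem t ht =>
        obtain ⟨i', j', hi', hj', h', y, hy, z, hz, rfl⟩ := ht
        rw [succ_succ]
        exact ih i' (by omega) (j' + j) hi' (by omega) (by omega) y hy _ (succ_mem hz hu.2)
    · clear hb
      induction hd using Submodule.span_induction with
      | zero => simp
      | add x y _ _ hx hy => rw [map_add]; exact add_mem hx hy
      | smul r x _ hx => rw [map_smul]; exact Submodule.smul_mem _ r hx
      | mem t ht =>
        obtain ⟨i', j', hi', hj', h', y, hy, z, hz, rfl⟩ := ht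
        rw [← succ_prec]
        refine Submodule.mem_sup_left (Submodule.subset_span
          ⟨i + i', j', by omega, hj', by omega, _, succ_mem ha hy, z, hz, rfl⟩)
  refine Submodule.span_le.2 ?_
  rintro _ ⟨i, j, hi, hj, hij, y, hy, z, hz, rfl⟩
  exact key i j hi hj hij y hy z hz

theorem mem_dendDeg_of_orthogonal {n : ℕ} (hn : 0 < n) {x : S} (hx : x ∈ weightComponent n)
    (h1 : ∀ c ∈ prodDeg prec n, form c x = 0) (h2 : ∀ c ∈ mixedDeg n, form c x = 0) :
    x ∈ dendDeg n := by
  refine ⟨⟨(mem_primDeg_of_orthogonal prec_mem hn hx h1).1,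
    (mem_primDeg_of_orthogonal succ_mem hn hx fun c hc => ?_).1⟩, hx⟩
  obtain ⟨a, ha, b, hb, rfl⟩ := Submodule.mem_sup.1 (prodDeg_succ_le n hc)
  rw [map_add, LinearMap.add_apply, h1 a ha, h2 b hb, add_zero]

theorem dendDeg_le_primDeg (n : ℕ) : dendDeg n ≤ primDeg prec n :=
  fun _ hx => ⟨hx.1.1, hx.2⟩

theorem dendDeg_inf_mixedDeg (n : ℕ) : dendDeg n ⊓ mixedDeg n = ⊥ :=
  (Submodule.eq_bot_iff _).2 fun _ hx => eq_zero_of_mem_mixedDeg hx.2 fun _ ht =>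
    form_eq_zero_of_mem_prodDeg (mixedDeg_le_prodDeg n ht) hx.1.1.2

/-- An element `y` orthogonal to the three spaces is dendriform primitive, and, being orthogonal to
all such elements, it also equals `u + c` with `u` mixed and `c` a sum of products for `≺`. Since
`y` and `u` are primitive for `≺`, so is `c`, whence `c = 0`; nondegeneracy on `mixedDeg n` then
gives `u = 0`. -/
theorem weightComponent_le_dendDeg {n : ℕ} (hn : 0 < n) :
    weightComponent n ≤ dendDeg n ⊔ mixedDeg n ⊔ prodDeg prec n := by
  have hC := prodDeg_le (f := prec) prec_mem n
  have hU := (mixedDeg_le_primDeg n).trans (primDeg_le prec n)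
  intro x hx
  refine mem_of_orthogonal hx (fun y hy hc => ?_)
    (sup_le (sup_le ((dendDeg_le_primDeg n).trans (primDeg_le prec n)) hU) hC)
  have hyU : ∀ c ∈ mixedDeg n, form c y = 0 := fun c hc' =>
    hc c (Submodule.mem_sup_left (Submodule.mem_sup_right hc'))
  have hyV : y ∈ dendDeg n := mem_dendDeg_of_orthogonal hn hy
    (fun c hc' => hc c (Submodule.mem_sup_right hc')) hyU
  have hy' : y ∈ mixedDeg n ⊔ prodDeg prec n := by
    refine mem_of_orthogonal hy (fun z hz hz' => ?_) (sup_le hU hC)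
    rw [form_comm]
    exact hc z (Submodule.mem_sup_left (Submodule.mem_sup_left (mem_dendDeg_of_orthogonal hn hz
      (fun c hc' => hz' c (Submodule.mem_sup_right hc'))
      (fun c hc' => hz' c (Submodule.mem_sup_left hc')))))
  obtain ⟨u, hu, c, hc', rfl⟩ := Submodule.mem_sup.1 hy'
  have hcW : c ∈ primDeg prec n := by
    have := sub_mem (dendDeg_le_primDeg n hyV) (mixedDeg_le_primDeg n hu)
    rwa [add_sub_cancel_left] at this
  have hc0 : c = 0 := (isGramPair_prec_prec.disjoint n).1 c hcW hc'
  rw [hc0, add_zero] at hyU ⊢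
  rw [eq_zero_of_mem_mixedDeg hu hyU, map_zero]

theorem dendDeg_sup_mixedDeg {n : ℕ} (hn : 0 < n) : dendDeg n ⊔ mixedDeg n = primDeg prec n := by
  refine le_antisymm (sup_le (dendDeg_le_primDeg n) (mixedDeg_le_primDeg n)) fun x hx => ?_
  obtain ⟨y, hy, c, hc, rfl⟩ := Submodule.mem_sup.1 (weightComponent_le_dendDeg hn hx.2)
  have hcW : c ∈ primDeg prec n := by
    have := sub_mem hx (sup_le (dendDeg_le_primDeg n) (mixedDeg_le_primDeg n) hy)
    rwa [add_sub_cancel_left] at this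
  rw [(isGramPair_prec_prec.disjoint n).1 c hcW hc, add_zero]
  exact hy

instance finite_dendDeg (n : ℕ) : Module.Finite ℚ (dendDeg n) :=
  Submodule.finiteDimensional_of_le (dendDeg_le_primDeg n)

theorem finrank_dendDeg {n : ℕ} (hn : 0 < n) :
    Module.finrank ℚ (dendDeg n) + Module.finrank ℚ (mixedDeg n) =
      Module.finrank ℚ (primDeg prec n) := by
  have : Module.Finite ℚ (mixedDeg n) :=
    Submodule.finiteDimensional_of_le (mixedDeg_le_primDeg n)
  have h1 := Submodule.finrank_sup_add_finrank_inf_eq (dendDeg n) (mixedDeg n)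
  rw [dendDeg_sup_mixedDeg hn, dendDeg_inf_mixedDeg, finrank_bot, add_zero] at h1
  exact h1.symm

/-! ### Generating series -/

/-- The graded permutations of weight `n`. -/
noncomputable def ofWeight (n : ℕ) : Finset GradedPerm := (finite_weight_eq n).toFinset

theorem mem_ofWeight {n : ℕ} {p : GradedPerm} : p ∈ ofWeight n ↔ weight p = n := by
  simp [ofWeight]

theorem finrank_weightComponent (n : ℕ) :
    Module.finrank ℚ (weightComponent n) = (ofWeight n).card := by
  have : Fintype {p : GradedPerm | weight p = n} := (finite_weight_eq n).fintype
  rw [weightComponent,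
    (Finsupp.supportedEquivFinsupp {p : GradedPerm | weight p = n}).finrank_eq,
    Module.finrank_finsupp_self, ← Set.toFinset_card]
  congr 1
  ext p
  simp [mem_ofWeight]

theorem finrank_weightComponent_zero : Module.finrank ℚ (weightComponent 0) = 1 := by
  rw [finrank_weightComponent, Finset.card_eq_one]
  refine ⟨standardize [], Finset.ext fun p => ?_⟩
  rw [mem_ofWeight, Finset.mem_singleton]
  exact ⟨eq_nil_of_weight_eq_zero, fun h => by rw [h, weight_standardize_nil]⟩

theorem primDeg_zero (f : S →ₗ[ℚ] S →ₗ[ℚ] S) : primDeg f 0 = ⊥ :=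
  (Submodule.eq_bot_iff (primDeg f 0)).2 fun _ hx => eq_zero_of_mem_primDeg rfl hx

theorem finrank_primDeg_zero (f : S →ₗ[ℚ] S →ₗ[ℚ] S) :
    Module.finrank ℚ (primDeg f 0) = 0 := by
  rw [primDeg_zero, finrank_bot]

theorem sum_lowWeight {M : Type*} [AddCommMonoid M] (n : ℕ) (a : ℕ → M) :
    ∑ p ∈ lowWeight n, a (weight p) =
      ∑ k ∈ Finset.Ico 1 n, Module.finrank ℚ (weightComponent k) • a k := by
  rw [← Finset.sum_fiberwise_of_maps_to (s := lowWeight n) (t := Finset.Ico 1 n) (g := weight)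
    fun p hp => by rw [Finset.mem_Ico]; exact mem_lowWeight.1 hp]
  refine Finset.sum_congr rfl fun k hk => ?_
  rw [Finset.mem_Ico] at hk
  have : (lowWeight n).filter (fun p => weight p = k) = ofWeight k := by
    ext p
    rw [Finset.mem_filter, mem_lowWeight, mem_ofWeight]
    exact ⟨fun h => h.2, fun h => ⟨by omega, h⟩⟩
  rw [this, Finset.sum_congr rfl (g := fun _ => a k) fun p hp => by rw [mem_ofWeight.1 hp],
    Finset.sum_const, finrank_weightComponent]

/-- The generating series of `S`. -/
noncomputable def seriesS : PowerSeries ℚ :=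
  PowerSeries.mk fun n => (Module.finrank ℚ (weightComponent n) : ℚ)

/-- The generating series of `primOf prec`. -/
noncomputable def seriesPrim : PowerSeries ℚ :=
  PowerSeries.mk fun n => (Module.finrank ℚ (primDeg prec n) : ℚ)

/-- The generating series of the dendriform primitive elements. -/
noncomputable def seriesDend : PowerSeries ℚ :=
  PowerSeries.mk fun n => (Module.finrank ℚ (dendDeg n) : ℚ)

/-- For `n > 0`, the complement and the expansion give `R_n = Q_n + ∑ R_k Q_{n-k}` over `0 < k < n`.
The missing terms of the Cauchy product are `R_0 Q_n = Q_n` and `R_n Q_0 = 0`. -/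
theorem seriesS_eq : seriesS = 1 + seriesS * seriesPrim := by
  ext n
  rw [map_add, PowerSeries.coeff_mul, PowerSeries.coeff_one]
  simp only [seriesS, seriesPrim, PowerSeries.coeff_mk]
  rcases Nat.eq_zero_or_pos n with rfl | hn
  · simp [finrank_weightComponent_zero, finrank_primDeg_zero]
  · rw [if_neg hn.ne', zero_add, ← isGramPair_prec_prec.finrank_add hn,
      isGramPair_prec_prec.finrank_prodDeg, sum_lowWeight n fun k =>
        Module.finrank ℚ (primDeg prec (n - k)), Finset.Nat.sum_antidiagonal_eq_sum_range_succ
        (fun i j => (Module.finrank ℚ (weightComponent i) : ℚ) *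
          (Module.finrank ℚ (primDeg prec j) : ℚ)), Finset.sum_range_succ, Finset.range_eq_Ico,
      Finset.sum_eq_sum_Ico_succ_bot hn]
    simp [finrank_weightComponent_zero, primDeg_zero]

theorem finrank_dendDeg_zero : Module.finrank ℚ (dendDeg 0) = 0 := by
  have h := Submodule.finrank_mono (dendDeg_le_primDeg 0)
  rw [finrank_primDeg_zero] at h
  exact Nat.le_zero.1 h

/-- The mixed products account for `Q²`, because the primitive elements for `*` also have series
`Q`. -/
theorem seriesPrim_eq : seriesPrim = seriesDend + seriesPrim * seriesPrim := by
  ext n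
  rw [map_add, PowerSeries.coeff_mul]
  simp only [seriesDend, seriesPrim, PowerSeries.coeff_mk]
  rcases Nat.eq_zero_or_pos n with rfl | hn
  · simp [finrank_dendDeg_zero, finrank_primDeg_zero]
  · have h := (finrank_dendDeg hn).symm
    rw [finrank_mixedDeg] at h
    rw [Finset.Nat.sum_antidiagonal_eq_sum_range_succ
        (fun i j => (Module.finrank ℚ (primDeg prec i) : ℚ) *
          (Module.finrank ℚ (primDeg prec j) : ℚ)), Finset.sum_range_succ, Nat.sub_self,
      finrank_primDeg_zero, Finset.sum_range, h, Nat.cast_add, Nat.cast_sum, Nat.cast_zero,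
      mul_zero, add_zero]
    congr 1
    refine Finset.sum_congr rfl fun i _ => ?_
    have hi : 0 < n - (i : ℕ) := by omega
    rw [finrank_primDeg_mul hi, Nat.cast_mul, mul_comm]

theorem seriesDend_mul_sq : seriesDend * seriesS ^ 2 = seriesS - 1 := by
  have h1 := seriesS_eq
  have h2 := seriesPrim_eq
  have h3 : seriesDend = seriesPrim - seriesPrim * seriesPrim := by rw [eq_sub_iff_add_eq, ← h2]
  have h4 : seriesS * (1 - seriesPrim) = 1 := by rw [mul_sub, mul_one, sub_eq_iff_eq_add, ← h1]
  calc seriesDend * seriesS ^ 2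
      = (seriesS * seriesPrim) * (seriesS * (1 - seriesPrim)) := by rw [h3]; ring
    _ = seriesS - 1 := by rw [h4, mul_one, eq_sub_iff_add_eq, add_comm, ← h1]

theorem constantCoeff_seriesS : PowerSeries.constantCoeff seriesS = 1 := by
  rw [← PowerSeries.coeff_zero_eq_constantCoeff_apply, seriesS, PowerSeries.coeff_mk,
    finrank_weightComponent_zero, Nat.cast_one]

theorem seriesDend_eq : seriesDend = (seriesS - 1) * (seriesS ^ 2)⁻¹ := by
  rw [PowerSeries.eq_mul_inv_iff_mul_eq (by rw [map_pow, constantCoeff_seriesS]; norm_num)]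
  exact seriesDend_mul_sq

/-! ### The series `R` as a count of permutations and compositions -/

theorem finite_compositions (k n : ℕ) : {d : Fin k → ℕ+ | ∑ i, (d i : ℕ) = n}.Finite := by
  have h := (finite_weight_eq n).preimage (f := fun d : Fin k → ℕ+ => (⟨k, 1, d⟩ : GradedPerm))
    (fun a _ b _ hab => by simpa using hab)
  exact h

/-- The number of compositions of `n` into `k` positive parts. -/
noncomputable def compositions (k n : ℕ) : Finset (Fin k → ℕ+) := (finite_compositions k n).toFinset

theorem mem_compositions {k n : ℕ} {d : Fin k → ℕ+} :
    d ∈ compositions k n ↔ ∑ i, (d i : ℕ) = n := by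
  simp [compositions]

theorem card_ofWeight (n : ℕ) :
    (ofWeight n).card = ∑ k ∈ Finset.range (n + 1), k ! * (compositions k n).card := by
  have : ofWeight n = (Finset.range (n + 1)).sigma fun k =>
      (Finset.univ : Finset (Equiv.Perm (Fin k))) ×ˢ compositions k n := by
    ext p
    rw [mem_ofWeight, Finset.mem_sigma, Finset.mem_product, mem_compositions, Finset.mem_range]
    refine ⟨fun h => ⟨?_, Finset.mem_univ _, h⟩, fun h => h.2.2⟩
    have := le_weight p
    omega
  rw [this, Finset.card_sigma]
  refine Finset.sum_congr rfl fun k _ => ?_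
  rw [Finset.card_product, Finset.card_univ, Fintype.card_perm, Fintype.card_fin]

theorem coeff_pow_eq_card (k n : ℕ) :
    PowerSeries.coeff n ((PowerSeries.mk fun k => if 1 ≤ k then (1 : ℚ) else 0) ^ k) =
      (compositions k n).card := by
  have h := PowerSeries.coeff_prod
    (fun _ : Fin k => PowerSeries.mk fun k => if 1 ≤ k then (1 : ℚ) else 0) n Finset.univ
  rw [Finset.prod_const, Finset.card_univ, Fintype.card_fin] at h
  rw [h]
  simp only [PowerSeries.coeff_mk, Finset.prod_ite_zero, Finset.prod_const_one,
    Finset.mem_univ, true_implies]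
  rw [Finset.sum_boole, Nat.cast_inj]
  refine Finset.card_bij' (fun l hl i => ⟨l i, (Finset.mem_filter.1 hl).2 i⟩)
    (fun d _ => Finsupp.equivFunOnFinite.symm fun i => (d i : ℕ)) ?_ ?_ ?_ ?_
  · intro l hl
    have := (Finset.mem_filter.1 hl).1
    rw [Finset.mem_finsuppAntidiag] at this
    exact mem_compositions.2 this.1
  · intro d hd
    rw [mem_compositions] at hd
    rw [Finset.mem_filter, Finset.mem_finsuppAntidiag]
    exact ⟨⟨by simpa using hd, Finset.subset_univ _⟩, fun i => (d i).pos⟩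
  · intro l hl
    ext i
    simp
  · intro d hd
    funext i
    exact PNat.eq rfl

theorem seriesR_eq : seriesR = seriesS := by
  have hs : PowerSeries.HasSubst (PowerSeries.mk fun k => if 1 ≤ k then (1 : ℚ) else 0) :=
    PowerSeries.HasSubst.of_constantCoeff_zero' (by
      rw [← PowerSeries.coeff_zero_eq_constantCoeff_apply, PowerSeries.coeff_mk]; simp)
  ext n
  rw [seriesR, PowerSeries.coeff_subst' hs, seriesS, PowerSeries.coeff_mk,
    finrank_weightComponent, card_ofWeight,
    finsum_eq_sum_of_support_subset (s := Finset.range (n + 1))]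
  · push_cast
    refine Finset.sum_congr rfl fun k _ => ?_
    rw [coeff_pow_eq_card, PowerSeries.coeff_mk, smul_eq_mul]
  · intro k hk
    rw [Finset.coe_range, Set.mem_Iio]
    by_contra hkn
    refine hk ?_
    change _ • PowerSeries.coeff n _ = _
    rw [coeff_pow_eq_card, Finset.card_eq_zero.2, Nat.cast_zero, smul_zero]
    refine Finset.eq_empty_of_forall_notMem fun d hd => hkn ?_
    rw [mem_compositions] at hd
    have := le_weight ⟨k, 1, d⟩
    change k ≤ ∑ i, (d i : ℕ) at this
    omega

/-! ### The products `p ≻ (v ≺ q)` with `v` dendriform primitive -/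

/-- The span of the elements `p ≻ (v ≺ q)` of weight `n` with `p`, `q` graded permutations and
`v` a homogeneous dendriform primitive element. -/
noncomputable def sandwichDeg (n : ℕ) : Submodule ℚ S :=
  Submodule.span ℚ {t | ∃ p q j, weight p + (weight q + j) = n ∧ ∃ v ∈ dendDeg j,
    t = succ (Finsupp.single p 1) (prec v (Finsupp.single q 1))}

theorem succ_prec_mem_sandwichDeg {i j k n : ℕ} (h : i + (k + j) = n) {a b v : S}
    (ha : a ∈ weightComponent i) (hb : b ∈ weightComponent k) (hv : v ∈ dendDeg j) :
    succ a (prec v b) ∈ sandwichDeg n := by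
  rw [weightComponent_eq_span] at ha hb
  induction ha using Submodule.span_induction with
  | zero => simp
  | add x y _ _ hx hy => rw [map_add, LinearMap.add_apply]; exact add_mem hx hy
  | smul r x _ hx => rw [map_smul, LinearMap.smul_apply]; exact Submodule.smul_mem _ r hx
  | mem x hx =>
  obtain ⟨p, hp, rfl⟩ := hx
  induction hb using Submodule.span_induction with
  | zero => simp
  | add x y _ _ hx hy => rw [map_add, map_add]; exact add_mem hx hy
  | smul r x _ hx => rw [map_smul, map_smul]; exact Submodule.smul_mem _ r hx
  | mem x hx =>
  obtain ⟨q, hq, rfl⟩ := hx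
  change weight p = i at hp
  change weight q = k at hq
  exact Submodule.subset_span ⟨p, q, j, by omega, v, hv, rfl⟩

theorem succ_prec_mem_sandwichDeg_left {m n : ℕ} {x y : S} (hx : x ∈ weightComponent m)
    (hy : y ∈ sandwichDeg n) : succ x y ∈ sandwichDeg (m + n) := by
  induction hy using Submodule.span_induction with
  | zero => simp
  | add a b _ _ ha hb => rw [map_add]; exact add_mem ha hb
  | smul r a _ ha => rw [map_smul]; exact Submodule.smul_mem _ r ha
  | mem t ht =>
    obtain ⟨p, q, j, h, v, hv, rfl⟩ := ht
    rw [← succ_succ]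
    exact succ_prec_mem_sandwichDeg (by omega) (mul_mem hx (single_mem_weightComponent p))
      (single_mem_weightComponent q) hv

theorem prec_mem_sandwichDeg {m n : ℕ} {x y : S} (hx : x ∈ sandwichDeg m)
    (hy : y ∈ weightComponent n) : prec x y ∈ sandwichDeg (m + n) := by
  induction hx using Submodule.span_induction with
  | zero => simp
  | add a b _ _ ha hb => rw [map_add, LinearMap.add_apply]; exact add_mem ha hb
  | smul r a _ ha => rw [map_smul, LinearMap.smul_apply]; exact Submodule.smul_mem _ r ha
  | mem t ht =>
    obtain ⟨p, q, j, h, v, hv, rfl⟩ := ht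
    rw [succ_prec, prec_prec]
    exact succ_prec_mem_sandwichDeg (by omega) (single_mem_weightComponent p)
      (mul_mem (single_mem_weightComponent q) hy) hv

theorem dendDeg_le_Splus (n : ℕ) : dendDeg n ≤ Splus := fun _ hx => hx.1.1.1

theorem succ_one_prec_one {v : S} (hv : v ∈ Splus) : succ one (prec v one) = v := by
  rw [prec_one_right hv, succ_one_left hv]

/-- The elements `p ≻ (v ≺ q)` absorb a factor `≻` on the left into `p` and a factor `≺` on the
right into `q`. By induction on the weight they span all products. -/
theorem weightComponent_le_sandwichDeg {n : ℕ} (hn : 0 < n) :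
    weightComponent n ≤ sandwichDeg n := by
  induction n using Nat.strong_induction_on with
  | _ n ih =>
  refine (weightComponent_le_dendDeg hn).trans
    (sup_le (sup_le ?_ ((mixedDeg_le_prodDeg n).trans ?_)) ?_)
  · intro v hv
    rw [← succ_one_prec_one (dendDeg_le_Splus n hv)]
    exact succ_prec_mem_sandwichDeg (by omega) one_mem_weightComponent one_mem_weightComponent hv
  · refine Submodule.span_le.2 ?_
    rintro _ ⟨i, j, hi, hj, rfl, y, hy, z, hz, rfl⟩
    exact succ_prec_mem_sandwichDeg_left hy (ih j (by omega) hj hz)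
  · refine Submodule.span_le.2 ?_
    rintro _ ⟨i, j, hi, hj, rfl, y, hy, z, hz, rfl⟩
    exact prec_mem_sandwichDeg (ih i (by omega) hi hy) hz

theorem sandwichDeg_eq {n : ℕ} (hn : 0 < n) : sandwichDeg n = weightComponent n := by
  refine le_antisymm (Submodule.span_le.2 ?_) (weightComponent_le_sandwichDeg hn)
  rintro _ ⟨p, q, j, rfl, v, hv, rfl⟩
  rw [add_comm (weight q)]
  exact succ_mem (single_mem_weightComponent p) (prec_mem hv.2 (single_mem_weightComponent q))

/-- The indices of a basis of `sandwichDeg n`. -/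
abbrev SandwichIndex (n : ℕ) : Type :=
  Σ a : Finset.HasAntidiagonal.antidiagonal n, Σ b : Finset.HasAntidiagonal.antidiagonal a.1.2,
    ofWeight a.1.1 × ofWeight b.1.1 × Fin (Module.finrank ℚ (dendDeg b.1.2))

/-- A basis of the dendriform primitive elements of weight `n`. -/
noncomputable def dendBasis (n : ℕ) :
    Module.Basis (Fin (Module.finrank ℚ (dendDeg n))) ℚ (dendDeg n) :=
  Module.finBasis ℚ (dendDeg n)

/-- A basis of `sandwichDeg n`. -/
noncomputable def sandwich {n : ℕ} (t : SandwichIndex n) : S :=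
  succ (Finsupp.single t.2.2.1.1 1)
    (prec (dendBasis t.2.1.1.2 t.2.2.2.2 : S) (Finsupp.single t.2.2.2.1.1 1))

theorem span_range_sandwich (n : ℕ) :
    Submodule.span ℚ (Set.range (sandwich (n := n))) = sandwichDeg n := by
  refine le_antisymm (Submodule.span_le.2 ?_) (Submodule.span_le.2 ?_)
  · rintro _ ⟨⟨⟨⟨i, m⟩, h1⟩, ⟨⟨k, j⟩, h2⟩, ⟨p, hp⟩, ⟨q, hq⟩, t⟩, rfl⟩
    rw [Finset.HasAntidiagonal.mem_antidiagonal] at h1 h2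
    rw [mem_ofWeight] at hp hq
    dsimp only at h1 h2 hp hq t ⊢
    exact Submodule.subset_span ⟨p, q, j, by omega, _, (dendBasis j t).2, rfl⟩
  · rintro _ ⟨p, q, j, h, v, hv, rfl⟩
    have hv' := congrArg Subtype.val ((dendBasis j).sum_repr ⟨v, hv⟩)
    rw [AddSubmonoidClass.coe_finsetSum] at hv'
    change ∑ i, (dendBasis j).repr ⟨v, hv⟩ i • (dendBasis j i : S) = v at hv'
    rw [← hv', map_sum, LinearMap.sum_apply, map_sum]
    refine Submodule.sum_mem _ fun t _ => ?_
    rw [map_smul, LinearMap.smul_apply, map_smul]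
    refine Submodule.smul_mem _ _ (Submodule.subset_span ⟨⟨⟨⟨weight p, weight q + j⟩,
      Finset.HasAntidiagonal.mem_antidiagonal.2 h⟩, ⟨⟨weight q, j⟩, Finset.HasAntidiagonal.mem_antidiagonal.2 rfl⟩,
      ⟨p, mem_ofWeight.2 rfl⟩, ⟨q, mem_ofWeight.2 rfl⟩, t⟩, rfl⟩)

theorem card_sandwichIndex {n : ℕ} (hn : 0 < n) :
    Fintype.card (SandwichIndex n) = Module.finrank ℚ (weightComponent n) := by
  have h := congrArg (PowerSeries.coeff n) seriesDend_mul_sq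
  rw [mul_comm, sq, mul_assoc, map_sub, PowerSeries.coeff_one, if_neg hn.ne', sub_zero,
    PowerSeries.coeff_mul] at h
  simp only [PowerSeries.coeff_mul, seriesS, seriesDend, PowerSeries.coeff_mk] at h
  rw [← Nat.cast_inj (R := ℚ), ← h, Fintype.card_sigma, Nat.cast_sum,
    ← Finset.sum_coe_sort (Finset.HasAntidiagonal.antidiagonal n)]
  refine Finset.sum_congr rfl fun a _ => ?_
  rw [Fintype.card_sigma, Nat.cast_sum, Finset.mul_sum,
    ← Finset.sum_coe_sort (Finset.HasAntidiagonal.antidiagonal a.1.2)]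
  refine Finset.sum_congr rfl fun b _ => ?_
  rw [Fintype.card_prod, Fintype.card_prod, Fintype.card_coe, Fintype.card_coe, Fintype.card_fin,
    finrank_weightComponent, finrank_weightComponent, Nat.cast_mul, Nat.cast_mul]

/-- A spanning family of the right cardinality: the count is the coefficient of `x^n` in `R · R · P
= R - 1`. -/
theorem linearIndependent_sandwich {n : ℕ} (hn : 0 < n) :
    LinearIndependent ℚ (sandwich (n := n)) := by
  rw [linearIndependent_iff_card_eq_finrank_span, Set.finrank, span_range_sandwich,
    sandwichDeg_eq hn, card_sandwichIndex hn]

/-! ### Linear maps given on the products `p ≻ (v ≺ q)` -/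

theorem exists_linearMap_of_pos {D : Type*} [AddCommGroup D] [Module ℚ D] {n : ℕ} (hn : 0 < n)
    (g : GradedPerm → GradedPerm → S →ₗ[ℚ] D) :
    ∃ h : S →ₗ[ℚ] D, ∀ p q j, weight p + (weight q + j) = n → ∀ v ∈ dendDeg j,
      h (succ (Finsupp.single p 1) (prec v (Finsupp.single q 1))) = g p q v := by
  obtain ⟨h, hh⟩ := LinearMap.exists_extend
    ((Module.Basis.span (linearIndependent_sandwich hn)).constr ℚ fun t =>
      g t.2.2.1.1 t.2.2.2.1.1 (dendBasis t.2.1.1.2 t.2.2.2.2 : S))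
  have hb : ∀ t : SandwichIndex n,
      h (sandwich t) = g t.2.2.1.1 t.2.2.2.1.1 (dendBasis t.2.1.1.2 t.2.2.2.2 : S) := by
    intro t
    have := LinearMap.congr_fun hh (Module.Basis.span (linearIndependent_sandwich hn) t)
    rw [Module.Basis.constr_basis] at this
    rw [← this, LinearMap.comp_apply, Submodule.subtype_apply, Module.Basis.span_apply]
  refine ⟨h, fun p q j hj v hv => ?_⟩
  have : h ∘ₗ succ (Finsupp.single p 1) ∘ₗ prec.flip (Finsupp.single q 1) ∘ₗ (dendDeg j).subtype =
      g p q ∘ₗ (dendDeg j).subtype :=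
    (dendBasis j).ext fun t => hb ⟨⟨⟨weight p, weight q + j⟩,
      Finset.HasAntidiagonal.mem_antidiagonal.2 hj⟩, ⟨⟨weight q, j⟩, Finset.HasAntidiagonal.mem_antidiagonal.2 rfl⟩,
      ⟨p, mem_ofWeight.2 rfl⟩, ⟨q, mem_ofWeight.2 rfl⟩, t⟩
  exact LinearMap.congr_fun this ⟨v, hv⟩

theorem exists_linearMap {D : Type*} [AddCommGroup D] [Module ℚ D]
    (g : GradedPerm → GradedPerm → S →ₗ[ℚ] D) :
    ∃ h : S →ₗ[ℚ] D, h one = 0 ∧ ∀ p q j, ∀ v ∈ dendDeg j,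
      h (succ (Finsupp.single p 1) (prec v (Finsupp.single q 1))) = g p q v := by
  choose h hh using fun n (hn : 0 < n) => exists_linearMap_of_pos hn g
  set H : S →ₗ[ℚ] D := Finsupp.linearCombination ℚ fun p =>
    if hp : 0 < weight p then h (weight p) hp (Finsupp.single p 1) else 0 with hH
  have key : ∀ n (hn : 0 < n), ∀ x ∈ weightComponent n, H x = h n hn x := by
    intro n hn x hx
    rw [weightComponent_eq_span] at hx
    induction hx using Submodule.span_induction with
    | zero => simp
    | add x y _ _ hx hy => rw [map_add, map_add, hx, hy]
    | smul r x _ hx => rw [map_smul, map_smul, hx]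
    | mem x hx =>
      obtain ⟨p, rfl, rfl⟩ := hx
      rw [hH, Finsupp.linearCombination_single, one_smul, dif_pos hn]
  refine ⟨H, ?_, fun p q j v hv => ?_⟩
  · rw [one_eq_single, hH, Finsupp.linearCombination_single, one_smul, dif_neg]
    rw [weight_standardize_nil]
    exact lt_irrefl 0
  · rcases Nat.eq_zero_or_pos j with rfl | hj
    · rw [eq_zero_of_mem_primDeg rfl (dendDeg_le_primDeg 0 hv)]
      simp
    · rw [key (weight p + (weight q + j)) (by omega), hh _ _ p q j rfl v hv]
      rw [add_comm (weight q)]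
      exact succ_mem (single_mem_weightComponent p)
        (prec_mem hv.2 (single_mem_weightComponent q))

/-! ### The universal property -/

theorem sandwich_mem_weightComponent {p q : GradedPerm} {j n : ℕ}
    (h : weight p + (weight q + j) = n) {v : S} (hv : v ∈ dendDeg j) :
    succ (Finsupp.single p 1) (prec v (Finsupp.single q 1)) ∈ weightComponent n := by
  rw [← h, add_comm (weight q)]
  exact succ_mem (single_mem_weightComponent p) (prec_mem hv.2 (single_mem_weightComponent q))

theorem weightComponent_induction {n : ℕ} (hn : 0 < n)
    {motive : (x : S) → x ∈ weightComponent n → Prop} (zero : motive 0 (zero_mem _))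
    (add : ∀ x hx y hy, motive x hx → motive y hy → motive (x + y) (add_mem hx hy))
    (smul : ∀ (c : ℚ) x hx, motive x hx → motive (c • x) (Submodule.smul_mem _ c hx))
    (sandwich : ∀ p q j (_ : 0 < j) (h : weight p + (weight q + j) = n) v (hv : v ∈ dendDeg j),
      motive (succ (Finsupp.single p 1) (prec v (Finsupp.single q 1)))
        (sandwich_mem_weightComponent h hv))
    {x : S} (hx : x ∈ weightComponent n) : motive x hx := by
  have hx' := weightComponent_le_sandwichDeg hn hx
  refine Submodule.span_induction (p := fun x hx => ∀ h, motive x h) ?_ (fun _ => zero)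
    (fun x y hx hy h h' _ => add x _ y _ (h (sandwichDeg_eq hn ▸ hx)) (h' (sandwichDeg_eq hn ▸ hy)))
    (fun c x hx h _ => smul c x _ (h (sandwichDeg_eq hn ▸ hx))) hx' hx
  rintro _ ⟨p, q, j, h, v, hv, rfl⟩ h'
  -- No nonzero dendriform primitive element has weight `0`. Restricting to `j > 0` makes `p` and
  -- `q` lighter than `n`, which drives the later recursions.
  rcases Nat.eq_zero_or_pos j with rfl | hj
  · have : v = 0 := eq_zero_of_mem_primDeg rfl (dendDeg_le_primDeg 0 hv)
    subst this
    revert h'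
    rw [map_zero, LinearMap.zero_apply, map_zero]
    exact fun _ => zero
  · exact sandwich p q j hj h v hv

section Extension

variable {D : Type*} [AddCommGroup D] [Module ℚ D] {precD succD : D →ₗ[ℚ] D →ₗ[ℚ] D}

/-- The coefficient of the unit. -/
noncomputable def counit : S →ₗ[ℚ] ℚ := form one

theorem counit_one : counit one = 1 := form_one_one

theorem counit_of_mem {x : S} (hx : x ∈ Splus) : counit x = 0 := form_one_of_mem_Splus hx

variable (succD) in
/-- The left multiplication `d ↦ F z ≻ d`, where `1 ≻ d = d`. -/
noncomputable def leftMul (F : S →ₗ[ℚ] D) : S →ₗ[ℚ] D →ₗ[ℚ] D :=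
  counit.smulRight LinearMap.id + succD ∘ₗ F

variable (precD) in
/-- The right multiplication `d ↦ d ≺ F z`, where `d ≺ 1 = d`. -/
noncomputable def rightMul (F : S →ₗ[ℚ] D) : S →ₗ[ℚ] D →ₗ[ℚ] D :=
  counit.smulRight LinearMap.id + precD.flip ∘ₗ F

theorem leftMul_apply (F : S →ₗ[ℚ] D) (z : S) (d : D) :
    leftMul succD F z d = counit z • d + succD (F z) d := rfl

theorem rightMul_apply (F : S →ₗ[ℚ] D) (z : S) (d : D) :
    rightMul precD F z d = counit z • d + precD d (F z) := rfl

theorem leftMul_one {F : S →ₗ[ℚ] D} (hF : F one = 0) (d : D) : leftMul succD F one d = d := by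
  rw [leftMul_apply, counit_one, hF]; simp

theorem rightMul_one {F : S →ₗ[ℚ] D} (hF : F one = 0) (d : D) : rightMul precD F one d = d := by
  rw [rightMul_apply, counit_one, hF]; simp

theorem leftMul_of_mem (F : S →ₗ[ℚ] D) {z : S} (hz : z ∈ Splus) (d : D) :
    leftMul succD F z d = succD (F z) d := by
  rw [leftMul_apply, counit_of_mem hz, zero_smul, zero_add]

theorem rightMul_of_mem (F : S →ₗ[ℚ] D) {z : S} (hz : z ∈ Splus) (d : D) :
    rightMul precD F z d = precD d (F z) := by
  rw [rightMul_apply, counit_of_mem hz, zero_smul, zero_add]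

theorem rightMul_leftMul (hD : IsDendriform precD succD) (F : S →ₗ[ℚ] D) (y z : S) (d : D) :
    rightMul precD F y (leftMul succD F z d) = leftMul succD F z (rightMul precD F y d) := by
  rw [leftMul_apply, rightMul_apply, leftMul_apply, rightMul_apply, map_add precD,
    LinearMap.add_apply, map_add (succD (F z)), map_smul precD, LinearMap.smul_apply,
    map_smul (succD (F z)), hD.succ_prec, smul_add, smul_add, smul_comm (counit y) (counit z)]
  abel

/-- The value `p ≻ (f v ≺ q)` on a product `p ≻ (v ≺ q)` of an extension of `f`. -/
noncomputable def sandwichValue (precD succD : D →ₗ[ℚ] D →ₗ[ℚ] D) (f F : S →ₗ[ℚ] D) (x y : S) :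
    S →ₗ[ℚ] D :=
  leftMul succD F x ∘ₗ rightMul precD F y ∘ₗ f

/-- One step of the recursive construction of an extension of `f`. -/
noncomputable def extensionStep (precD succD : D →ₗ[ℚ] D →ₗ[ℚ] D) (f F : S →ₗ[ℚ] D) : S →ₗ[ℚ] D :=
  (exists_linearMap fun p q =>
    sandwichValue precD succD f F (Finsupp.single p 1) (Finsupp.single q 1)).choose

theorem extensionStep_one (f F : S →ₗ[ℚ] D) : extensionStep precD succD f F one = 0 :=
  (exists_linearMap _).choose_spec.1

theorem extensionStep_sandwich (f F : S →ₗ[ℚ] D) (p q : GradedPerm) {j : ℕ} {v : S}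
    (hv : v ∈ dendDeg j) :
    extensionStep precD succD f F (succ (Finsupp.single p 1) (prec v (Finsupp.single q 1))) =
      sandwichValue precD succD f F (Finsupp.single p 1) (Finsupp.single q 1) v :=
  (exists_linearMap _).choose_spec.2 p q j v hv

/-- The successive approximations of an extension of `f`. -/
noncomputable def extensionSeq (precD succD : D →ₗ[ℚ] D →ₗ[ℚ] D) (f : S →ₗ[ℚ] D) :
    ℕ → S →ₗ[ℚ] D
  | 0 => 0
  | k + 1 => extensionStep precD succD f (extensionSeq precD succD f k)

theorem extensionSeq_one (f : S →ₗ[ℚ] D) (k : ℕ) : extensionSeq precD succD f k one = 0 := by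
  cases k with
  | zero => rfl
  | succ k => exact extensionStep_one _ _

theorem mem_weightComponent_zero {x : S} (hx : x ∈ weightComponent 0) : ∃ c : ℚ, x = c • one := by
  rw [weightComponent_eq_span] at hx
  induction hx using Submodule.span_induction with
  | zero => exact ⟨0, by simp⟩
  | add x y _ _ hx hy =>
    obtain ⟨c, rfl⟩ := hx
    obtain ⟨d, rfl⟩ := hy
    exact ⟨c + d, (add_smul c d one).symm⟩
  | smul r x _ hx =>
    obtain ⟨c, rfl⟩ := hx
    exact ⟨r * c, smul_smul r c one⟩
  | mem x hx =>
    obtain ⟨p, hp, rfl⟩ := hx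
    refine ⟨1, ?_⟩
    rw [one_smul, one_eq_single, eq_nil_of_weight_eq_zero hp]

theorem sandwichValue_congr {f F G : S →ₗ[ℚ] D} {x y : S} (hx : F x = G x) (hy : F y = G y) :
    sandwichValue precD succD f F x y = sandwichValue precD succD f G x y := by
  ext v
  simp only [sandwichValue, LinearMap.comp_apply, leftMul_apply, rightMul_apply, hx, hy]

/-- The value at `p ≻ (v ≺ q)` uses the previous approximation at `p` and `q` only, which are
lighter. The sequence is thus stationary in weight `n` from index `n + 1` on. -/
theorem extensionSeq_eq (f : S →ₗ[ℚ] D) {n k m : ℕ} (hk : n < k) (hm : n < m) {x : S}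
    (hx : x ∈ weightComponent n) :
    extensionSeq precD succD f k x = extensionSeq precD succD f m x := by
  induction n using Nat.strong_induction_on generalizing k m x with
  | _ n ih =>
  rcases Nat.eq_zero_or_pos n with rfl | hn
  · obtain ⟨c, rfl⟩ := mem_weightComponent_zero hx
    rw [map_smul, map_smul, extensionSeq_one, extensionSeq_one]
  obtain ⟨k, rfl⟩ := Nat.exists_eq_add_of_lt hk
  obtain ⟨m, rfl⟩ := Nat.exists_eq_add_of_lt hm
  induction hx using weightComponent_induction hn with
  | zero => simp
  | add x _ y _ hx hy => rw [map_add, map_add, hx, hy]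
  | smul c x _ hx => rw [map_smul, map_smul, hx]
  | sandwich p q j hj h v hv =>
    change extensionStep _ _ _ _ _ = extensionStep _ _ _ _ _
    rw [extensionStep_sandwich _ _ _ _ hv, extensionStep_sandwich _ _ _ _ hv, sandwichValue_congr
      (ih (weight p) (by omega) (by omega : _ < n + k) (by omega : _ < n + m)
        (single_mem_weightComponent p))
      (ih (weight q) (by omega) (by omega : _ < n + k) (by omega : _ < n + m)
        (single_mem_weightComponent q))]

/-- The extension of `f` to a linear map which is compatible with the products
`p ≻ (v ≺ q)`. -/
noncomputable def extension (precD succD : D →ₗ[ℚ] D →ₗ[ℚ] D) (f : S →ₗ[ℚ] D) : S →ₗ[ℚ] D :=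
  Finsupp.linearCombination ℚ fun p =>
    extensionSeq precD succD f (weight p + 1) (Finsupp.single p 1)

theorem extension_eq (f : S →ₗ[ℚ] D) {n k : ℕ} (hk : n < k) {x : S}
    (hx : x ∈ weightComponent n) : extension precD succD f x = extensionSeq precD succD f k x := by
  rw [weightComponent_eq_span] at hx
  induction hx using Submodule.span_induction with
  | zero => simp
  | add x y _ _ hx hy => rw [map_add, map_add, hx, hy]
  | smul r x _ hx => rw [map_smul, map_smul, hx]
  | mem x hx =>
    obtain ⟨p, rfl, rfl⟩ := hx
    rw [extension, Finsupp.linearCombination_single, one_smul]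
    exact extensionSeq_eq f (Nat.lt_succ_self _) hk (single_mem_weightComponent p)

theorem extension_one (f : S →ₗ[ℚ] D) : extension precD succD f one = 0 := by
  rw [extension_eq f Nat.zero_lt_one one_mem_weightComponent, extensionSeq_one]

theorem extension_sandwich_single (f : S →ₗ[ℚ] D) (p q : GradedPerm) {j : ℕ} {v : S}
    (hv : v ∈ dendDeg j) :
    extension precD succD f (succ (Finsupp.single p 1) (prec v (Finsupp.single q 1))) =
      sandwichValue precD succD f (extension precD succD f) (Finsupp.single p 1)
        (Finsupp.single q 1) v := by
  rcases Nat.eq_zero_or_pos j with rfl | hj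
  · rw [eq_zero_of_mem_primDeg rfl (dendDeg_le_primDeg 0 hv)]
    simp
  have h := succ_mem (single_mem_weightComponent p)
    (prec_mem hv.2 (single_mem_weightComponent q))
  rw [extension_eq f (Nat.lt_succ_self _) h]
  change extensionStep _ _ _ _ _ = _
  rw [extensionStep_sandwich _ _ _ _ hv, sandwichValue_congr
    (extension_eq f (by omega) (single_mem_weightComponent p)).symm
    (extension_eq f (by omega) (single_mem_weightComponent q)).symm]

theorem extension_sandwich (f : S →ₗ[ℚ] D) (x y : S) {j : ℕ} {v : S} (hv : v ∈ dendDeg j) :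
    extension precD succD f (succ x (prec v y)) =
      leftMul succD (extension precD succD f) x
        (rightMul precD (extension precD succD f) y (f v)) := by
  induction x using S_induction with
  | hadd x x' hx hx' => simp only [map_add, LinearMap.add_apply, hx, hx']
  | hsmul c x hx => simp only [map_smul, LinearMap.smul_apply, hx]
  | hsingle p =>
  induction y using S_induction with
  | hadd x x' hx hx' => simp only [map_add, LinearMap.add_apply, hx, hx']
  | hsmul c x hx => simp only [map_smul, LinearMap.smul_apply, hx]
  | hsingle q => exact extension_sandwich_single f p q hv

theorem extension_of_mem_dendDeg (f : S →ₗ[ℚ] D) {j : ℕ} {v : S} (hv : v ∈ dendDeg j) :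
    extension precD succD f v = f v := by
  have h := extension_sandwich (precD := precD) (succD := succD) f one one hv
  rwa [succ_one_prec_one (dendDeg_le_Splus j hv), leftMul_one (extension_one f),
    rightMul_one (extension_one f)] at h

/-- Compatibility of a linear map with the products of elements of weights `m` and `k`. -/
def CompatibleAt (precD succD : D →ₗ[ℚ] D →ₗ[ℚ] D) (F : S →ₗ[ℚ] D) (m k : ℕ) : Prop :=
  ∀ x ∈ weightComponent m, ∀ y ∈ weightComponent k,
    (0 < m → F (prec x y) = rightMul precD F y (F x)) ∧
    (0 < k → F (succ x y) = leftMul succD F x (F y))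

theorem leftMul_mul (hD : IsDendriform precD succD) {F : S →ₗ[ℚ] D} (hF : F one = 0) {m k : ℕ}
    (h : CompatibleAt precD succD F m k) {x y : S} (hx : x ∈ weightComponent m)
    (hy : y ∈ weightComponent k) (d : D) :
    leftMul succD F (mul x y) d = leftMul succD F x (leftMul succD F y d) := by
  rcases Nat.eq_zero_or_pos m with rfl | hm
  · obtain ⟨c, rfl⟩ := mem_weightComponent_zero hx
    simp only [map_smul, LinearMap.smul_apply, one_mul', leftMul_one hF]
  rcases Nat.eq_zero_or_pos k with rfl | hk
  · obtain ⟨c, rfl⟩ := mem_weightComponent_zero hy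
    simp only [map_smul, LinearMap.smul_apply, mul_one', leftMul_one hF]
  have hx' := weightComponent_le_Splus hm hx
  have hy' := weightComponent_le_Splus hk hy
  rw [leftMul_of_mem F hx', leftMul_of_mem F hy', leftMul_of_mem F
    (weightComponent_le_Splus (by omega) (mul_mem hx hy)), mul_eq_left hx', map_add,
    (h x hx y hy).1 hm, (h x hx y hy).2 hk, rightMul_of_mem F hy', leftMul_of_mem F hx',
    hD.succ_succ]

theorem rightMul_mul (hD : IsDendriform precD succD) {F : S →ₗ[ℚ] D} (hF : F one = 0) {m k : ℕ}
    (h : CompatibleAt precD succD F m k) {x y : S} (hx : x ∈ weightComponent m)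
    (hy : y ∈ weightComponent k) (d : D) :
    rightMul precD F (mul x y) d = rightMul precD F y (rightMul precD F x d) := by
  rcases Nat.eq_zero_or_pos m with rfl | hm
  · obtain ⟨c, rfl⟩ := mem_weightComponent_zero hx
    simp only [map_smul, LinearMap.smul_apply, one_mul', rightMul_one hF]
  rcases Nat.eq_zero_or_pos k with rfl | hk
  · obtain ⟨c, rfl⟩ := mem_weightComponent_zero hy
    simp only [map_smul, LinearMap.smul_apply, mul_one', rightMul_one hF]
  have hx' := weightComponent_le_Splus hm hx
  have hy' := weightComponent_le_Splus hk hy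
  rw [rightMul_of_mem F hx', rightMul_of_mem F hy', rightMul_of_mem F
    (weightComponent_le_Splus (by omega) (mul_mem hx hy)), mul_eq_left hx', map_add,
    (h x hx y hy).1 hm, (h x hx y hy).2 hk, rightMul_of_mem F hy', leftMul_of_mem F hx',
    hD.prec_prec]

/-- For `x = p ≻ (v ≺ q)` one has `x ≺ y = p ≻ (v ≺ (q * y))`, and compatibility for `q` and `y`, of
smaller total weight, identifies the action of `F (q * y)`. The case of `≻` is symmetric, with `x *
p`. -/
theorem extension_compatibleAt (hD : IsDendriform precD succD) (f : S →ₗ[ℚ] D) (m k : ℕ) :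
    CompatibleAt precD succD (extension precD succD f) m k := by
  have h1 : extension precD succD f one = 0 := extension_one f
  induction hn : m + k using Nat.strong_induction_on generalizing m k with
  | _ n ih =>
  subst hn
  refine fun x hx y hy => ⟨fun hm => ?_, fun hk => ?_⟩
  · induction hx using weightComponent_induction hm with
    | zero => simp
    | add x _ y _ hx hy => simp only [map_add, LinearMap.add_apply, hx, hy]
    | smul c x _ hx => simp only [map_smul, LinearMap.smul_apply, hx]
    | sandwich p q j hj h v hv =>
      have hq := single_mem_weightComponent q
      rw [extension_sandwich f _ _ hv, succ_prec, prec_prec, extension_sandwich f _ _ hv,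
        rightMul_mul hD h1 (ih _ (by omega) _ _ rfl) hq hy, rightMul_leftMul hD]
  · induction hy using weightComponent_induction hk with
    | zero => simp
    | add x _ y _ hx hy => simp only [map_add, hx, hy]
    | smul c x _ hx => simp only [map_smul, hx]
    | sandwich p q j hj h v hv =>
      have hp := single_mem_weightComponent p
      rw [extension_sandwich f _ _ hv, ← succ_succ, extension_sandwich f _ _ hv,
        leftMul_mul hD h1 (ih _ (by omega) _ _ rfl) hx hp]

theorem extension_prec (hD : IsDendriform precD succD) (f : S →ₗ[ℚ] D) {x y : S}
    (hx : x ∈ Splus) (hy : y ∈ Splus) : extension precD succD f (prec x y) =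
      precD (extension precD succD f x) (extension precD succD f y) := by
  induction hx using Splus_induction with
  | hzero => simp
  | hadd x x' _ _ hx hx' => simp only [map_add, LinearMap.add_apply, hx, hx']
  | hsmul c x _ hx => simp only [map_smul, LinearMap.smul_apply, hx]
  | hsingle p hp =>
  induction hy using Splus_induction with
  | hzero => simp
  | hadd x x' _ _ hx hx' => simp only [map_add, hx, hx']
  | hsmul c x _ hx => simp only [map_smul, hx]
  | hsingle q hq =>
  rw [((extension_compatibleAt hD f _ _) _ (single_mem_weightComponent p) _
    (single_mem_weightComponent q)).1 (weight_pos.2 hp), rightMul_of_mem _ (single_mem_Splus hq)]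

theorem extension_succ (hD : IsDendriform precD succD) (f : S →ₗ[ℚ] D) {x y : S}
    (hx : x ∈ Splus) (hy : y ∈ Splus) : extension precD succD f (succ x y) =
      succD (extension precD succD f x) (extension precD succD f y) := by
  induction hx using Splus_induction with
  | hzero => simp
  | hadd x x' _ _ hx hx' => simp only [map_add, LinearMap.add_apply, hx, hx']
  | hsmul c x _ hx => simp only [map_smul, LinearMap.smul_apply, hx]
  | hsingle p hp =>
  induction hy using Splus_induction with
  | hzero => simp
  | hadd x x' _ _ hx hx' => simp only [map_add, hx, hx']
  | hsmul c x _ hx => simp only [map_smul, hx]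
  | hsingle q hq =>
  rw [((extension_compatibleAt hD f _ _) _ (single_mem_weightComponent p) _
    (single_mem_weightComponent q)).2 (weight_pos.2 hq), leftMul_of_mem _ (single_mem_Splus hp)]

end Extension

/-! ### The grading of the dendriform primitive elements -/

/-- The homogeneous component of weight `n` of an element. -/
noncomputable def component (n : ℕ) (x : S) : S := Finsupp.filter (fun p => weight p = n) x

theorem component_mem (n : ℕ) (x : S) : component n x ∈ weightComponent n := by
  intro p hp
  rw [Finset.mem_coe, component, Finsupp.support_filter, Finset.mem_filter] at hp
  exact hp.2

theorem form_component {n : ℕ} {y : S} (hy : y ∈ weightComponent n) (x : S) :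
    form y (component n x) = form y x := by
  rw [weightComponent_eq_span] at hy
  induction hy using Submodule.span_induction with
  | zero => simp
  | add a b _ _ ha hb => rw [map_add, LinearMap.add_apply, LinearMap.add_apply, ha, hb]
  | smul r a _ ha => rw [map_smul, LinearMap.smul_apply, LinearMap.smul_apply, ha]
  | mem t ht =>
    obtain ⟨p, rfl, rfl⟩ := ht
    rw [form_comm, form_single_right, form_comm, form_single_right, component,
      Finsupp.filter_apply_pos (fun q => weight q = weight p) x (weight_inv p)]

theorem component_mem_primDeg {f : S →ₗ[ℚ] S →ₗ[ℚ] S} (hf : Homogeneous f) {x : S}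
    (hx : x ∈ primOf f) {n : ℕ} (hn : 0 < n) : component n x ∈ primDeg f n :=
  mem_primDeg_of_orthogonal hf hn (component_mem n x) fun c hc => by
    rw [form_component (prodDeg_le hf n hc), form_eq_zero_of_mem_prodDeg hc hx]

theorem component_mem_dendDeg {x : S} (hx : x ∈ primOf prec ⊓ primOf succ) {n : ℕ} (hn : 0 < n) :
    component n x ∈ dendDeg n :=
  ⟨⟨(component_mem_primDeg prec_mem hx.1 hn).1, (component_mem_primDeg succ_mem hx.2 hn).1⟩,
    component_mem n x⟩

theorem sum_component (x : S) : ∑ n ∈ x.support.image weight, component n x = x := by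
  ext p
  rw [Finsupp.finsetSum_apply]
  simp only [component, Finsupp.filter_apply]
  rw [Finset.sum_ite_eq]
  split_ifs with h
  · rfl
  · by_contra h'
    exact h (Finset.mem_image_of_mem _ (Finsupp.mem_support_iff.2 (Ne.symm h')))

theorem mem_primComponent {n : ℕ} {x : Splus} : x ∈ primComponent n ↔ (x : S) ∈ dendDeg n := by
  rw [primComponent, Submodule.mem_inf, mem_primDend]
  rfl

theorem pos_of_mem_support {x : S} (hx : x ∈ Splus) {n : ℕ} (hn : n ∈ x.support.image weight) :
    0 < n := by
  obtain ⟨p, hp, rfl⟩ := Finset.mem_image.1 hn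
  exact weight_pos.2 (hx hp)

/-- Primitivity is orthogonality to homogeneous products, and the form respects weights, so the
weight components of a primitive element are primitive. -/
theorem iSup_primComponent : (⨆ n, primComponent n) = primDend := by
  refine le_antisymm (iSup_le fun n => inf_le_left) fun x hx => ?_
  have hx' := mem_primDend.1 hx
  have hmem : ∀ n : {n // n ∈ (x : S).support.image weight}, component n (x : S) ∈ dendDeg n :=
    fun n => component_mem_dendDeg hx' (pos_of_mem_support x.2 n.2)
  have hsum : x = ∑ n : {n // n ∈ (x : S).support.image weight},
      (⟨component n (x : S), dendDeg_le_Splus _ (hmem n)⟩ : Splus) := by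
    refine Subtype.ext ?_
    rw [AddSubmonoidClass.coe_finsetSum, Finset.sum_coe_sort _ fun n => component n (x : S),
      sum_component]
  rw [hsum]
  exact Submodule.sum_mem _ fun n _ =>
    Submodule.mem_iSup_of_mem (n : ℕ) (mem_primComponent.2 (hmem n))

theorem finrank_primComponent (n : ℕ) :
    Module.finrank ℚ (primComponent n) = Module.finrank ℚ (dendDeg n) := by
  have : primComponent n = (dendDeg n).comap Splus.subtype := by
    ext x
    exact mem_primComponent
  rw [this]
  exact (Submodule.comapSubtypeEquivOfLe (dendDeg_le_Splus n)).finrank_eq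

/-! ### Freeness -/

theorem isDendriform_plus : IsDendriform precPlus succPlus where
  prec_prec x y z := Subtype.ext (by
    have := prec_prec (x : S) y z
    rwa [mul_eq_left y.2] at this)
  succ_succ x y z := Subtype.ext (by
    have := succ_succ (x : S) y z
    rwa [mul_eq_left x.2] at this)
  succ_prec x y z := Subtype.ext (succ_prec (x : S) y z)

/-- Generation, hence uniqueness of the extension: each component of positive weight is spanned by
dendriform primitive elements and products of lighter elements. -/
theorem Splus_le_of_closed {E : Submodule ℚ S} (hV : ∀ n, dendDeg n ≤ E)
    (hprec : ∀ x ∈ E, ∀ y ∈ E, prec x y ∈ E) (hsucc : ∀ x ∈ E, ∀ y ∈ E, succ x y ∈ E) :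
    Splus ≤ E := by
  have key : ∀ n, 0 < n → weightComponent n ≤ E := by
    intro n
    induction n using Nat.strong_induction_on with
    | _ n ih =>
    intro hn
    refine (weightComponent_le_dendDeg hn).trans
      (sup_le (sup_le (hV n) ((mixedDeg_le_prodDeg n).trans ?_)) ?_)
    · refine Submodule.span_le.2 ?_
      rintro _ ⟨i, j, hi, hj, rfl, y, hy, z, hz, rfl⟩
      exact hsucc _ (ih i (by omega) hi hy) _ (ih j (by omega) hj hz)
    · refine Submodule.span_le.2 ?_
      rintro _ ⟨i, j, hi, hj, rfl, y, hy, z, hz, rfl⟩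
      exact hprec _ (ih i (by omega) hi hy) _ (ih j (by omega) hj hz)
  intro x hx
  induction hx using Splus_induction with
  | hzero => exact zero_mem _
  | hadd x x' _ _ hx hx' => exact add_mem hx hx'
  | hsmul c x _ hx => exact Submodule.smul_mem _ c hx
  | hsingle p hp => exact key _ (weight_pos.2 hp) (single_mem_weightComponent p)

theorem eq_of_eq_on_primDend {D : Type*} [AddCommGroup D] [Module ℚ D]
    {precD succD : D →ₗ[ℚ] D →ₗ[ℚ] D} {F G : Splus →ₗ[ℚ] D}
    (hF : ∀ x y, F (precPlus x y) = precD (F x) (F y))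
    (hF' : ∀ x y, F (succPlus x y) = succD (F x) (F y))
    (hG : ∀ x y, G (precPlus x y) = precD (G x) (G y))
    (hG' : ∀ x y, G (succPlus x y) = succD (G x) (G y))
    (h : ∀ a ∈ primDend, F a = G a) : F = G := by
  have hle : Splus ≤ (LinearMap.eqLocus F G).map Splus.subtype := by
    refine Splus_le_of_closed (fun n v hv => ?_) ?_ ?_
    · exact ⟨⟨v, dendDeg_le_Splus n hv⟩, h _ (mem_primDend.2 hv.1), rfl⟩
    · rintro _ ⟨x, hx, rfl⟩ _ ⟨y, hy, rfl⟩
      refine ⟨precPlus x y, ?_, rfl⟩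
      change F x = G x at hx
      change F y = G y at hy
      change F _ = G _
      rw [hF, hG, hx, hy]
    · rintro _ ⟨x, hx, rfl⟩ _ ⟨y, hy, rfl⟩
      refine ⟨succPlus x y, ?_, rfl⟩
      change F x = G x at hx
      change F y = G y at hy
      change F _ = G _
      rw [hF', hG', hx, hy]
  ext1 x
  obtain ⟨y, hy, hyx⟩ := hle x.2
  rw [← Subtype.ext hyx]
  exact hy

theorem isFreelyGeneratedBy_primDend :
    IsFreelyGeneratedBy.{u} precPlus succPlus primDend := by
  refine ⟨isDendriform_plus, fun D _ _ precD succD hD f => ?_⟩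
  -- An arbitrary linear extension to `S`; the construction uses its values on dendriform primitive
  -- elements only.
  obtain ⟨f₁, hf₁⟩ := LinearMap.exists_extend f
  obtain ⟨f₂, hf₂⟩ := LinearMap.exists_extend f₁
  have hf : ∀ a : primDend, f₂ (a : Splus) = f a := fun a => by
    rw [← hf₁, ← hf₂]
    rfl
  have hprim : ∀ a ∈ primDend,
      (extension precD succD f₂ ∘ₗ Splus.subtype) a = (f₂ ∘ₗ Splus.subtype) a := by
    intro a ha
    rw [← iSup_primComponent] at ha
    induction ha using Submodule.iSup_induction' with
    | mem n x hx => exact extension_of_mem_dendDeg f₂ (mem_primComponent.1 hx)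
    | zero => rw [map_zero, map_zero]
    | add x y _ _ hx hy => rw [map_add, map_add, hx, hy]
  refine ⟨extension precD succD f₂ ∘ₗ Splus.subtype,
    ⟨fun x y => extension_prec hD f₂ x.2 y.2, fun x y => extension_succ hD f₂ x.2 y.2,
      fun a => (hprim a a.2).trans (hf a)⟩, ?_⟩
  rintro G ⟨hG, hG', hGf⟩
  refine eq_of_eq_on_primDend hG hG' (fun x y => extension_prec hD f₂ x.2 y.2)
    (fun x y => extension_succ hD f₂ x.2 y.2) fun a ha => ?_
  rw [hprim a ha]
  exact (hGf ⟨a, ha⟩).trans (hf ⟨a, ha⟩).symm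

/-! ### The action on the words of a graded alphabet -/

section Action

variable {X : Type*} (deg : X → ℕ+) (x₀ : X)

/-- The letter of the word `x` designated by a biletter, with default value `x₀`. -/
def letterAt (x : List X) (c : ℕ × ℕ+) : X := x.getD c.1 x₀

/-- The word obtained by letting a biword whose first row is a permutation act on the word `x`. -/
noncomputable def evalWord (x : List X) (w : List (ℕ × ℕ+)) : Sh X :=
  open scoped Classical in
  if w.length = x.length ∧ ∀ c ∈ w, deg (letterAt x₀ x c) = c.2 then
    Finsupp.single (w.map (letterAt x₀ x)) 1
  else 0

theorem actionBasis_single (p : GradedPerm) (x : List X) :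
    actionBasis deg p (Finsupp.single x 1) = evalWord deg x₀ x (biword p) := by
  rw [actionBasis, Finsupp.linearCombination_single, one_smul, evalWord, length_biword]
  by_cases h : p.1 = x.length
  · have hget : ∀ i, letterAt x₀ x ((p.2.1 i : ℕ), p.2.2 i) = x.get (Fin.cast h (p.2.1 i)) :=
      fun i => List.getD_eq_getElem _ _ (by rw [← h]; exact (p.2.1 i).2)
    have hmap : (biword p).map (letterAt x₀ x) =
        List.ofFn fun i => x.get (Fin.cast h (p.2.1 i)) := by
      rw [biword, List.map_ofFn]
      exact congrArg List.ofFn (funext hget)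
    rw [dif_pos h, hmap]
    have : (p.1 = x.length ∧ ∀ c ∈ biword p, deg (letterAt x₀ x c) = c.2) ↔
        ∀ i, deg (x.get (Fin.cast h (p.2.1 i))) = p.2.2 i := by
      rw [and_iff_right h]
      refine ⟨fun H i => ?_, fun H c hc => ?_⟩
      · rw [← hget]
        exact H _ ((List.mem_ofFn).2 ⟨i, rfl⟩)
      · obtain ⟨i, rfl⟩ := (List.mem_ofFn).1 hc
        rw [hget]
        exact H i
    simp only [this]
  · rw [dif_neg h, if_neg fun H => h H.1]

theorem action_single (p : GradedPerm) : action deg (Finsupp.single p 1) = actionBasis deg p := by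
  rw [action, Finsupp.linearCombination_single, one_smul]

theorem action_cls {w : List (ℕ × ℕ+)} {n : ℕ} (h : (letters w).Perm (List.range n))
    (x : List X) : action deg (cls w) (Finsupp.single x 1) = evalWord deg x₀ x w := by
  rw [cls, action_single, actionBasis_single deg x₀, biword_standardize_of_perm h]

/-- The length and degree conditions depend only on the multiset of biletters, so all shuffles of
`u` and `v` satisfy them or none does. -/
theorem lshSum_evalWord (x : List X) (u v : List (ℕ × ℕ+)) :
    lshSum u v (evalWord deg x₀ x) =
      open scoped Classical in
      if (u ++ v).length = x.length ∧ ∀ c ∈ u ++ v, deg (letterAt x₀ x c) = c.2 then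
        shPrec X (Finsupp.single (u.map (letterAt x₀ x)) 1)
          (Finsupp.single (v.map (letterAt x₀ x)) 1)
      else 0 := by
  classical
  have hw : ∀ w ∈ leftShuffles u v,
      ((w.length = x.length ∧ ∀ c ∈ w, deg (letterAt x₀ x c) = c.2) ↔
        ((u ++ v).length = x.length ∧ ∀ c ∈ u ++ v, deg (letterAt x₀ x c) = c.2)) := by
    intro w hw
    have hp := mem_leftShuffles_perm hw
    rw [hp.length_eq]
    simp only [hp.mem_iff]
  split_ifs with h
  · rw [shPrec, bilinearExt_single, leftShuffles_map, List.map_map, lshSum]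
    refine congrArg List.sum (List.map_congr_left fun w hw' => ?_)
    rw [evalWord, if_pos ((hw w hw').2 h)]
    rfl
  · rw [lshSum]
    refine List.sum_eq_zero fun t ht => ?_
    obtain ⟨w, hw', rfl⟩ := List.mem_map.1 ht
    rw [evalWord, if_neg fun H => h ((hw w hw').1 H)]

theorem letterAt_take {x : List X} {k : ℕ} {c : ℕ × ℕ+} (hc : c.1 < k) :
    letterAt x₀ (x.take k) c = letterAt x₀ x c := by
  rw [letterAt, letterAt, List.getD_eq_getElem?_getD, List.getD_eq_getElem?_getD,
    List.getElem?_take_of_lt hc]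

theorem letterAt_drop (x : List X) (k : ℕ) (c : ℕ × ℕ+) :
    letterAt x₀ (x.drop k) c = letterAt x₀ x (c.1 + k, c.2) := by
  rw [letterAt, letterAt, List.getD_eq_getElem?_getD, List.getD_eq_getElem?_getD,
    List.getElem?_drop, add_comm]

theorem letter_lt_of_mem_biword {p : GradedPerm} {c : ℕ × ℕ+} (hc : c ∈ biword p) : c.1 < p.1 :=
  lt_of_mem_letters_biword (List.mem_map_of_mem hc)

theorem evalWord_take_drop {M : Type*} [AddCommGroup M] [Module ℚ M]
    (Φ : Sh X →ₗ[ℚ] Sh X →ₗ[ℚ] M) (p q : GradedPerm) (x : List X) (hpq : x.length = p.1 + q.1) :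
    Φ (evalWord deg x₀ (x.take p.1) (biword p)) (evalWord deg x₀ (x.drop p.1) (biword q)) =
      open scoped Classical in
      if ∀ c ∈ biword p ++ shift p.1 (biword q), deg (letterAt x₀ x c) = c.2 then
        Φ (Finsupp.single ((biword p).map (letterAt x₀ x)) 1)
          (Finsupp.single ((shift p.1 (biword q)).map (letterAt x₀ x)) 1)
      else 0 := by
  classical
  have h1 : (biword p).map (letterAt x₀ (x.take p.1)) = (biword p).map (letterAt x₀ x) :=
    List.map_congr_left fun c hc => letterAt_take x₀ (letter_lt_of_mem_biword hc)
  have h2 : (biword q).map (letterAt x₀ (x.drop p.1)) =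
      (shift p.1 (biword q)).map (letterAt x₀ x) := by
    rw [shift, List.map_map]
    exact List.map_congr_left fun c _ => letterAt_drop x₀ x p.1 c
  have h3 : (∀ c ∈ biword p, deg (letterAt x₀ (x.take p.1) c) = c.2) ↔
      ∀ c ∈ biword p, deg (letterAt x₀ x c) = c.2 :=
    forall₂_congr fun c hc => by rw [letterAt_take x₀ (letter_lt_of_mem_biword hc)]
  have h4 : (∀ c ∈ biword q, deg (letterAt x₀ (x.drop p.1) c) = c.2) ↔
      ∀ c ∈ shift p.1 (biword q), deg (letterAt x₀ x c) = c.2 := by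
    rw [shift, List.forall_mem_map]
    exact forall₂_congr fun _ _ => by rw [letterAt_drop]
  have h5 : (biword p).length = (x.take p.1).length := by
    rw [length_biword, List.length_take, hpq]; omega
  have h6 : (biword q).length = (x.drop p.1).length := by
    rw [length_biword, List.length_drop, hpq]; omega
  simp only [evalWord, h1, h2, h3, h4, h5, h6, true_and, List.forall_mem_append]
  by_cases ha : ∀ c ∈ biword p, deg (letterAt x₀ x c) = c.2
  · by_cases hb : ∀ c ∈ shift p.1 (biword q), deg (letterAt x₀ x c) = c.2
    · rw [if_pos ha, if_pos hb, if_pos ⟨ha, hb⟩]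
    · rw [if_neg hb, map_zero, if_neg fun H => hb H.2]
  · rw [if_neg ha, map_zero, LinearMap.zero_apply,
      if_neg fun H => ha H.1]

/-- Of all deconcatenations of `x`, only the one after `p.1` letters is not killed by `p` for
reasons of length. It feeds `q` the later letters of `x`, which is what the shift records. -/
theorem lift_map_deconcatenation {M : Type*} [AddCommGroup M] [Module ℚ M]
    (Φ : Sh X →ₗ[ℚ] Sh X →ₗ[ℚ] M) (p q : GradedPerm) (x : List X) :
    TensorProduct.lift Φ (TensorProduct.map (actionBasis deg p) (actionBasis deg q)
        (deconcatenation X (Finsupp.single x 1))) =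
      open scoped Classical in
      if (biword p ++ shift p.1 (biword q)).length = x.length ∧
          ∀ c ∈ biword p ++ shift p.1 (biword q), deg (letterAt x₀ x c) = c.2 then
        Φ (Finsupp.single ((biword p).map (letterAt x₀ x)) 1)
          (Finsupp.single ((shift p.1 (biword q)).map (letterAt x₀ x)) 1)
      else 0 := by
  classical
  have hlen : (biword p ++ shift p.1 (biword q)).length = p.1 + q.1 := by
    rw [List.length_append, shift, List.length_map, length_biword, length_biword]
  rw [deconcatenation, Finsupp.linearCombination_single, one_smul, map_sum, map_sum, hlen]
  simp only [TensorProduct.map_tmul, TensorProduct.lift.tmul, actionBasis_single deg x₀]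
  have hzero : ∀ i ∈ Finset.range (x.length + 1), i ≠ p.1 →
      Φ (evalWord deg x₀ (x.take i) (biword p)) (evalWord deg x₀ (x.drop i) (biword q)) = 0 := by
    intro i hi hip
    rw [Finset.mem_range] at hi
    rw [evalWord, if_neg, map_zero, LinearMap.zero_apply]
    rintro ⟨h, -⟩
    rw [length_biword, List.length_take] at h
    omega
  by_cases hpq : p.1 + q.1 = x.length
  · rw [Finset.sum_eq_single_of_mem p.1 (Finset.mem_range.2 (by omega)) hzero,
      evalWord_take_drop deg x₀ Φ p q x hpq.symm]
    simp only [hpq, true_and]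
  · rw [if_neg fun H => hpq H.1]
    refine Finset.sum_eq_zero fun i hi => ?_
    rcases eq_or_ne i p.1 with rfl | hip
    · rw [Finset.mem_range] at hi
      rw [evalWord.eq_def _ _ (x.drop p.1), if_neg, map_zero]
      rintro ⟨h, -⟩
      rw [length_biword, List.length_drop] at h
      omega
    · exact hzero i hi hip

theorem action_lshSum_cls {u v : List (ℕ × ℕ+)} {n : ℕ}
    (h : (letters (u ++ v)).Perm (List.range n)) (x : List X) :
    action deg (lshSum u v cls) (Finsupp.single x 1) = lshSum u v (evalWord deg x₀ x) := by
  rw [map_lshSum]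
  change LinearMap.applyₗ (Finsupp.single x (1 : ℚ)) (lshSum u v fun w => action deg (cls w)) = _
  rw [map_lshSum]
  exact lshSum_congr fun w hw => action_cls deg x₀ ((hw.map _).trans h) x

/-! ### Compatibility of the action with the half-products -/

theorem action_prec [Nonempty X] (x y : S) :
    action deg (prec x y) = endPrec (action deg x) (action deg y) := by
  obtain ⟨x₀⟩ := ‹Nonempty X›
  induction x using S_induction with
  | hadd x x' hx hx' =>
    simp only [map_add, LinearMap.add_apply, hx, hx', endPrec, TensorProduct.map_add_left,
      LinearMap.add_comp, LinearMap.comp_add]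
  | hsmul c x hx =>
    simp only [map_smul, LinearMap.smul_apply, hx, endPrec, TensorProduct.map_smul_left,
      LinearMap.smul_comp, LinearMap.comp_smul]
  | hsingle p =>
  induction y using S_induction with
  | hadd x x' hx hx' =>
    simp only [map_add, hx, hx', endPrec, TensorProduct.map_add_right,
      LinearMap.add_comp, LinearMap.comp_add]
  | hsmul c x hx =>
    simp only [map_smul, hx, endPrec, TensorProduct.map_smul_right,
      LinearMap.smul_comp, LinearMap.comp_smul]
  | hsingle q =>
  refine Finsupp.lhom_ext' fun w => LinearMap.ext_ring ?_
  have hw := letters_append_shift_perm p q (List.Perm.refl _)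
  change action deg (prec _ _) (Finsupp.single w 1) = TensorProduct.lift (shPrec X) _
  rw [prec, bilinearExt_single, action_single, action_single]
  exact (action_lshSum_cls deg x₀ hw w).trans ((lshSum_evalWord deg x₀ w _ _).trans
    (lift_map_deconcatenation deg x₀ (shPrec X) p q w).symm)

theorem action_succ [Nonempty X] (x y : S) :
    action deg (succ x y) = endSucc (action deg x) (action deg y) := by
  obtain ⟨x₀⟩ := ‹Nonempty X›
  induction x using S_induction with
  | hadd x x' hx hx' =>
    simp only [map_add, LinearMap.add_apply, hx, hx', endSucc, TensorProduct.map_add_left,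
      LinearMap.add_comp, LinearMap.comp_add]
  | hsmul c x hx =>
    simp only [map_smul, LinearMap.smul_apply, hx, endSucc, TensorProduct.map_smul_left,
      LinearMap.smul_comp, LinearMap.comp_smul]
  | hsingle p =>
  induction y using S_induction with
  | hadd x x' hx hx' =>
    simp only [map_add, hx, hx', endSucc, TensorProduct.map_add_right,
      LinearMap.add_comp, LinearMap.comp_add]
  | hsmul c x hx =>
    simp only [map_smul, hx, endSucc, TensorProduct.map_smul_right,
      LinearMap.smul_comp, LinearMap.comp_smul]
  | hsingle q =>
  refine Finsupp.lhom_ext' fun w => LinearMap.ext_ring ?_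
  have hw := letters_append_shift_perm p q List.perm_append_comm
  change action deg (succ _ _) (Finsupp.single w 1) = TensorProduct.lift (shSucc X) _
  rw [succ, bilinearExt_single, action_single, action_single]
  refine (action_lshSum_cls deg x₀ hw w).trans ((lshSum_evalWord deg x₀ w _ _).trans
    (Eq.trans ?_ (lift_map_deconcatenation deg x₀ (shSucc X) p q w).symm))
  simp only [List.forall_mem_append, List.length_append]
  exact if_congr (by rw [add_comm, and_comm (a := ∀ c ∈ biword p, _)]) rfl rfl

/-! ### Faithfulness of the action -/

theorem exists_word (hX : ∀ n, {x | deg x = n}.Infinite) (p : GradedPerm) :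
    ∃ x : List X, x.Nodup ∧ x.length = p.1 ∧ ∀ c ∈ biword p, deg (letterAt x₀ x c) = c.2 := by
  have hE : ∀ n, ∃ e : ℕ → X, Function.Injective e ∧ ∀ j, deg (e j) = n := fun n =>
    ⟨fun j => (hX n).natEmbedding _ j, fun a b h => (hX n).natEmbedding _ |>.injective
      (Subtype.ext h), fun j => ((hX n).natEmbedding _ j).2⟩
  choose E hE hdeg using hE
  -- The letter at place `j` is the one read at position `σ⁻¹ j`, so its degree must be `d (σ⁻¹ j)`;
  -- indexing by `j` keeps letters of equal degree distinct.
  refine ⟨List.ofFn fun j => E (p.2.2 (p.2.1.symm j)) j, ?_, List.length_ofFn, ?_⟩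
  · rw [List.nodup_ofFn]
    intro i j h
    have h1 := congrArg deg h
    dsimp only at h h1
    rw [hdeg, hdeg] at h1
    rw [h1] at h
    exact Fin.ext (hE _ h)
  · intro c hc
    obtain ⟨i, rfl⟩ := (List.mem_ofFn).1 hc
    rw [letterAt, List.getD_eq_getElem _ _ (by rw [List.length_ofFn]; exact (p.2.1 i).2),
      List.getElem_ofFn, hdeg]
    simp

theorem eq_of_map_letterAt_eq {x : List X} (hx : x.Nodup) {u v : List (ℕ × ℕ+)}
    (hu : ∀ c ∈ u, c.1 < x.length ∧ deg (letterAt x₀ x c) = c.2)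
    (hv : ∀ c ∈ v, c.1 < x.length ∧ deg (letterAt x₀ x c) = c.2)
    (h : u.map (letterAt x₀ x) = v.map (letterAt x₀ x)) : u = v := by
  induction u generalizing v with
  | nil => exact (List.map_eq_nil_iff.1 h.symm).symm
  | cons a u ih =>
    cases v with
    | nil => exact List.map_eq_nil_iff.1 h
    | cons b v =>
      rw [List.map_cons, List.map_cons, List.cons.injEq] at h
      rw [List.forall_mem_cons] at hu hv
      have hab : a.1 = b.1 := by
        have h1 := h.1
        rw [letterAt, letterAt, List.getD_eq_getElem _ _ hu.1.1,
          List.getD_eq_getElem _ _ hv.1.1] at h1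
        exact (hx.getElem_inj_iff).1 h1
      rw [ih hu.2 hv.2 h.2, Prod.ext hab (by rw [← hu.1.2, ← hv.1.2, h.1])]

theorem action_injective (hX : ∀ n, {x | deg x = n}.Infinite) :
    Function.Injective (action deg) := by
  classical
  obtain ⟨x₀, -⟩ := (hX 1).nonempty
  rw [← LinearMap.ker_eq_bot, LinearMap.ker_eq_bot']
  intro z hz
  ext p
  obtain ⟨x, hx, hlen, hp⟩ := exists_word deg x₀ hX p
  -- The letters of `x` being distinct, the permuted word determines the permutation, and the
  -- degrees of its letters determine `d`. Its coefficient in the image of `x` therefore isolates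
  -- the coefficient of `p`.
  have key : ∀ z, action deg z (Finsupp.single x 1) ((biword p).map (letterAt x₀ x)) = z p := by
    intro z
    induction z using S_induction with
    | hadd z z' hz hz' => rw [map_add, LinearMap.add_apply, Finsupp.add_apply, hz, hz',
        Finsupp.add_apply]
    | hsmul c z hz => rw [map_smul, LinearMap.smul_apply, Finsupp.smul_apply, hz,
        Finsupp.smul_apply]
    | hsingle q =>
      rw [action_single, actionBasis_single deg x₀, evalWord]
      split_ifs with h
      · rw [Finsupp.single_apply, Finsupp.single_apply]
        refine if_congr ⟨fun H => biword_injective ?_, fun H => by rw [H]⟩ rfl rfl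
        rw [length_biword] at h
        exact eq_of_map_letterAt_eq deg x₀ hx
          (fun c hc => ⟨h.1 ▸ letter_lt_of_mem_biword hc, h.2 c hc⟩)
          (fun c hc => ⟨hlen ▸ letter_lt_of_mem_biword hc, hp c hc⟩) H
      · rw [Finsupp.zero_apply, Finsupp.single_eq_of_ne]
        rintro rfl
        exact h ⟨by rw [length_biword, hlen], hp⟩
  rw [← key z, hz]
  rfl

end Action

end GradedPermutations

theorem mainTheorem5 :
    -- The half-products of `S` are those of the endomorphisms of the shuffle algebra `Sh X`,
    -- for every graded alphabet `X` with infinitely many letters of each positive degree.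
    (∀ (X : Type v) (deg : X → ℕ+), (∀ n, {x | deg x = n}.Infinite) →
      Function.Injective (GradedPermutations.action deg) ∧
      ∀ x y : GradedPermutations.S,
        GradedPermutations.action deg (GradedPermutations.prec x y) =
          GradedPermutations.endPrec
            (GradedPermutations.action deg x) (GradedPermutations.action deg y) ∧
        GradedPermutations.action deg (GradedPermutations.succ x y) =
          GradedPermutations.endSucc
            (GradedPermutations.action deg x) (GradedPermutations.action deg y)) ∧
    -- The augmentation ideal is freely generated by its dendriform primitive elements.
    GradedPermutations.IsFreelyGeneratedBy.{u}
      GradedPermutations.precPlus GradedPermutations.succPlus GradedPermutations.primDend ∧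
    -- `R` is the generating series of `S`.
    (∀ n, Module.Finite ℚ (GradedPermutations.weightComponent n)) ∧
    (PowerSeries.mk fun n => (Module.finrank ℚ (GradedPermutations.weightComponent n) : ℚ)) =
      GradedPermutations.seriesR ∧
    -- The space of dendriform primitive elements is graded, with generating series `(R - 1) / R²`.
    (⨆ n, GradedPermutations.primComponent n) = GradedPermutations.primDend ∧
    (PowerSeries.mk fun n => (Module.finrank ℚ (GradedPermutations.primComponent n) : ℚ)) =
      (GradedPermutations.seriesR - 1) * (GradedPermutations.seriesR ^ 2)⁻¹ := by
  refine ⟨fun X deg hX => ⟨GradedPermutations.action_injective deg hX, fun x y => ?_⟩,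
    GradedPermutations.isFreelyGeneratedBy_primDend, GradedPermutations.finite_weightComponent,
    GradedPermutations.seriesR_eq.symm, GradedPermutations.iSup_primComponent, ?_⟩
  · have : Nonempty X := ⟨(hX 1).nonempty.some⟩
    exact ⟨GradedPermutations.action_prec deg x y, GradedPermutations.action_succ deg x y⟩
  · simp only [GradedPermutations.finrank_primComponent, GradedPermutations.seriesR_eq]
    exact GradedPermutations.seriesDend_eq
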